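/- **Setting.** Let $k$ be an algebraically closed field of characteristic $p>0$, and let $\mathcal X$ be a regular $k$-surface: a connected (hence integral) regular scheme over $k$ whose local ring at every closed point is 2-dimensional with residue field $k$. Let $K$ be the function field of $\mathcal X$, and let $L=K(x)$ with $x^p-x=a\in K$. Let $\mathcal Y\to\mathcal X$ be the normalization of $\mathcal X$ in $L$, and let $R$ be its reduced branch locus, i.e. the image of $\operatorname{Supp}\Omega^1_{\mathcal Y/\mathcal X}$. **Arcs.** An arc on $\mathcal X$ is a non-constant $k$-morphism $\mathcal C:\operatorname{Spec}k[[X]]\to\mathcal X$ mapping the closed point to a closed point $P_{\mathcal C}$, the center of $\mathcal C$. Let $f^{\mathcal C}:\mathcal O_{\mathcal X,P_{\mathcal C}}\to k[[X]]$ be the corresponding local homomorphism, let $\hat f^{\mathcal C}$ be its extension to the completion, and let $\mathcal R^{\mathcal C}=\operatorname{Im}\hat f^{\mathcal C}\subseteq k[[X]]$. Let $v_X$ be the valuation of $k[[X]]$. * The degree $d_{\mathcal C}$ is $v_X(t)$ for a uniformizer $t$ of the integral closure $\overline{\mathcal R^{\mathcal C}}$ of $\mathcal R^{\mathcal C}$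 in its fraction field. The arc is primitive if $d_{\mathcal C}=1$. * $E_{\mathcal C}=e(\mathcal R^{\mathcal C})\,d_{\mathcal C}$, where $e$ is the multiplicity: $\dim_k \mathcal R/\mathfrak m^n=e(\mathcal R)n+q$ for all large $n$. * $M_{\mathcal C}$ is the least number of quadratic transforms $\mathcal R\mapsto\mathcal R[z/x\mid z\in\mathfrak m]$ ($x$ a transversal parameter, i.e. $x\in\mathfrak m$ and $x+\mathfrak m^2$ is not nilpotent in $\operatorname{gr}_{\mathfrak m}\mathcal R$) that lead from $\mathcal R^{\mathcal C}$ to $\overline{\mathcal R^{\mathcal C}}$. * If $P_{\mathcal C}=P_{\mathcal D}$, then $(\mathcal C.\mathcal D)=d_{\mathcal D}\,v_X(\hat f^{\mathcal C}(g))\in\{0,1,\dots,\infty\}$, where $g$ generates $\operatorname{Ker}\hat f^{\mathcal D}$. If the centers differ, $(\mathcal C.\mathcal D)=0$. * For a prime divisor $F$ through $P_{\mathcal C}$, $(\mathcal C.F)=v_X(f^{\mathcal C}(t))$ with $t$ a local equation of $F$ at $P_{\mathcal C}$. For other prime divisors $(\mathcal C.F)=0$. This is extended linearly to divisors. Let $\mathbf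 U_{\mathcal X}$ be the set of arcs that do not map the generic point of $\operatorname{Spec}k[[X]]$ into $R$. For $\mathcal C\in\mathbf U_{\mathcal X}$ the fibre of $\mathcal Y\to\mathcal X$ over $\operatorname{Spec}k((X))\to\mathcal X$ is the spectrum of a product of copies of a finite Galois extension $L_{\mathcal C}/k((X))$. **Wild jumps.** With the ramification groups $G_j$ of $L_{\mathcal C}/k((X))$ in lower numbering, put for $i\ge1$ $$w^{(i)}_{\mathcal C}(L/K)=\frac{\min\{j\ge1: p^i\nmid |G_j|\}-1}{(G_0:G_1)} .$$ $L/K$ has equal wild jumps at $\mathcal C$ and $\mathcal D$ if $w^{(i)}_{\mathcal C}(L/K)=w^{(i)}_{\mathcal D}(L/K)$ for all $i\ge1$. **Proposition 6.1.** Assume that $R$ is a simple normal crossing divisor with components $F_i$. Put $m_i=-v_i(a)$, where $v_i$ is the valuation of $K$ associated with $F_i$, and $R_0=\sum_i(m_i+1)F_i$. Let $\mathcal C,\mathcal D\in\mathbf U_{\mathcal X}$ be primitive arcs with $P_{\mathcal C}=P_{\mathcal D}$ and $$(\mathcal C.\mathcal D)\ \ge\ (\mathcal C.R_0)\,E_{\mathcal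 D}+E_{\mathcal C}E_{\mathcal D}\max(M_{\mathcal C},M_{\mathcal D}).$$ Then $L/K$ has equal wild jumps at $\mathcal C$ and $\mathcal D$. -/

import Mathlib

open AlgebraicGeometry CategoryTheory IsLocalRing Order
open scoped PowerSeries TensorProduct

universe u v

noncomputable section

namespace ZhukovJets

/-! ### Ramification invariants

Here `R` is the valuation ring of a complete discrete valuation field `F`, and `M / F` is a finite
Galois extension. The valuation ring of `M` is the integral closure `O` of `R` in `M`; it is a
discrete valuation ring, and its Jacobson radical is its maximal ideal. -/

section Ramification

variable (R F M : Type*) [CommRing R] [Field F] [CommRing M] [Algebra R F] [Algebra F M]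
  [Algebra R M] [IsScalarTower R F M]

/-- The ramification group `G_j` in lower numbering: all `g` with `v (g a - a) ≥ j + 1` for every
`a` in the valuation ring `O` of `M`, i.e. `g a - a` lies in the `(j+1)`-st power of the maximal
ideal of `O`. -/
def ramificationGroup (j : ℕ) : Subgroup (M ≃ₐ[F] M) :=
  ((Ideal.jacobson (⊥ : Ideal (integralClosure R M)) ^ (j + 1) :
    Ideal (integralClosure R M)).toAddSubgroup).inertia (M ≃ₐ[F] M)

/-- The tame ramification index `(G_0 : G_1)`. -/
def tameIndex : ℕ :=
  (ramificationGroup R F M 1).relIndex (ramificationGroup R F M 0)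

/-- The `i`-th ramification jump, numbered from the bigger to the smaller ones:
`h⁽ⁱ⁾ = min {j ≥ 1 | p ^ i does not divide |G_j|} - 1`. -/
def ramificationJump (p i : ℕ) : ℕ :=
  sInf {j : ℕ | 1 ≤ j ∧ ¬ p ^ i ∣ Nat.card (ramificationGroup R F M j)} - 1

/-- The `i`-th wild jump `w⁽ⁱ⁾ = h⁽ⁱ⁾ / (G_0 : G_1)`. -/
def wildJump (p i : ℕ) : ℚ :=
  (ramificationJump R F M p i : ℚ) / (tameIndex R F M : ℚ)

end Ramification

/-! ### Algebroid curves inside `k⟦X⟧` -/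

section Algebroid

variable {k : Type u} [Field k]

/-- The maximal ideal of a subalgebra of `k⟦X⟧` (contraction of the maximal ideal of `k⟦X⟧`). -/
def curveIdeal (R : Subalgebra k k⟦X⟧) : Ideal R :=
  (maximalIdeal k⟦X⟧).comap (algebraMap R k⟦X⟧)

/-- The multiplicity `e(R)`: the unique `e` with `dim_k (R / 𝔪 ^ n) = e n + q` for all large `n`. -/
def curveMultiplicity (R : Subalgebra k k⟦X⟧) : ℕ :=
  sInf {e : ℕ | ∃ q : ℤ, ∀ᶠ n : ℕ in Filter.atTop,
    (Module.finrank k (R ⧸ curveIdeal R ^ n) : ℤ) = e * n + q}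

/-- `x ∈ 𝔪` is a transversal parameter if `x + 𝔪²` is not nilpotent in `gr_𝔪 R`. -/
def IsTransversal (R : Subalgebra k k⟦X⟧) (x : R) : Prop :=
  x ∈ curveIdeal R ∧ ∀ n : ℕ, x ^ n ∉ curveIdeal R ^ (n + 1)

/-- The quadratic transform `R[z / x | z ∈ 𝔪]`, where `x` is a transversal parameter. This ring
does not depend on `x`, so all transversal parameters are used at the same time. -/
def quadraticTransform (R : Subalgebra k k⟦X⟧) : Subalgebra k k⟦X⟧ :=
  Algebra.adjoin k ((R : Set k⟦X⟧) ∪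
    {y | ∃ x z : R, IsTransversal R x ∧ z ∈ curveIdeal R ∧ (x : k⟦X⟧) * y = z})

/-- The integral closure of `R` in its fraction field. It is contained in `k⟦X⟧`, which is
integrally closed. -/
def curveNormalization (R : Subalgebra k k⟦X⟧) : Set k⟦X⟧ :=
  {y | IsIntegral R y ∧ ∃ a b : R, b ≠ 0 ∧ (b : k⟦X⟧) * y = a}

/-- `M(R)`: the minimal number of quadratic transforms leading from `R` to its normalization. -/
def resolutionLength (R : Subalgebra k k⟦X⟧) : ℕ :=
  sInf {i : ℕ | ((quadraticTransform^[i] R : Subalgebra k k⟦X⟧) : Set k⟦X⟧) =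
    curveNormalization R}

/-- The degree: `v_X (t)`, where `t` is a uniformizer of the normalization of `R`, i.e. the least
positive `X`-adic valuation of an element of the normalization. -/
def curveDegree (R : Subalgebra k k⟦X⟧) : ℕ :=
  sInf {n : ℕ | 0 < n ∧ ∃ t ∈ curveNormalization R, t.order = (n : ℕ∞)}

end Algebroid

/-! ### Arcs on local rings -/

section LocalArc

variable {k : Type u} [Field k] {A : Type u} [CommRing A] [IsLocalRing A]

theorem maximalIdeal_pow_le_comap (f : A →+* k⟦X⟧) [IsLocalHom f] (n : ℕ) :
    maximalIdeal A ^ n ≤ (Ideal.span {(PowerSeries.X : k⟦X⟧)} ^ n).comap f := by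
  rw [← PowerSeries.maximalIdeal_eq_span_X, ← Ideal.map_le_iff_le_comap, Ideal.map_pow]
  refine Ideal.pow_right_mono (Ideal.map_le_iff_le_comap.mpr ?_) n
  exact fun a ha => map_nonunit f a ha

/-- The homomorphisms `Â → A / 𝔪 ^ n → k⟦X⟧ / (X ^ n)` induced by `f`. -/
def truncatedHom (f : A →+* k⟦X⟧) [IsLocalHom f] (n : ℕ) :
    AdicCompletion (maximalIdeal A) A →+* k⟦X⟧ ⧸ Ideal.span {(PowerSeries.X : k⟦X⟧)} ^ n :=
  (Ideal.quotientMap (Ideal.span {(PowerSeries.X : k⟦X⟧)} ^ n) f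
    (maximalIdeal_pow_le_comap f n)).comp
    (AdicCompletion.evalₐ (maximalIdeal A) n : _ →+* _)

theorem truncatedHom_compat (f : A →+* k⟦X⟧) [IsLocalHom f] {m n : ℕ} (hle : m ≤ n) :
    (Ideal.Quotient.factorPow (Ideal.span {(PowerSeries.X : k⟦X⟧)}) hle).comp
      (truncatedHom f n) = truncatedHom f m := by
  ext x
  obtain ⟨y, rfl⟩ := AdicCompletion.mk_surjective _ _ x
  have h := y.property hle
  rw [SModEq.sub_mem] at h
  have h2 : y.val m - y.val n ∈ maximalIdeal A ^ m := by simpa using h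
  have h3 := maximalIdeal_pow_le_comap f m h2
  rw [Ideal.mem_comap, map_sub] at h3
  simp only [truncatedHom, RingHom.coe_comp, RingHom.coe_coe, Function.comp_apply,
    AdicCompletion.evalₐ_mk, Ideal.quotientMap_mk]
  exact ((Ideal.Quotient.mk_eq_mk_iff_sub_mem _ _).mpr h3).symm

/-- The homomorphism `f̂ : Â → k⟦X⟧` induced on completions by a local homomorphism
`f : A → k⟦X⟧`. -/
def completedHom (f : A →+* k⟦X⟧) [IsLocalHom f] :
    AdicCompletion (maximalIdeal A) A →+* k⟦X⟧ :=
  IsAdicComplete.liftRingHom (Ideal.span {(PowerSeries.X : k⟦X⟧)}) (truncatedHom f)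
    (truncatedHom_compat f)

theorem completedHom_of (f : A →+* k⟦X⟧) [IsLocalHom f] (a : A) :
    completedHom f (AdicCompletion.of _ _ a) = f a := by
  refine (IsHausdorff.eq_iff_smodEq (I := Ideal.span {(PowerSeries.X : k⟦X⟧)})).mpr fun n => ?_
  rw [SModEq.sub_mem, smul_eq_mul, Ideal.mul_top, ← Ideal.Quotient.mk_eq_mk_iff_sub_mem,
    completedHom, IsAdicComplete.mk_liftRingHom _ _ (truncatedHom_compat f)]
  simp [truncatedHom]

/-- The algebroid curve `R^𝒞 = Im f̂`, a `k`-subalgebra of `k⟦X⟧`. -/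
def arcCurve (f : A →+* k⟦X⟧) [IsLocalHom f] (hf : ∀ c : k, ∃ a, f a = PowerSeries.C c) :
    Subalgebra k k⟦X⟧ where
  __ := (completedHom f).range
  algebraMap_mem' c := by
    obtain ⟨a, ha⟩ := hf c
    exact ⟨AdicCompletion.of _ _ a, (completedHom_of f a).trans ha⟩

/-- The algebra `k((X)) ⊗_A B`, where `A` acts on `k((X))` through `f : A → k⟦X⟧`. -/
def GenericFibre (f : A →+* k⟦X⟧) (B : Type v) [CommRing B] [Algebra A B] : Type (max u v) :=
  letI : Algebra A (LaurentSeries k) := ((algebraMap k⟦X⟧ (LaurentSeries k)).comp f).toAlgebra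
  LaurentSeries k ⊗[A] B

section GenericFibre

variable (f : A →+* k⟦X⟧) (B : Type v) [CommRing B] [Algebra A B]

instance : CommRing (GenericFibre f B) :=
  letI : Algebra A (LaurentSeries k) := ((algebraMap k⟦X⟧ (LaurentSeries k)).comp f).toAlgebra
  (inferInstance : CommRing (LaurentSeries k ⊗[A] B))

instance : Algebra (LaurentSeries k) (GenericFibre f B) :=
  letI : Algebra A (LaurentSeries k) := ((algebraMap k⟦X⟧ (LaurentSeries k)).comp f).toAlgebra
  (inferInstance : Algebra (LaurentSeries k) (LaurentSeries k ⊗[A] B))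

instance : Algebra k⟦X⟧ (GenericFibre f B) :=
  ((algebraMap (LaurentSeries k) (GenericFibre f B)).comp
    (algebraMap k⟦X⟧ (LaurentSeries k))).toAlgebra

instance : IsScalarTower k⟦X⟧ (LaurentSeries k) (GenericFibre f B) := .of_algebraMap_eq' rfl

end GenericFibre

end LocalArc

/-! ### Surfaces, branch divisors and arcs -/

section Surface

variable {k : Type u} [Field k] {X : Scheme.{u}}

/-- `X` is a regular surface over `k` (the integral, locally Noetherian scheme `X` being given with
its structure morphism `s`): all local rings are regular, and at each closed point the local ring
has dimension 2 and its residue field is `k`. -/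
structure IsRegularSurface (s : X ⟶ Spec (.of k)) : Prop where
  regular : ∀ P : X, IsRegularLocalRing (X.presheaf.stalk P)
  dim_eq_two : ∀ P : X, IsClosed {P} → ringKrullDim (X.presheaf.stalk P) = 2
  residue : ∀ P : X, IsClosed {P} → Function.Bijective (s.residueFieldMap P)

section Branch

variable [IsIntegral X] (L : Type v) [Field L] [Algebra X.functionField L]

/-- The normalization of `X` in `L`, over the local scheme at `P`: the integral closure of `𝒪_{X,P}`
in the extension `L` of the function field. -/
def LocalNormalization (P : X) : Type v :=
  letI : Algebra (X.presheaf.stalk P) L :=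
    ((algebraMap X.functionField L).comp
      (algebraMap (X.presheaf.stalk P) X.functionField)).toAlgebra
  integralClosure (X.presheaf.stalk P) L

instance (P : X) : CommRing (LocalNormalization L P) :=
  letI : Algebra (X.presheaf.stalk P) L :=
    ((algebraMap X.functionField L).comp
      (algebraMap (X.presheaf.stalk P) X.functionField)).toAlgebra
  (inferInstance : CommRing (integralClosure (X.presheaf.stalk P) L))

instance (P : X) : Algebra (X.presheaf.stalk P) (LocalNormalization L P) :=
  letI : Algebra (X.presheaf.stalk P) L :=
    ((algebraMap X.functionField L).comp
      (algebraMap (X.presheaf.stalk P) X.functionField)).toAlgebra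
  (inferInstance : Algebra (X.presheaf.stalk P) (integralClosure (X.presheaf.stalk P) L))

/-- The branch locus `R = φ (Supp Ω¹_{Y/X})`, where `φ : Y → X` is the normalization of `X` in `L`:
a point `P` belongs to it iff `Ω¹_{Y/X}` does not vanish over the local scheme at `P`. -/
def branchLocus : Set X :=
  {P | Nontrivial (Ω[LocalNormalization L P⁄X.presheaf.stalk P])}

end Branch

/-- The prime ideal of `𝒪_{X,P}` of a generization `F` of `P`, i.e. the ideal at `P` of the integral
closed subscheme with the generic point `F`. -/
def primeAt {F P : X} (h : F ⤳ P) : Ideal (X.presheaf.stalk P) :=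
  (maximalIdeal (X.presheaf.stalk F)).comap (X.presheaf.stalkSpecializes h).hom

/-- A subset `R` of a regular surface is (the support of) a simple normal crossing divisor: at each
closed point of `R` there are local parameters `t, u` in the (Zariski) local ring such that `R` is
given by `t = 0` or by `t u = 0`. Since `t` and `u` are prime elements of the Zariski local ring,
they are local equations of distinct components of `R`, and the components are regular. -/
def IsSNC (R : Set X) : Prop :=
  ∀ P ∈ R, IsClosed {P} → ∃ t u : X.presheaf.stalk P,
    Ideal.span {t, u} = maximalIdeal (X.presheaf.stalk P) ∧
    ((∀ (F : X) (h : F ⤳ P), F ∈ R ↔ t ∈ primeAt h) ∨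
      (∀ (F : X) (h : F ⤳ P), F ∈ R ↔ t * u ∈ primeAt h))

/-- An arc on the `k`-scheme `X`: a non-constant `k`-morphism `Spec k⟦X⟧ → X` that maps the closed
point to a closed point. -/
structure Arc (s : X ⟶ Spec (.of k)) where
  hom : Spec (.of k⟦X⟧) ⟶ X
  hom_comp : hom ≫ s = Spec.map (CommRingCat.ofHom (PowerSeries.C : k →+* k⟦X⟧))
  isClosed_center : IsClosed {hom (closedPoint k⟦X⟧)}
  nonconstant : hom (⊥ : PrimeSpectrum k⟦X⟧) ≠ hom (closedPoint k⟦X⟧)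

namespace Arc

variable {s : X ⟶ Spec (.of k)} (C : Arc s)

/-- The center of an arc. -/
def center : X := C.hom (closedPoint k⟦X⟧)

/-- The local homomorphism `f^𝒞 : 𝒪_{X,P} → k⟦X⟧` of an arc with the center `P`. -/
def localHom (P : X) (h : C.center = P) : X.presheaf.stalk P →+* k⟦X⟧ :=
  (X.presheaf.stalkSpecializes (specializes_of_eq h) ≫ Scheme.stalkClosedPointTo C.hom).hom

theorem localHom_center :
    C.localHom C.center rfl = (Scheme.stalkClosedPointTo C.hom).hom := by
  rw [localHom]
  simp only [center, TopCat.Presheaf.stalkSpecializes_refl, Category.id_comp]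
  rfl

instance (P : X) (h : C.center = P) : IsLocalHom (C.localHom P h) := by
  subst h
  rw [localHom_center]
  exact Scheme.isLocalHom_stalkClosedPointTo' C.hom

theorem exists_stalkClosedPointTo_eq (g : Spec (.of k⟦X⟧) ⟶ Spec (.of k))
    (hg : g = Spec.map (CommRingCat.ofHom (PowerSeries.C : k →+* k⟦X⟧))) (c : k) :
    ∃ a, (Scheme.stalkClosedPointTo g).hom a = PowerSeries.C c := by
  subst hg
  have h := Scheme.germ_stalkClosedPointTo_Spec
    (CommRingCat.ofHom (PowerSeries.C : k →+* k⟦X⟧))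
  refine ⟨_, (congrArg (fun φ => φ.hom ((Scheme.ΓSpecIso (.of k)).inv c)) h).trans ?_⟩
  simp

theorem exists_localHom_eq (P : X) (h : C.center = P) (c : k) :
    ∃ a, C.localHom P h a = PowerSeries.C c := by
  subst h
  obtain ⟨a, ha⟩ := exists_stalkClosedPointTo_eq (C.hom ≫ s) C.hom_comp c
  rw [Scheme.stalkClosedPointTo_comp] at ha
  rw [localHom_center]
  exact ⟨_, ha⟩

/-- The algebroid curve `R^𝒞` of an arc. -/
def curve : Subalgebra k k⟦X⟧ :=
  arcCurve (C.localHom C.center rfl) (C.exists_localHom_eq C.center rfl)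

/-- The degree `d_𝒞`. -/
def degree : ℕ := curveDegree C.curve

/-- An arc is primitive if it has degree 1. -/
def IsPrimitive : Prop := C.degree = 1

/-- The multiplicity `E_𝒞 = e(R^𝒞) d_𝒞`. -/
def mult : ℕ := curveMultiplicity C.curve * C.degree

/-- The number `M_𝒞 = M(R^𝒞)`. -/
def resLength : ℕ := resolutionLength C.curve

open Classical in
/-- The intersection multiplicity `(𝒞.𝒟)`. It is `0` if the centers differ. Otherwise it equals
`d_𝒟 · v_X (f̂^𝒞 (g))` with `g` a generator of `Ker f̂^𝒟`; the infimum below is attained at `g`. -/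
def inter (C D : Arc s) : ℕ∞ :=
  if h : C.center = D.center then
    D.degree * ⨅ g ∈ RingHom.ker (completedHom (D.localHom D.center rfl)),
      (completedHom (C.localHom D.center h) g).order
  else 0

open Classical in
/-- The intersection multiplicity `(𝒞.F)` of an arc with the prime divisor with the generic point
`F`: the valuation `v_X (f^𝒞 (t))`, where `t` is a local equation of `F` at the center (the infimum
below is attained at `t`), and `0` if `F` does not pass through the center. -/
def interPrime (F : X) : ℕ∞ :=
  if h : F ⤳ C.center then ⨅ g ∈ primeAt h, (C.localHom C.center rfl g).order else 0

section Extension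

variable [IsIntegral X] (L : Type v) [Field L] [Algebra X.functionField L]

/-- The set `𝐔_X` of the arcs that do not lie on the branch locus. -/
def IsAdmissible : Prop := C.hom (⊥ : PrimeSpectrum k⟦X⟧) ∉ branchLocus L

/-- The coordinate ring `k((X)) ⊗_{𝒪_{X,P}} B` of the fibre of the normalization `Y → X` over the
generic point `Spec k((X)) → X` of an arc. With `Â` the completion of `𝒪_{X,P}` and `q = Ker f̂^𝒞`
the ideal of the support `[𝒞]`, the ring `Â ⊗ B` is étale over `Â` at `q` if the arc is admissible,
so that this is the product of the algebras `k(D) ⊗_{k([𝒞])} k((X))` over all prime divisors `D` of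
`Y ×_X Spec Â` lying over `[𝒞]`. If moreover `L` is Galois over the function field, it is a finite
product of copies of a Galois extension `L_𝒞` of `k((X))`. -/
abbrev FibreRing : Type (max u v) :=
  GenericFibre (C.localHom C.center rfl) (LocalNormalization L C.center)

/-- The wild jump `w_𝒞⁽ⁱ⁾`, computed for the extension `L_𝒞 / k((X))` which is the residue field at
a point `𝔪` of the fibre of the normalization over the generic point of the arc. -/
def wildJumpAt (p i : ℕ) (m : MaximalSpectrum (C.FibreRing L)) : ℚ :=
  wildJump k⟦X⟧ (LaurentSeries k) (C.FibreRing L ⧸ m.asIdeal) p i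

/-- `L` has equal wild jumps at `C` and `D`: all wild jumps coincide, for every choice of the fields
`L_C` and `L_D`. -/
def EqualWildJumps (p : ℕ) (C D : Arc s) : Prop :=
  ∀ (m : MaximalSpectrum (C.FibreRing L)) (n : MaximalSpectrum (D.FibreRing L)) (i : ℕ), 1 ≤ i →
    C.wildJumpAt L p i m = D.wildJumpAt L p i n

/-- The intersection number `(𝒞.R₀)` with `R₀ = ∑ (m_F + 1) F`, where `F` runs over the components
of the branch divisor, and `m_F = - v_F (a)`. -/
def interR0 [IsLocallyNoetherian X] (a : X.functionField) : ℤ :=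
  ∑ᶠ F : {F : X // F ∈ branchLocus L ∧ coheight F = 1},
    (- Scheme.ord a F.1 + 1) * ((C.interPrime F.1).toNat : ℤ)

end Extension

end Arc

end Surface

end ZhukovJets

end

/-! Let `A` be the local ring at the common center, `f` and `g` the homomorphisms `A → k⟦X⟧` of the
two arcs, and `N = (𝒞.R₀)`. If the center lies off the branch locus, both local extensions are
trivial. Otherwise the bound on the intersection number forces `f ≡ σ ∘ g` modulo `X ^ N` for an
automorphism `σ` of `k⟦X⟧`, and this precision suffices to identify the extensions over the two arcs
along `σ`.

Contact. The image `Γ` of the completion of `A` in `k⟦X⟧ × k⟦X⟧` is a plane curve with two branches;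
their intersection multiplicity is the least order of an `a` with `(a, 0) ∈ Γ`. A quadratic
transform of `Γ` transforms both branches and lowers this number by at most the product of their
multiplicities (`interGE_adjoin`). As long as the number stays positive, the branches keep a common
center. The curve of a primitive arc contains all series of large order, so quadratic transforms
lead it to `k⟦X⟧`. Thus `M = max(M_𝒞, M_𝒟)` transforms make both branches smooth at a cost of at
most `M E_𝒞 E_𝒟`, and contact at least `N` remains. Two smooth branches of contact `N` agree modulo
`X ^ N` up to a change of the parameter (`IsArcPair.exists_evalHom_congr`).

Representative. Where the extension is unramified, some integral element has a unit trace. Hence a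
power `r` of the local equation of the branch divisor is a trace `Tr b`. With `c = Tr(b x) / Tr b`,
the element `r (x - c)` is the sum of the `h(b) (x - h x)` over the Galois group, and `x - h x` is a
root of `T ^ p - T`; so `r (x - c)` is integral, and `a - (c ^ p - c)` has poles only on the branch
divisor (`exists_artinSchreier_representative`). Its pole orders are then lowered to the `m_i`, one
unit at a time (`exists_reduce_pole`): a pole beyond that of `a` comes from `c ^ p`, and its leading
term can be removed by a fraction with poles only on the branch divisor, because for parameters `t,
u` the nonzero elements of `A / t` are units times powers of `u`. This is where normal crossings
enter.

Comparison. Now the class of `a` is that of `n / d` with `d = t ^ m₁ u ^ m₂`, and the fields over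
the arcs are Artin–Schreier extensions of `k((X))` given by `f(n) / f(d)` and `g(n) / g(d)`. Modulo
`X ^ N` the denominators agree up to a factor `1 + f(d) w`; the summand `1` in `m_i + 1` provides
this factor. Hence `f(n) / f(d)` and the `σ`-image of `g(n) / g(d)` differ by a power series, which
has the form `γ ^ p - γ` because `k` is algebraically closed. The fields are therefore isomorphic
along `σ`, and such an isomorphism preserves the ramification groups (`wildJump_eq_of_semilinear`).
-/

noncomputable section

namespace ZhukovJets

/-! ### Substitution into power series -/

section Substitution

variable {k : Type u} [Field k]

/-- The substitution `X ↦ τ` as an endomorphism of `k⟦X⟧`. -/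
def evalHom (τ : k⟦X⟧) (hτ : PowerSeries.constantCoeff τ = 0) : k⟦X⟧ →ₐ[k] k⟦X⟧ :=
  PowerSeries.substAlgHom (PowerSeries.HasSubst.of_constantCoeff_zero' hτ)

theorem evalHom_X (τ : k⟦X⟧) (hτ) : evalHom τ hτ PowerSeries.X = τ :=
  PowerSeries.substAlgHom_X _

theorem evalHom_coe (τ : k⟦X⟧) (hτ) (p : Polynomial k) :
    evalHom τ hτ (p : k⟦X⟧) = Polynomial.aeval τ p :=
  PowerSeries.substAlgHom_coe _ _

theorem X_pow_dvd_iff_le_order {a : k⟦X⟧} {n : ℕ} :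
    (PowerSeries.X : k⟦X⟧) ^ n ∣ a ↔ (n : ℕ∞) ≤ a.order := by
  rw [PowerSeries.order_eq_emultiplicity_X, pow_dvd_iff_le_emultiplicity]

theorem X_pow_dvd_pow {τ : k⟦X⟧} (hτ : PowerSeries.constantCoeff τ = 0) (n : ℕ) :
    (PowerSeries.X : k⟦X⟧) ^ n ∣ τ ^ n :=
  pow_dvd_pow_of_dvd (PowerSeries.X_dvd_iff.mpr hτ) n

theorem X_pow_dvd_evalHom {τ : k⟦X⟧} (hτ) {n : ℕ} {c : k⟦X⟧} (hc : PowerSeries.X ^ n ∣ c) :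
    PowerSeries.X ^ n ∣ evalHom τ hτ c := by
  obtain ⟨d, rfl⟩ := hc
  rw [map_mul, map_pow, evalHom_X]
  exact (X_pow_dvd_pow hτ n).mul_right _

theorem X_pow_dvd_sub_trunc (n : ℕ) (c : k⟦X⟧) :
    (PowerSeries.X : k⟦X⟧) ^ n ∣ c - (PowerSeries.trunc n c : Polynomial k) := by
  rw [PowerSeries.X_pow_dvd_iff]
  intro m hm
  simp [PowerSeries.coeff_trunc, hm]

theorem eq_zero_of_forall_X_pow_dvd {a : k⟦X⟧} (h : ∀ n : ℕ, (PowerSeries.X : k⟦X⟧) ^ n ∣ a) :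
    a = 0 := by
  ext n
  exact (PowerSeries.X_pow_dvd_iff.mp (h (n + 1))) n (Nat.lt_succ_self n)

/-- Every power series divides `X ^ e`, where `e` is its order. -/
theorem exists_isUnit_mul_X_pow {τ : k⟦X⟧} {e : ℕ} (he : τ.order = e) :
    ∃ w : k⟦X⟧, IsUnit w ∧ τ = w * PowerSeries.X ^ e := by
  have h0 : τ ≠ 0 := by rintro rfl; simp at he
  refine ⟨τ.divXPowOrder, PowerSeries.isUnit_divided_by_X_pow_order h0, ?_⟩
  rw [mul_comm]
  have h := PowerSeries.X_pow_order_mul_divXPowOrder (f := τ)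
  rw [he] at h
  exact h.symm

theorem dvd_iff_order_le {a b : k⟦X⟧} : a ∣ b ↔ a.order ≤ b.order := by
  constructor
  · rintro ⟨c, rfl⟩
    rw [PowerSeries.order_mul]
    exact le_self_add
  · intro h
    by_cases ha : a = 0
    · subst ha
      simp only [PowerSeries.order_zero, top_le_iff, PowerSeries.order_eq_top] at h
      simp [h]
    · obtain ⟨w, hw, hw2⟩ := exists_isUnit_mul_X_pow (PowerSeries.coe_toNat_order ha).symm
      rw [← PowerSeries.coe_toNat_order ha, ← X_pow_dvd_iff_le_order] at h
      rw [hw2, hw.mul_left_dvd]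
      exact h

/-- Repeated division by `τ`, with remainders that are polynomials in `X` of degree less than `e`,
converges `X`-adically. This makes `k⟦X⟧` a finite module over `k⟦τ⟧` with `e` generators; both the
finiteness and the number `e` are used below. -/
theorem exists_evalHom_sum_eq {τ : k⟦X⟧} (hτ : PowerSeries.constantCoeff τ = 0) {e : ℕ}
    (he : τ.order = e) (y : k⟦X⟧) :
    ∃ c : Fin e → k⟦X⟧, y = ∑ i, evalHom τ hτ (c i) * PowerSeries.X ^ (i : ℕ) := by
  have hdvd : ∀ y : k⟦X⟧, ∃ z, y - (PowerSeries.trunc e y : Polynomial k) = τ * z := by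
    intro y
    refine dvd_iff_order_le.mpr ?_
    rw [he]
    exact X_pow_dvd_iff_le_order.mp (X_pow_dvd_sub_trunc e y)
  choose q hq using hdvd
  let Y : ℕ → k⟦X⟧ := fun n => q^[n] y
  have hY : ∀ n, Y n = (PowerSeries.trunc e (Y n) : Polynomial k) + τ * Y (n + 1) := by
    intro n
    have h1 : Y (n + 1) = q (Y n) := Function.iterate_succ_apply' q n y
    rw [h1, ← hq]
    ring
  -- The `i`-th coordinate collects the `i`-th coefficients of the successive quotients `Y j`, as
  -- coefficients of a series in `τ`.
  let c : Fin e → k⟦X⟧ := fun i => PowerSeries.mk fun j => PowerSeries.coeff i (Y j)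
  have htr : ∀ z : k⟦X⟧, ((PowerSeries.trunc e z : Polynomial k) : k⟦X⟧) =
      ∑ i : Fin e, PowerSeries.C (PowerSeries.coeff i z) * PowerSeries.X ^ (i : ℕ) := by
    intro z
    ext m
    simp only [Polynomial.coeff_coe, PowerSeries.coeff_trunc, map_sum,
      PowerSeries.coeff_C_mul_X_pow]
    split_ifs with h
    · rw [Finset.sum_eq_single (⟨m, h⟩ : Fin e)]
      · simp
      · intro b _ hb
        rw [if_neg]
        rintro rfl
        exact hb rfl
      · simp
    · symm
      refine Finset.sum_eq_zero fun i _ => if_neg ?_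
      have := i.2
      omega
  have hsum : ∀ J : ℕ, y = ∑ i : Fin e, evalHom τ hτ (PowerSeries.trunc J (c i) : Polynomial k)
      * PowerSeries.X ^ (i : ℕ) + τ ^ J * Y J := by
    intro J
    induction J with
    | zero => simp [Y]
    | succ J ih =>
      rw [ih, hY J, htr]
      simp only [PowerSeries.trunc_succ, evalHom_coe, map_add, Polynomial.aeval_monomial, add_mul,
        Finset.sum_add_distrib, c, PowerSeries.coeff_mk, mul_add, Finset.mul_sum]
      rw [add_assoc]
      congr 2
      · refine Finset.sum_congr rfl fun i _ => ?_
        rw [PowerSeries.algebraMap_apply]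
        simp
        ring
      · rw [pow_succ]
        ring
  refine ⟨c, sub_eq_zero.mp (eq_zero_of_forall_X_pow_dvd fun J => ?_)⟩
  nth_rewrite 1 [hsum J]
  rw [add_sub_right_comm, ← Finset.sum_sub_distrib]
  refine dvd_add (Finset.dvd_sum fun i _ => ?_) ((X_pow_dvd_pow hτ J).mul_right _)
  rw [← sub_mul, ← map_sub]
  refine (X_pow_dvd_evalHom hτ ?_).mul_right _
  rw [← neg_sub]
  exact (X_pow_dvd_sub_trunc J (c i)).neg_right

theorem evalHom_injective {τ : k⟦X⟧} (hτ) (h0 : τ ≠ 0) : Function.Injective (evalHom τ hτ) := by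
  rw [injective_iff_map_eq_zero]
  intro c hc
  by_contra hc0
  obtain ⟨w, hw, hw2⟩ := exists_isUnit_mul_X_pow (PowerSeries.coe_toNat_order hc0).symm
  rw [hw2, map_mul, map_pow, evalHom_X] at hc
  rcases mul_eq_zero.mp hc with h | h
  · exact (hw.map (evalHom τ hτ)).ne_zero h
  · exact pow_ne_zero _ h0 h

theorem constantCoeff_evalHom {τ : k⟦X⟧} (hτ) (c : k⟦X⟧) :
    PowerSeries.constantCoeff (evalHom τ hτ c) = PowerSeries.constantCoeff c := by
  have h1 : PowerSeries.X ∣ c - PowerSeries.C (PowerSeries.constantCoeff c) := by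
    rw [PowerSeries.X_dvd_iff]; simp
  have h2 := X_pow_dvd_evalHom hτ (n := 1) (by simpa using h1)
  rw [pow_one, PowerSeries.X_dvd_iff, map_sub, map_sub] at h2
  have h3 : evalHom τ hτ (PowerSeries.C (PowerSeries.constantCoeff c)) =
      PowerSeries.C (PowerSeries.constantCoeff c) := (evalHom τ hτ).commutes _
  rw [h3] at h2
  simpa [sub_eq_zero] using h2

end Substitution

/-! ### Closed submodules -/

/-- Krull's intersection theorem: additive subgroups of a finite algebra over a Noetherian local
ring which are stable under the base ring are closed. -/
theorem mem_of_forall_exists_sub_mem {Λ : Type*} {V : Type*} [CommRing Λ] [IsLocalRing Λ]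
    [IsNoetherianRing Λ] [CommRing V] (φ : Λ →+* V) (hφ : φ.Finite) (N : AddSubgroup V)
    (hN : ∀ c, ∀ n ∈ N, φ c * n ∈ N) (w : V)
    (h : ∀ j : ℕ, ∃ n ∈ N, w - n ∈ (maximalIdeal Λ ^ j).map φ) : w ∈ N := by
  algebraize [φ]
  let N' : Submodule Λ V :=
    { N with smul_mem' := fun c x hx => by rw [Algebra.smul_def]; exact hN c x hx }
  have : IsHausdorff (maximalIdeal Λ) (V ⧸ N') := inferInstance
  have h0 : (Submodule.Quotient.mk w : V ⧸ N') = 0 := by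
    refine this.haus _ fun j => ?_
    obtain ⟨n, hn, hw⟩ := h j
    have h1 : w - n ∈ (maximalIdeal Λ ^ j • ⊤ : Submodule Λ V) := by
      rw [Ideal.smul_top_eq_map]
      exact hw
    have h2 : (Submodule.Quotient.mk w : V ⧸ N') = N'.mkQ (w - n) := by
      rw [map_sub]
      have : N'.mkQ n = 0 := by
        rw [Submodule.mkQ_apply, Submodule.Quotient.mk_eq_zero]
        exact hn
      rw [this, sub_zero]
      rfl
    rw [SModEq.zero, h2]
    have h3 := Submodule.mem_map_of_mem (f := N'.mkQ) h1
    rw [Submodule.map_smul''] at h3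
    exact Submodule.smul_mono le_rfl le_top h3
  rw [Submodule.Quotient.mk_eq_zero] at h0
  exact h0

theorem aeval_mem {R A : Type*} [CommSemiring R] [Semiring A] [Algebra R A] {S : Subalgebra R A}
    {x : A} (h : x ∈ S) (p : Polynomial R) : Polynomial.aeval x p ∈ S := by
  have h1 := (Polynomial.aeval (⟨x, h⟩ : S) p).2
  rwa [Polynomial.coe_aeval_mk_apply] at h1

theorem finite_of_forall_eq_sum {Λ V ι : Type*} [CommRing Λ] [CommRing V] [Fintype ι]
    (φ : Λ →+* V) (b : ι → V) (h : ∀ y, ∃ c : ι → Λ, y = ∑ i, φ (c i) * b i) : φ.Finite := by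
  algebraize [φ]
  refine Module.Finite.of_surjective (Fintype.linearCombination Λ b) fun y => ?_
  obtain ⟨c, hc⟩ := h y
  refine ⟨c, ?_⟩
  rw [hc, Fintype.linearCombination_apply]
  exact Finset.sum_congr rfl fun i _ => Algebra.smul_def _ _

/-! ### Closed subspaces of one or two copies of `k⟦X⟧` -/

section

variable {k : Type u} [Field k]

theorem evalHom_finite {τ : k⟦X⟧} (hτ) (h0 : τ ≠ 0) :
    (evalHom τ hτ : k⟦X⟧ →+* k⟦X⟧).Finite :=
  finite_of_forall_eq_sum _ (fun i : Fin τ.order.toNat => PowerSeries.X ^ (i : ℕ)) fun y =>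
    exists_evalHom_sum_eq hτ (PowerSeries.coe_toNat_order h0).symm y

/-- The substitution `X ↦ τ` with values in pairs of power series. -/
def pairHom (τ : k⟦X⟧ × k⟦X⟧) (h1 : PowerSeries.constantCoeff τ.1 = 0)
    (h2 : PowerSeries.constantCoeff τ.2 = 0) : k⟦X⟧ →ₐ[k] k⟦X⟧ × k⟦X⟧ :=
  (evalHom τ.1 h1).prod (evalHom τ.2 h2)

theorem pairHom_X (τ : k⟦X⟧ × k⟦X⟧) (h1 h2) : pairHom τ h1 h2 PowerSeries.X = τ :=
  Prod.ext (evalHom_X _ h1) (evalHom_X _ h2)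

theorem pairHom_coe (τ : k⟦X⟧ × k⟦X⟧) (h1 h2) (p : Polynomial k) :
    pairHom τ h1 h2 (p : k⟦X⟧) = Polynomial.aeval τ p := by
  refine Prod.ext ?_ ?_
  · refine (evalHom_coe _ h1 p).trans ?_
    exact Polynomial.aeval_algHom_apply (AlgHom.fst k k⟦X⟧ k⟦X⟧) τ p
  · refine (evalHom_coe _ h2 p).trans ?_
    exact Polynomial.aeval_algHom_apply (AlgHom.snd k k⟦X⟧ k⟦X⟧) τ p

theorem pairHom_finite {τ : k⟦X⟧ × k⟦X⟧} (h1 h2) (h01 : τ.1 ≠ 0) (h02 : τ.2 ≠ 0) :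
    (pairHom τ h1 h2 : k⟦X⟧ →+* k⟦X⟧ × k⟦X⟧).Finite := by
  refine finite_of_forall_eq_sum _ (Sum.elim
    (fun i : Fin τ.1.order.toNat => ((PowerSeries.X ^ (i : ℕ), 0) : k⟦X⟧ × k⟦X⟧))
    (fun i : Fin τ.2.order.toNat => ((0, PowerSeries.X ^ (i : ℕ)) : k⟦X⟧ × k⟦X⟧))) fun y => ?_
  obtain ⟨c, hc⟩ := exists_evalHom_sum_eq h1 (PowerSeries.coe_toNat_order h01).symm y.1
  obtain ⟨d, hd⟩ := exists_evalHom_sum_eq h2 (PowerSeries.coe_toNat_order h02).symm y.2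
  refine ⟨Sum.elim c d, ?_⟩
  rw [Fintype.sum_sum_type]
  refine Prod.ext ?_ ?_
  · simpa [pairHom, Prod.fst_sum] using hc
  · simpa [pairHom, Prod.snd_sum] using hd

theorem pow_dvd_of_X_pow_dvd {τ : k⟦X⟧} {j n : ℕ} {y : k⟦X⟧} (hn : τ.order.toNat * j ≤ n)
    (h0 : τ ≠ 0) (h : (PowerSeries.X : k⟦X⟧) ^ n ∣ y) : τ ^ j ∣ y := by
  refine dvd_trans ?_ h
  rw [dvd_iff_order_le, PowerSeries.order_pow, PowerSeries.order_X_pow,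
    ← PowerSeries.coe_toNat_order h0]
  rw [nsmul_eq_mul, mul_comm]
  exact_mod_cast hn

theorem mem_map_maximalIdeal_pow {V : Type*} [CommRing V] (φ : k⟦X⟧ →+* V) (j : ℕ) {w : V}
    (h : φ PowerSeries.X ^ j ∣ w) : w ∈ (maximalIdeal k⟦X⟧ ^ j).map φ := by
  rw [PowerSeries.maximalIdeal_eq_span_X, Ideal.span_singleton_pow, Ideal.map_span,
    Set.image_singleton, map_pow]
  exact Ideal.mem_span_singleton.mpr h

/-- Since `k⟦X⟧` is finite over `k⟦τ⟧`, Krull's theorem closes every `k⟦τ⟧`-submodule in the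
`τ`-adic topology, which is the `X`-adic one because `τ` is a unit times a power of `X`. -/
theorem mem_of_closed_single {τ : k⟦X⟧} (hτ) (h0 : τ ≠ 0) (N : AddSubgroup k⟦X⟧)
    (hN : ∀ c, ∀ n ∈ N, evalHom τ hτ c * n ∈ N) (w : k⟦X⟧)
    (h : ∀ j : ℕ, ∃ n ∈ N, PowerSeries.X ^ j ∣ w - n) : w ∈ N := by
  refine mem_of_forall_exists_sub_mem (evalHom τ hτ : k⟦X⟧ →+* k⟦X⟧) (evalHom_finite hτ h0) N hN w
    fun j => ?_
  obtain ⟨n, hn, hd⟩ := h (τ.order.toNat * j)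
  refine ⟨n, hn, mem_map_maximalIdeal_pow _ j ?_⟩
  rw [AlgHom.coe_toRingHom, evalHom_X]
  exact pow_dvd_of_X_pow_dvd le_rfl h0 hd

/-- Congruence of pairs of power series modulo `X ^ n`. -/
def PairCongr (n : ℕ) (v w : k⟦X⟧ × k⟦X⟧) : Prop :=
  PowerSeries.X ^ n ∣ v.1 - w.1 ∧ PowerSeries.X ^ n ∣ v.2 - w.2

theorem mem_of_closed_pair {τ : k⟦X⟧ × k⟦X⟧} (h1 h2) (h01 : τ.1 ≠ 0) (h02 : τ.2 ≠ 0)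
    (N : AddSubgroup (k⟦X⟧ × k⟦X⟧)) (hN : ∀ c, ∀ n ∈ N, pairHom τ h1 h2 c * n ∈ N)
    (w : k⟦X⟧ × k⟦X⟧) (h : ∀ j : ℕ, ∃ n ∈ N, PairCongr j w n) : w ∈ N := by
  refine mem_of_forall_exists_sub_mem (pairHom τ h1 h2 : k⟦X⟧ →+* k⟦X⟧ × k⟦X⟧)
    (pairHom_finite h1 h2 h01 h02) N hN w fun j => ?_
  obtain ⟨n, hn, hd1, hd2⟩ := h (max (τ.1.order.toNat * j) (τ.2.order.toNat * j))
  refine ⟨n, hn, mem_map_maximalIdeal_pow _ j ?_⟩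
  rw [AlgHom.coe_toRingHom, pairHom_X]
  obtain ⟨a, ha⟩ := pow_dvd_of_X_pow_dvd (le_max_left _ _) h01 hd1
  obtain ⟨b, hb⟩ := pow_dvd_of_X_pow_dvd (le_max_right _ _) h02 hd2
  exact ⟨(a, b), Prod.ext ha hb⟩

/-- Closedness of a set of pairs of power series in the `X`-adic topology. -/
def IsXClosed (S : Set (k⟦X⟧ × k⟦X⟧)) : Prop :=
  ∀ w, (∀ j : ℕ, ∃ n ∈ S, PairCongr j w n) → w ∈ S

/-- A power series in `τ` is the limit of its truncations, which are polynomials in `τ` and so lie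
in `Γ`. -/
theorem pairHom_mem {Γ : Subalgebra k (k⟦X⟧ × k⟦X⟧)} (hΓ : IsXClosed (Γ : Set (k⟦X⟧ × k⟦X⟧)))
    {τ : k⟦X⟧ × k⟦X⟧} (hτ : τ ∈ Γ) (h1 h2) (c : k⟦X⟧) : pairHom τ h1 h2 c ∈ Γ := by
  refine hΓ _ fun j => ⟨pairHom τ h1 h2 (PowerSeries.trunc j c : Polynomial k), ?_, ?_, ?_⟩
  · rw [pairHom_coe]
    exact aeval_mem hτ _
  · change PowerSeries.X ^ j ∣ evalHom τ.1 h1 _ - evalHom τ.1 h1 _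
    rw [← map_sub]
    exact X_pow_dvd_evalHom h1 (X_pow_dvd_sub_trunc j c)
  · change PowerSeries.X ^ j ∣ evalHom τ.2 h2 _ - evalHom τ.2 h2 _
    rw [← map_sub]
    exact X_pow_dvd_evalHom h2 (X_pow_dvd_sub_trunc j c)

/-- Containing `k⟦τ⟧` makes `Γ` a `k⟦τ⟧`-submodule of a finite module. In this way closedness passes
from a ring to all larger ones, in particular to quadratic transforms. -/
theorem isXClosed_of_pairHom_mem {Γ : Subalgebra k (k⟦X⟧ × k⟦X⟧)} {τ : k⟦X⟧ × k⟦X⟧} (h1 h2)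
    (h01 : τ.1 ≠ 0) (h02 : τ.2 ≠ 0) (h : ∀ c, pairHom τ h1 h2 c ∈ Γ) :
    IsXClosed (Γ : Set (k⟦X⟧ × k⟦X⟧)) := fun w hw =>
  mem_of_closed_pair h1 h2 h01 h02 Γ.toSubring.toAddSubgroup
    (fun c _ hn => Γ.mul_mem (h c) hn) w hw

end

/-! ### Algebroid curves containing a power of the maximal ideal -/

section

variable {k : Type u} [Field k]

/-- The subalgebra contains all power series of sufficiently large order. -/
def IsOpenCurve (R : Subalgebra k k⟦X⟧) : Prop :=
  ∃ c : ℕ, ∀ y : k⟦X⟧, PowerSeries.X ^ c ∣ y → y ∈ R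

/-- The least positive order of an element of `R`. -/
def curveOrder (R : Subalgebra k k⟦X⟧) : ℕ :=
  sInf {n : ℕ | 0 < n ∧ ∃ x ∈ R, x.order = (n : ℕ∞)}

theorem IsOpenCurve.mono {R S : Subalgebra k k⟦X⟧} (h : R ≤ S) (hR : IsOpenCurve R) :
    IsOpenCurve S := by
  obtain ⟨c, hc⟩ := hR
  exact ⟨c, fun y hy => h (hc y hy)⟩

theorem IsOpenCurve.nonempty {R : Subalgebra k k⟦X⟧} (hR : IsOpenCurve R) :
    {n : ℕ | 0 < n ∧ ∃ x ∈ R, x.order = (n : ℕ∞)}.Nonempty := by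
  obtain ⟨c, hc⟩ := hR
  exact ⟨c + 1, Nat.succ_pos _, PowerSeries.X ^ (c + 1), hc _ (pow_dvd_pow _ (Nat.le_succ c)),
    PowerSeries.order_X_pow _⟩

theorem IsOpenCurve.curveOrder_pos {R : Subalgebra k k⟦X⟧} (hR : IsOpenCurve R) :
    0 < curveOrder R :=
  (Nat.sInf_mem hR.nonempty).1

theorem IsOpenCurve.exists_order_eq {R : Subalgebra k k⟦X⟧} (hR : IsOpenCurve R) :
    ∃ x ∈ R, x.order = (curveOrder R : ℕ∞) :=
  (Nat.sInf_mem hR.nonempty).2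

theorem mem_curveIdeal {R : Subalgebra k k⟦X⟧} {x : R} :
    x ∈ curveIdeal R ↔ PowerSeries.constantCoeff (x : k⟦X⟧) = 0 := by
  rw [curveIdeal, Ideal.mem_comap, PowerSeries.maximalIdeal_eq_span_X,
    Ideal.mem_span_singleton, PowerSeries.X_dvd_iff]
  rfl

theorem X_pow_curveOrder_dvd {R : Subalgebra k k⟦X⟧} {x : k⟦X⟧} (hx : x ∈ R)
    (h : PowerSeries.constantCoeff x = 0) : PowerSeries.X ^ curveOrder R ∣ x := by
  by_cases h0 : x = 0
  · simp [h0]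
  rw [X_pow_dvd_iff_le_order, ← PowerSeries.coe_toNat_order h0]
  have h1 : x.order.toNat ≠ 0 := by
    intro h2
    have h3 := PowerSeries.coeff_order h0
    rw [h2] at h3
    exact h3 (by simpa using h)
  have h2 : curveOrder R ≤ x.order.toNat :=
    Nat.sInf_le ⟨Nat.pos_of_ne_zero h1, x, hx, (PowerSeries.coe_toNat_order h0).symm⟩
  exact_mod_cast h2

theorem constantCoeff_eq_zero_of_order {x : k⟦X⟧} {n : ℕ} (hn : 0 < n) (h : x.order = n) :
    PowerSeries.constantCoeff x = 0 := by
  rw [← PowerSeries.order_ne_zero_iff_constCoeff_eq_zero, h]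
  exact_mod_cast hn.ne'

theorem curveOrder_anti {R S : Subalgebra k k⟦X⟧} (h : R ≤ S) (hR : IsOpenCurve R) :
    curveOrder S ≤ curveOrder R := by
  obtain ⟨x, hx, hx2⟩ := hR.exists_order_eq
  exact Nat.sInf_le ⟨hR.curveOrder_pos, x, h hx, hx2⟩

theorem X_pow_dvd_of_mem_curveIdeal_pow {R : Subalgebra k k⟦X⟧} (n : ℕ) {x : R}
    (hx : x ∈ curveIdeal R ^ n) : PowerSeries.X ^ (curveOrder R * n) ∣ (x : k⟦X⟧) := by
  have h1 : curveIdeal R ≤ (Ideal.span {PowerSeries.X ^ curveOrder R}).comap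
      (algebraMap R k⟦X⟧) := fun y hy => by
    rw [Ideal.mem_comap, Ideal.mem_span_singleton]
    exact X_pow_curveOrder_dvd y.2 (mem_curveIdeal.mp hy)
  have h2 := (Ideal.pow_right_mono h1 n).trans (Ideal.le_comap_pow _ n) hx
  rwa [Ideal.mem_comap, Ideal.span_singleton_pow, Ideal.mem_span_singleton, ← pow_mul] at h2

/-- Each power of an element of order above the minimum `e` gains order over the same power of an
element `ξ` of order `e`. Once the gain exceeds the conductor exponent, the power lies in a higher
power of the maximal ideal. -/
theorem IsOpenCurve.isTransversal_iff {R : Subalgebra k k⟦X⟧} (hR : IsOpenCurve R) (x : R) :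
    IsTransversal R x ↔ (x : k⟦X⟧).order = (curveOrder R : ℕ∞) := by
  constructor
  · rintro ⟨hx, hn⟩
    have h1 := X_pow_curveOrder_dvd x.2 (mem_curveIdeal.mp hx)
    refine le_antisymm (le_of_not_gt fun hlt => ?_) (X_pow_dvd_iff_le_order.mp h1)
    obtain ⟨c, hc⟩ := hR
    have hR' : IsOpenCurve R := ⟨c, hc⟩
    obtain ⟨ξ, hξ, hξo⟩ := hR'.exists_order_eq
    set e := curveOrder R
    have h2 : ((e + 1 : ℕ) : ℕ∞) ≤ (x : k⟦X⟧).order := by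
      push_cast
      exact Order.add_one_le_of_lt hlt
    rw [← X_pow_dvd_iff_le_order] at h2
    have h3 := pow_dvd_pow_of_dvd h2 (e + c)
    obtain ⟨w, hw, hw2⟩ := exists_isUnit_mul_X_pow hξo
    -- The exponent `e + c` is chosen so that `(e + 1) (e + c) = e (e + c + 1) + c`: after division
    -- by `ξ ^ (e + c + 1)` an order of at least `c` is left.
    have h4 : ∃ y, PowerSeries.X ^ c ∣ y ∧ (x : k⟦X⟧) ^ (e + c) = ξ ^ (e + c + 1) * y := by
      obtain ⟨z, hz⟩ := h3
      obtain ⟨w', hw'⟩ := hw.exists_right_inv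
      refine ⟨PowerSeries.X ^ c * (w' ^ (e + c + 1) * z), Dvd.intro _ rfl, ?_⟩
      rw [hz, hw2]
      have : (w * w') ^ (e + c + 1) = 1 := by rw [hw', one_pow]
      calc _ = (w * w') ^ (e + c + 1) * (PowerSeries.X ^ (e + 1)) ^ (e + c) * z := by
            rw [this, one_mul]
        _ = _ := by ring
    obtain ⟨y, hy, hy2⟩ := h4
    refine hn (e + c) ?_
    have h5 : x ^ (e + c) = (⟨ξ, hξ⟩ : R) ^ (e + c + 1) * ⟨y, hc y hy⟩ := Subtype.ext hy2
    rw [h5]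
    refine Ideal.mul_mem_right _ _ (Ideal.pow_mem_pow ?_ _)
    exact mem_curveIdeal.mpr (constantCoeff_eq_zero_of_order hR'.curveOrder_pos hξo)
  · intro h
    refine ⟨mem_curveIdeal.mpr (constantCoeff_eq_zero_of_order hR.curveOrder_pos h), fun n hn => ?_⟩
    have h1 := X_pow_dvd_of_mem_curveIdeal_pow _ hn
    rw [X_pow_dvd_iff_le_order] at h1
    push_cast at h1
    rw [PowerSeries.order_pow, h, nsmul_eq_mul] at h1
    have h2 : curveOrder R * (n + 1) ≤ n * curveOrder R := by exact_mod_cast h1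
    have := hR.curveOrder_pos
    nlinarith

/-- The geometric series may be cut off after `c` terms, as the remainder is divisible by `X ^ c`
and so lies in `R`. -/
theorem IsOpenCurve.inv_mem {R : Subalgebra k k⟦X⟧} (hR : IsOpenCurve R) {w : k⟦X⟧} (hw : w ∈ R)
    (h0 : PowerSeries.constantCoeff w ≠ 0) : w⁻¹ ∈ R := by
  obtain ⟨c, hc⟩ := hR
  set a := PowerSeries.constantCoeff w with ha
  set m : k⟦X⟧ := 1 - PowerSeries.C a⁻¹ * w with hm
  have hC : ∀ b : k, PowerSeries.C b ∈ R := fun b => R.algebraMap_mem b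
  have hmR : m ∈ R := R.sub_mem R.one_mem (R.mul_mem (hC _) hw)
  have hm0 : PowerSeries.constantCoeff m = 0 := by
    simp [hm, ← ha, h0]
  have h1 : w⁻¹ = PowerSeries.C a⁻¹ * ∑ i ∈ Finset.range c, m ^ i + w⁻¹ * m ^ c := by
    have h2 := mul_neg_geom_sum m c
    have h3 : w⁻¹ * w = 1 := PowerSeries.inv_mul_cancel w h0
    have h4 : 1 - m = PowerSeries.C a⁻¹ * w := by rw [hm]; ring
    rw [h4] at h2
    calc w⁻¹ = w⁻¹ * (1 - m ^ c) + w⁻¹ * m ^ c := by ring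
      _ = _ := by
        rw [← h2]
        congr 1
        rw [show w⁻¹ * (PowerSeries.C a⁻¹ * w * ∑ i ∈ Finset.range c, m ^ i) =
          (w⁻¹ * w) * (PowerSeries.C a⁻¹ * ∑ i ∈ Finset.range c, m ^ i) by ring, h3, one_mul]
  rw [h1]
  exact R.add_mem (R.mul_mem (hC _) (R.sum_mem fun i _ => R.pow_mem hmR i))
    (hc _ ((X_pow_dvd_pow hm0 c).mul_left _))

theorem le_quadraticTransform (R : Subalgebra k k⟦X⟧) : R ≤ quadraticTransform R :=
  fun _ hx => Algebra.subset_adjoin (Or.inl hx)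

/-- A subalgebra is the quadratic transform if it is generated over `R` by quotients by a fixed
element of the least order and contains all of these quotients. -/
theorem IsOpenCurve.quadraticTransform_eq {R S : Subalgebra k k⟦X⟧} (hR : IsOpenCurve R)
    (hRS : R ≤ S) {ξ : k⟦X⟧} (hξ : ξ ∈ R) (hξo : ξ.order = (curveOrder R : ℕ∞))
    (h1 : ∀ y, ξ * y ∈ R → PowerSeries.constantCoeff (ξ * y) = 0 → y ∈ S)
    (h2 : S ≤ Algebra.adjoin k ((R : Set k⟦X⟧) ∪ {y | ξ * y ∈ R})) :
    quadraticTransform R = S := by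
  have hξ0 : PowerSeries.constantCoeff ξ = 0 :=
    constantCoeff_eq_zero_of_order hR.curveOrder_pos hξo
  apply le_antisymm
  · refine Algebra.adjoin_le ?_
    rintro y (hy | ⟨x, z, hx, hz, hxy⟩)
    · exact hRS hy
    · have hxo := (hR.isTransversal_iff x).mp hx
      -- Any other transversal parameter is `ξ` times a unit `w` of `S`, so division by it does not
      -- lead out of `S`.
      obtain ⟨w, hw⟩ : ξ ∣ (x : k⟦X⟧) := dvd_iff_order_le.mpr (by rw [hxo, hξo])
      have hwS : w ∈ S := h1 w (hw ▸ x.2) (by simp [hξ0])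
      have hw0 : PowerSeries.constantCoeff w ≠ 0 := by
        intro h
        rw [← PowerSeries.order_ne_zero_iff_constCoeff_eq_zero] at h
        apply h
        rw [hw, PowerSeries.order_mul, hξo] at hxo
        have h3 : ((curveOrder R : ℕ∞)) + w.order = curveOrder R + 0 := by rw [hxo, add_zero]
        exact ENat.add_right_injective_of_ne_top (ENat.natCast_ne_top _) h3
      have hwy : w * y ∈ S := by
        refine h1 _ ?_ (by simp [hξ0])
        rw [← mul_assoc, ← hw, hxy]
        exact z.2
      have : y = w⁻¹ * (w * y) := by
        rw [← mul_assoc, PowerSeries.inv_mul_cancel w hw0, one_mul]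
      rw [this]
      exact S.mul_mem ((hR.mono hRS).inv_mem hwS hw0) hwy
  · refine h2.trans (Algebra.adjoin_mono ?_)
    rintro y (hy | hy)
    · exact Or.inl hy
    · right
      exact ⟨⟨ξ, hξ⟩, ⟨ξ * y, hy⟩, (hR.isTransversal_iff _).mpr hξo,
        mem_curveIdeal.mpr (by simp [hξ0]), rfl⟩

/-- Polynomials in an element of order one approximate every series to order `c`, and the error lies
in `R`. -/
theorem IsOpenCurve.eq_top_of_curveOrder_eq_one {R : Subalgebra k k⟦X⟧} (hR : IsOpenCurve R)
    (h : curveOrder R = 1) : R = ⊤ := by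
  obtain ⟨ξ, hξ, hξo⟩ := hR.exists_order_eq
  rw [h] at hξo
  have hξ0 := constantCoeff_eq_zero_of_order one_pos hξo
  have happ : ∀ (n : ℕ) (y : k⟦X⟧), ∃ r ∈ R, ∃ z, y = r + ξ ^ n * z := by
    intro n
    induction n with
    | zero => exact fun y => ⟨0, R.zero_mem, y, by simp⟩
    | succ n ih =>
      intro y
      obtain ⟨r, hr, z, rfl⟩ := ih y
      have h1 : ξ ∣ z - PowerSeries.C (PowerSeries.constantCoeff z) := by
        rw [dvd_iff_order_le, hξo]
        refine X_pow_dvd_iff_le_order.mp ?_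
        rw [pow_one, PowerSeries.X_dvd_iff]
        simp
      obtain ⟨z', hz'⟩ := h1
      refine ⟨r + ξ ^ n * PowerSeries.C (PowerSeries.constantCoeff z),
        R.add_mem hr (R.mul_mem (R.pow_mem hξ n) (R.algebraMap_mem _)), z', ?_⟩
      rw [pow_succ, mul_assoc, ← hz']
      ring
  rw [eq_top_iff]
  intro y _
  obtain ⟨c, hc⟩ := hR
  obtain ⟨r, hr, z, rfl⟩ := happ c y
  exact R.add_mem hr (hc _ ((X_pow_dvd_pow hξ0 c).mul_right _))

/-- If nothing new arises, `R` is stable under division by `ξ`. The element `ξ ^ c X` has order at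
least `c` and lies in `R`, hence so does `X`. -/
theorem IsOpenCurve.eq_top_of_quadraticTransform_le {R : Subalgebra k k⟦X⟧} (hR : IsOpenCurve R)
    (h : quadraticTransform R ≤ R) : R = ⊤ := by
  obtain ⟨ξ, hξ, hξo⟩ := hR.exists_order_eq
  have hpos := hR.curveOrder_pos
  set e := curveOrder R with he
  have hdiv : ∀ y, ξ * y ∈ R → y ∈ R := fun y hy => h <| Algebra.subset_adjoin <| Or.inr
    ⟨⟨ξ, hξ⟩, ⟨ξ * y, hy⟩, (hR.isTransversal_iff _).mpr hξo,
      mem_curveIdeal.mpr (by simp [constantCoeff_eq_zero_of_order hpos hξo]), rfl⟩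
  have hdivn : ∀ (n : ℕ) y, ξ ^ n * y ∈ R → y ∈ R := by
    intro n
    induction n with
    | zero => intro y hy; simpa using hy
    | succ n ih => intro y hy; exact hdiv _ (ih _ (by rwa [← mul_assoc, ← pow_succ]))
  refine hR.eq_top_of_curveOrder_eq_one ?_
  obtain ⟨c, hc⟩ := hR
  have h1 : PowerSeries.X ∈ R := by
    refine hdivn c _ (hc _ ?_)
    exact (X_pow_dvd_pow (constantCoeff_eq_zero_of_order hpos hξo) c).mul_right _
  have h2 : curveOrder R ≤ 1 := Nat.sInf_le ⟨one_pos, _, h1, by simp⟩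
  omega

end

/-! ### The quadratic transform of a pair of algebroid curves -/

section

variable {k : Type u} [Field k]

/-- The first branch of a subalgebra of `k⟦X⟧ × k⟦X⟧`. -/
abbrev fstCurve (Γ : Subalgebra k (k⟦X⟧ × k⟦X⟧)) : Subalgebra k k⟦X⟧ :=
  Γ.map (AlgHom.fst k k⟦X⟧ k⟦X⟧)

/-- The second branch of a subalgebra of `k⟦X⟧ × k⟦X⟧`. -/
abbrev sndCurve (Γ : Subalgebra k (k⟦X⟧ × k⟦X⟧)) : Subalgebra k k⟦X⟧ :=
  Γ.map (AlgHom.snd k k⟦X⟧ k⟦X⟧)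

/-- A plane algebroid curve with two branches, given by the image of its ring in the product of
the normalizations of the branches. -/
structure IsArcPair (Γ : Subalgebra k (k⟦X⟧ × k⟦X⟧)) : Prop where
  constantCoeff_eq : ∀ w ∈ Γ, PowerSeries.constantCoeff w.1 = PowerSeries.constantCoeff w.2
  closed : IsXClosed (Γ : Set (k⟦X⟧ × k⟦X⟧))
  gen : ∃ x ∈ Γ, ∃ y ∈ Γ, PowerSeries.constantCoeff x.1 = 0 ∧ PowerSeries.constantCoeff y.1 = 0 ∧
    ∀ w ∈ Γ, PowerSeries.constantCoeff w.1 = 0 → ∃ a ∈ Γ, ∃ b ∈ Γ, w = x * a + y * b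
  open_fst : IsOpenCurve (fstCurve Γ)
  open_snd : IsOpenCurve (sndCurve Γ)

/-- The intersection multiplicity of the two branches is at least `n`. -/
def InterGE (Γ : Subalgebra k (k⟦X⟧ × k⟦X⟧)) (n : ℕ) : Prop :=
  ∀ a, ((a, 0) : k⟦X⟧ × k⟦X⟧) ∈ Γ → PowerSeries.X ^ n ∣ a

/-- Cayley–Hamilton for multiplication by `z`. The bound of the degree by the number of generators
is essential: it bounds the loss of intersection multiplicity in a quadratic transform. -/
theorem exists_monic_eval₂_eq_zero {Λ V ι : Type*} [CommRing Λ] [CommRing V] [Fintype ι]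
    (φ : Λ →+* V) (b : ι → V) (h : ∀ y, ∃ c : ι → Λ, y = ∑ i, φ (c i) * b i) (z : V) :
    ∃ H : Polynomial Λ, H.Monic ∧ H.natDegree ≤ Fintype.card ι ∧ H.eval₂ φ z = 0 := by
  classical
  algebraize [φ]
  have hb : Submodule.span Λ (Set.range b) = ⊤ := by
    rw [eq_top_iff]
    intro y _
    obtain ⟨c, hc⟩ := h y
    rw [hc]
    refine Submodule.sum_mem _ fun i _ => ?_
    have := Submodule.smul_mem _ (c i) (Submodule.subset_span (R := Λ) (Set.mem_range_self (f := b) i))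
    rwa [Algebra.smul_def] at this
  obtain ⟨M, hM⟩ := Matrix.isRepresentation.toEnd_surjective Λ b hb (Algebra.lmul Λ V z)
  refine ⟨M.1.charpoly, M.1.charpoly_monic, ?_, ?_⟩
  · nontriviality Λ
    exact (Matrix.charpoly_natDegree_eq_dim _).le
  · have h1 : Polynomial.aeval M M.1.charpoly = 0 := by
      apply Subtype.ext
      rw [Polynomial.aeval_subalgebra_coe, Matrix.aeval_self_charpoly]
      rfl
    have h2 := congrArg (Matrix.isRepresentation.toEnd Λ b hb) h1
    rw [← Polynomial.aeval_algHom_apply, hM, map_zero, Polynomial.aeval_algHom_apply] at h2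
    have h3 : Polynomial.aeval z M.1.charpoly * 1 = 0 := congrArg (fun F => F 1) h2
    rwa [mul_one] at h3

variable {Γ : Subalgebra k (k⟦X⟧ × k⟦X⟧)}

theorem IsArcPair.constantCoeff_snd (hΓ : IsArcPair Γ) {w : k⟦X⟧ × k⟦X⟧} (hw : w ∈ Γ)
    (h : PowerSeries.constantCoeff w.1 = 0) : PowerSeries.constantCoeff w.2 = 0 :=
  (hΓ.constantCoeff_eq w hw).symm.trans h

theorem order_add_eq_of_lt {a b : k⟦X⟧} (h : a.order < b.order) : (a + b).order = a.order := by
  rw [PowerSeries.order_add_of_order_ne _ _ h.ne, min_eq_left h.le]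

/-- There is an element of `Γ` that has the least order on both branches. -/
theorem IsArcPair.exists_order_eq (hΓ : IsArcPair Γ) :
    ∃ τ ∈ Γ, τ.1.order = (curveOrder (fstCurve Γ) : ℕ∞) ∧
      τ.2.order = (curveOrder (sndCurve Γ) : ℕ∞) := by
  obtain ⟨_, ⟨v, hv, rfl⟩, hvo⟩ := hΓ.open_fst.exists_order_eq
  obtain ⟨_, ⟨w, hw, rfl⟩, hwo⟩ := hΓ.open_snd.exists_order_eq
  simp only [RingHom.coe_coe, AlgHom.fst_apply, AlgHom.snd_apply] at hvo hwo
  have hv1 := constantCoeff_eq_zero_of_order hΓ.open_fst.curveOrder_pos hvo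
  have hw2 := constantCoeff_eq_zero_of_order hΓ.open_snd.curveOrder_pos hwo
  have hv2 := hΓ.constantCoeff_snd hv hv1
  have hw1 := (hΓ.constantCoeff_eq w hw).trans hw2
  have h1 := X_pow_dvd_iff_le_order.mp (X_pow_curveOrder_dvd (R := fstCurve Γ) ⟨w, hw, rfl⟩ hw1)
  have h2 := X_pow_dvd_iff_le_order.mp (X_pow_curveOrder_dvd (R := sndCurve Γ) ⟨v, hv, rfl⟩ hv2)
  rcases h1.eq_or_lt with h1 | h1
  · exact ⟨w, hw, h1.symm, hwo⟩
  rcases h2.eq_or_lt with h2 | h2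
  · exact ⟨v, hv, hvo, h2.symm⟩
  refine ⟨v + w, Γ.add_mem hv hw, ?_, ?_⟩
  · rw [Prod.fst_add, order_add_eq_of_lt (hvo ▸ h1), hvo]
  · rw [Prod.snd_add, add_comm, order_add_eq_of_lt (hwo ▸ h2), hwo]

/-- Writing `w = a + m` with `a` its constant term, the inverse is the value at `m` of the power
series `(X + a)⁻¹`, and the closed ring `Γ` contains all power series in `m`. -/
theorem IsArcPair.mul_inv_mem (hΓ : IsArcPair Γ) {w : k⟦X⟧ × k⟦X⟧} (hw : w ∈ Γ)
    (h0 : PowerSeries.constantCoeff w.1 ≠ 0) : ∃ v ∈ Γ, w * v = 1 := by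
  set a := PowerSeries.constantCoeff w.1 with ha
  have ha2 : PowerSeries.constantCoeff w.2 = a := (hΓ.constantCoeff_eq w hw).symm
  set m : k⟦X⟧ × k⟦X⟧ := w - algebraMap k _ a with hm
  have hmΓ : m ∈ Γ := Γ.sub_mem hw (Γ.algebraMap_mem _)
  have hm1 : PowerSeries.constantCoeff m.1 = 0 := by
    simp [hm, ← ha]
  have hm2 : PowerSeries.constantCoeff m.2 = 0 := by
    simp [hm, ha2]
  refine ⟨pairHom m hm1 hm2 (PowerSeries.X + PowerSeries.C a)⁻¹,
    pairHom_mem hΓ.closed hmΓ hm1 hm2 _, ?_⟩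
  have h1 : w = pairHom m hm1 hm2 (PowerSeries.X + PowerSeries.C a) := by
    rw [map_add, pairHom_X]
    have : pairHom m hm1 hm2 (PowerSeries.C a) = algebraMap k _ a := (pairHom m hm1 hm2).commutes a
    rw [this, hm]
    ring
  nth_rewrite 1 [h1]
  rw [← map_mul, PowerSeries.mul_inv_cancel _ (by simpa using h0), map_one]

/-- An element of least order on both branches is part of a pair of parameters. -/
theorem IsArcPair.exists_parameter (hΓ : IsArcPair Γ) {τ : k⟦X⟧ × k⟦X⟧} (hτ : τ ∈ Γ)
    (hτo : τ.1.order = (curveOrder (fstCurve Γ) : ℕ∞)) :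
    ∃ η ∈ Γ, PowerSeries.constantCoeff η.1 = 0 ∧
      ∀ w ∈ Γ, PowerSeries.constantCoeff w.1 = 0 → ∃ a ∈ Γ, ∃ b ∈ Γ, w = τ * a + η * b := by
  obtain ⟨x, hx, y, hy, hx0, hy0, hgen⟩ := hΓ.gen
  have hτ0 := constantCoeff_eq_zero_of_order hΓ.open_fst.curveOrder_pos hτo
  obtain ⟨a, ha, b, hb, hab⟩ := hgen τ hτ hτ0
  -- One of the coefficients in `τ = x a + y b` is a unit, since otherwise `τ` would exceed the
  -- least order on the first branch. The generator with the unit coefficient is then exchanged for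
  -- `τ`.
  by_cases ha0 : PowerSeries.constantCoeff a.1 = 0
  · by_cases hb0 : PowerSeries.constantCoeff b.1 = 0
    · exfalso
      have key : ∀ v ∈ Γ, PowerSeries.constantCoeff v.1 = 0 →
          PowerSeries.X ^ curveOrder (fstCurve Γ) ∣ v.1 := fun v hv h0 =>
        X_pow_curveOrder_dvd (R := fstCurve Γ) ⟨v, hv, rfl⟩ h0
      have h1 : PowerSeries.X ^ (curveOrder (fstCurve Γ) + 1) ∣ τ.1 := by
        rw [hab, Prod.fst_add, Prod.fst_mul, Prod.fst_mul, pow_succ]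
        exact dvd_add (mul_dvd_mul (key x hx hx0) (PowerSeries.X_dvd_iff.mpr ha0))
          (mul_dvd_mul (key y hy hy0) (PowerSeries.X_dvd_iff.mpr hb0))
      rw [X_pow_dvd_iff_le_order, hτo] at h1
      have h2 : curveOrder (fstCurve Γ) + 1 ≤ curveOrder (fstCurve Γ) := by exact_mod_cast h1
      omega
    · obtain ⟨b', hb', hbb⟩ := hΓ.mul_inv_mem hb hb0
      refine ⟨x, hx, hx0, fun w hw hw0 => ?_⟩
      obtain ⟨c, hc, d, hd, rfl⟩ := hgen w hw hw0
      refine ⟨b' * d, Γ.mul_mem hb' hd, c - a * b' * d,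
        Γ.sub_mem hc (Γ.mul_mem (Γ.mul_mem ha hb') hd), ?_⟩
      rw [hab]
      linear_combination (-(y * d)) * hbb
  · obtain ⟨a', ha', haa⟩ := hΓ.mul_inv_mem ha ha0
    refine ⟨y, hy, hy0, fun w hw hw0 => ?_⟩
    obtain ⟨c, hc, d, hd, rfl⟩ := hgen w hw hw0
    refine ⟨a' * c, Γ.mul_mem ha' hc, d - b * a' * c,
      Γ.sub_mem hd (Γ.mul_mem (Γ.mul_mem hb ha') hc), ?_⟩
    rw [hab]
    linear_combination (-(x * c)) * haa

/-- The data of a quadratic transform: `τ` has the least order on both branches, `τ` and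
`η = τ ζ` generate the maximal ideal and the second branch is tangent to `η = 0`. -/
theorem IsArcPair.exists_tangent_parameter (hΓ : IsArcPair Γ) {τ : k⟦X⟧ × k⟦X⟧} (hτ : τ ∈ Γ)
    (hτ1 : τ.1.order = (curveOrder (fstCurve Γ) : ℕ∞))
    (hτ2 : τ.2.order = (curveOrder (sndCurve Γ) : ℕ∞)) :
    ∃ ζ, τ * ζ ∈ Γ ∧ PowerSeries.constantCoeff ζ.2 = 0 ∧
      ∀ w ∈ Γ, PowerSeries.constantCoeff w.1 = 0 → ∃ a ∈ Γ, ∃ b ∈ Γ, w = τ * a + τ * ζ * b := by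
  obtain ⟨η, hη, hη0, hgen⟩ := hΓ.exists_parameter hτ hτ1
  obtain ⟨z1, hz1⟩ : τ.1 ∣ η.1 := by
    rw [dvd_iff_order_le, hτ1, ← X_pow_dvd_iff_le_order]
    exact X_pow_curveOrder_dvd (R := fstCurve Γ) ⟨η, hη, rfl⟩ hη0
  obtain ⟨z2, hz2⟩ : τ.2 ∣ η.2 := by
    rw [dvd_iff_order_le, hτ2, ← X_pow_dvd_iff_le_order]
    exact X_pow_curveOrder_dvd (R := sndCurve Γ) ⟨η, hη, rfl⟩ (hΓ.constantCoeff_snd hη hη0)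
  have hηz : η = τ * (z1, z2) := Prod.ext hz1 hz2
  -- Subtracting the constant term of `z2` moves the center of the transformed second branch to the
  -- origin. That the first branch stays there too is a consequence of positive contact, shown
  -- later.
  set c : k⟦X⟧ × k⟦X⟧ := algebraMap k _ (PowerSeries.constantCoeff z2) with hc
  have hcΓ : c ∈ Γ := Γ.algebraMap_mem _
  refine ⟨(z1, z2) - c, ?_, ?_, fun w hw hw0 => ?_⟩
  · rw [mul_sub, ← hηz]
    exact Γ.sub_mem hη (Γ.mul_mem hτ hcΓ)
  · simp [hc]
  · obtain ⟨a, ha, b, hb, rfl⟩ := hgen w hw hw0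
    refine ⟨a + c * b, Γ.add_mem ha (Γ.mul_mem hcΓ hb), b, hb, ?_⟩
    rw [hηz]
    ring

end

/-! ### Construction of the transform and its loss of contact -/

section

variable {k : Type u} [Field k] {Γ : Subalgebra k (k⟦X⟧ × k⟦X⟧)}

theorem ne_zero_of_order {x : k⟦X⟧} {n : ℕ} (h : x.order = n) : x ≠ 0 := by
  rintro rfl
  simp at h

/-- A ring generated by two parameters consists of polynomials in one of them over the ring of
power series in the other one. -/
theorem IsArcPair.exists_eval₂_eq (hΓ : IsArcPair Γ) {τ η : k⟦X⟧ × k⟦X⟧}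
    (h1 h2) (h01 : τ.1 ≠ 0) (h02 : τ.2 ≠ 0) (hη : η ∈ Γ) (hη0 : PowerSeries.constantCoeff η.1 = 0)
    (hgen : ∀ w ∈ Γ, PowerSeries.constantCoeff w.1 = 0 → ∃ a ∈ Γ, ∃ b ∈ Γ, w = τ * a + η * b)
    {w : k⟦X⟧ × k⟦X⟧} (hw : w ∈ Γ) :
    ∃ P : Polynomial k⟦X⟧, P.eval₂ (pairHom τ h1 h2 : k⟦X⟧ →+* k⟦X⟧ × k⟦X⟧) η = w := by
  set φ := (pairHom τ h1 h2 : k⟦X⟧ →+* k⟦X⟧ × k⟦X⟧)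
  let S : Subring (k⟦X⟧ × k⟦X⟧) := (Polynomial.eval₂RingHom φ η).range
  have hφS : ∀ c, φ c ∈ S := fun c => ⟨Polynomial.C c, by simp⟩
  have hτS : τ ∈ S := by
    have : φ PowerSeries.X = τ := pairHom_X τ h1 h2
    exact this ▸ hφS PowerSeries.X
  have hηS : η ∈ S := ⟨Polynomial.X, by simp⟩
  refine mem_of_closed_pair h1 h2 h01 h02 S.toAddSubgroup (fun c n hn => S.mul_mem (hφS c) hn) w ?_
  have hη2 := hΓ.constantCoeff_snd hη hη0
  -- `S` is a `k⟦τ⟧`-submodule, hence closed; so approximation to every order suffices. Removing the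
  -- constant term and applying the induction hypothesis to the two coefficients gains one order.
  suffices ∀ (j : ℕ), ∀ w ∈ Γ, ∃ n ∈ S, PairCongr j w n from fun j => this j w hw
  intro j
  induction j with
  | zero => exact fun w _ => ⟨0, S.zero_mem, by simp [PairCongr]⟩
  | succ j ih =>
    intro w hw
    set c := PowerSeries.constantCoeff w.1
    obtain ⟨a, ha, b, hb, hab⟩ := hgen (w - algebraMap k _ c) (Γ.sub_mem hw (Γ.algebraMap_mem c))
      (by simp [c])
    obtain ⟨a', ha', haa1, haa2⟩ := ih a ha
    obtain ⟨b', hb', hbb1, hbb2⟩ := ih b hb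
    have hcS : algebraMap k (k⟦X⟧ × k⟦X⟧) c ∈ S := by
      have : φ (algebraMap k _ c) = algebraMap k _ c := (pairHom τ h1 h2).commutes c
      exact this ▸ hφS _
    refine ⟨algebraMap k _ c + (τ * a' + η * b'),
      S.add_mem hcS (S.add_mem (S.mul_mem hτS ha') (S.mul_mem hηS hb')), ?_⟩
    have hw2 : w - (algebraMap k _ c + (τ * a' + η * b')) = τ * (a - a') + η * (b - b') := by
      linear_combination hab
    constructor
    · rw [← Prod.fst_sub, hw2, pow_succ']
      exact dvd_add (mul_dvd_mul (PowerSeries.X_dvd_iff.mpr h1) haa1)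
        (mul_dvd_mul (PowerSeries.X_dvd_iff.mpr hη0) hbb1)
    · rw [← Prod.snd_sub, hw2, pow_succ']
      exact dvd_add (mul_dvd_mul (PowerSeries.X_dvd_iff.mpr h2) haa2)
        (mul_dvd_mul (PowerSeries.X_dvd_iff.mpr hη2) hbb2)

/-- The substitution of `τ T` for `T` turns polynomials in `τ ζ` over `k⟦τ⟧` into polynomials in
`ζ`. Adjoining `ζ` therefore gives just `k⟦τ⟧[ζ]`. -/
theorem eval₂_mem_range_of_mem_adjoin {τ ζ : k⟦X⟧ × k⟦X⟧} (h1 h2)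
    (hpoly : ∀ w ∈ Γ, ∃ P : Polynomial k⟦X⟧,
      P.eval₂ (pairHom τ h1 h2 : k⟦X⟧ →+* k⟦X⟧ × k⟦X⟧) (τ * ζ) = w)
    {w : k⟦X⟧ × k⟦X⟧} (hw : w ∈ Algebra.adjoin k ((Γ : Set (k⟦X⟧ × k⟦X⟧)) ∪ {ζ})) :
    ∃ P : Polynomial k⟦X⟧, P.eval₂ (pairHom τ h1 h2 : k⟦X⟧ →+* k⟦X⟧ × k⟦X⟧) ζ = w := by
  set φ := (pairHom τ h1 h2 : k⟦X⟧ →+* k⟦X⟧ × k⟦X⟧)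
  have hX : φ PowerSeries.X = τ := pairHom_X τ h1 h2
  change w ∈ (Polynomial.eval₂RingHom φ ζ).range
  have hΓS : ∀ w ∈ Γ, w ∈ (Polynomial.eval₂RingHom φ ζ).range := by
    intro w hw
    obtain ⟨P, rfl⟩ := hpoly w hw
    refine ⟨P.comp (Polynomial.C PowerSeries.X * Polynomial.X), ?_⟩
    simp [Polynomial.eval₂_comp, hX]
  induction hw using Algebra.adjoin_induction with
  | mem x hx =>
    rcases hx with hx | rfl
    · exact hΓS x hx
    · exact ⟨Polynomial.X, by simp⟩
  | algebraMap r => exact hΓS _ (Γ.algebraMap_mem r)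
  | add x y _ _ hx hy => exact add_mem hx hy
  | mul x y _ _ hx hy => exact mul_mem hx hy

/-- Each `ζ ^ i` with `i ≤ d` becomes `τ ^ (d - i) (τ ζ) ^ i` on multiplication by `τ ^ d`. This
pulls elements of the transform back to the original ring. -/
theorem pow_mul_eval₂_mem {Λ V : Type*} [CommRing Λ] [CommRing V] (φ : Λ →+* V) (S : Subring V)
    (hφ : ∀ c, φ c ∈ S) {τ ζ : V} (hτ : τ ∈ S) (hζ : τ * ζ ∈ S) (P : Polynomial Λ) {d : ℕ}
    (hd : P.natDegree ≤ d) : τ ^ d * P.eval₂ φ ζ ∈ S := by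
  rw [Polynomial.eval₂_eq_sum_range, Finset.mul_sum]
  refine S.sum_mem fun i hi => ?_
  have hi' : i ≤ d := (Nat.lt_succ_iff.mp (Finset.mem_range.mp hi)).trans hd
  obtain ⟨j, rfl⟩ := Nat.exists_eq_add_of_le hi'
  have : τ ^ (i + j) * (φ (P.coeff i) * ζ ^ i) = φ (P.coeff i) * τ ^ j * (τ * ζ) ^ i := by ring
  rw [this]
  exact S.mul_mem (S.mul_mem (hφ _) (S.pow_mem hτ j)) (S.pow_mem hζ i)

theorem fst_eval₂ {τ ζ : k⟦X⟧ × k⟦X⟧} (h1 h2) (P : Polynomial k⟦X⟧) :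
    (P.eval₂ (pairHom τ h1 h2 : k⟦X⟧ →+* k⟦X⟧ × k⟦X⟧) ζ).1 =
      P.eval₂ (evalHom τ.1 h1 : k⟦X⟧ →+* k⟦X⟧) ζ.1 :=
  Polynomial.hom_eval₂ P (pairHom τ h1 h2 : k⟦X⟧ →+* k⟦X⟧ × k⟦X⟧) (RingHom.fst k⟦X⟧ k⟦X⟧) ζ

theorem snd_eval₂ {τ ζ : k⟦X⟧ × k⟦X⟧} (h1 h2) (P : Polynomial k⟦X⟧) :
    (P.eval₂ (pairHom τ h1 h2 : k⟦X⟧ →+* k⟦X⟧ × k⟦X⟧) ζ).2 =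
      P.eval₂ (evalHom τ.2 h2 : k⟦X⟧ →+* k⟦X⟧) ζ.2 :=
  Polynomial.hom_eval₂ P (pairHom τ h1 h2 : k⟦X⟧ →+* k⟦X⟧ × k⟦X⟧) (RingHom.snd k⟦X⟧ k⟦X⟧) ζ

/-- A quadratic transform lowers the intersection multiplicity at most by the product of the
multiplicities of the branches. -/
theorem interGE_adjoin {τ ζ : k⟦X⟧ × k⟦X⟧} (h1 h2) (hφ : ∀ c, pairHom τ h1 h2 c ∈ Γ)
    (hζ : τ * ζ ∈ Γ) {d e n : ℕ} (he : τ.1.order = e) (hd : τ.2.order = d)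
    (hpoly : ∀ w ∈ Γ, ∃ P : Polynomial k⟦X⟧,
      P.eval₂ (pairHom τ h1 h2 : k⟦X⟧ →+* k⟦X⟧ × k⟦X⟧) (τ * ζ) = w)
    (hn : InterGE Γ (n + e * d)) :
    InterGE (Algebra.adjoin k ((Γ : Set (k⟦X⟧ × k⟦X⟧)) ∪ {ζ})) n := by
  have hτ : τ ∈ Γ := pairHom_X τ h1 h2 ▸ hφ PowerSeries.X
  intro a ha
  obtain ⟨P, hP⟩ := eval₂_mem_range_of_mem_adjoin h1 h2 hpoly ha
  -- For degree at most `d`, multiplication by `τ ^ d` leads back into `Γ` and keeps the zero on the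
  -- second branch. On the first branch it adds the order `e d`, which is exactly the allowed loss.
  have hlow : ∀ Q : Polynomial k⟦X⟧, Q.natDegree ≤ d →
      Q.eval₂ (evalHom τ.2 h2 : k⟦X⟧ →+* k⟦X⟧) ζ.2 = 0 →
      PowerSeries.X ^ n ∣ Q.eval₂ (evalHom τ.1 h1 : k⟦X⟧ →+* k⟦X⟧) ζ.1 := by
    intro Q hQ hQ0
    have h3 := pow_mul_eval₂_mem (pairHom τ h1 h2 : k⟦X⟧ →+* k⟦X⟧ × k⟦X⟧) Γ.toSubring hφ hτ hζ Q hQ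
    have h4 : τ ^ d * Q.eval₂ (pairHom τ h1 h2 : k⟦X⟧ →+* k⟦X⟧ × k⟦X⟧) ζ =
        (τ.1 ^ d * Q.eval₂ (evalHom τ.1 h1 : k⟦X⟧ →+* k⟦X⟧) ζ.1, 0) := by
      refine Prod.ext ?_ ?_
      · rw [Prod.fst_mul, fst_eval₂]; rfl
      · rw [Prod.snd_mul, snd_eval₂, hQ0, mul_zero]
    rw [h4] at h3
    have h5 := hn _ h3
    obtain ⟨w, hw, hw2⟩ := exists_isUnit_mul_X_pow he
    generalize Q.eval₂ _ ζ.1 = r at h5 ⊢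
    rw [hw2, mul_pow, mul_assoc, (hw.pow d).dvd_mul_left, ← pow_mul, pow_add, mul_comm] at h5
    exact (mul_dvd_mul_iff_left (pow_ne_zero _ PowerSeries.X_ne_zero)).mp h5
  -- Division by a monic equation `H` of `ζ.2` of degree at most `d` reduces an arbitrary `P` to two
  -- polynomials of degree at most `d` vanishing on the second branch: the remainder and `H` itself.
  obtain ⟨H, hHm, hHd, hH0⟩ := exists_monic_eval₂_eq_zero (evalHom τ.2 h2 : k⟦X⟧ →+* k⟦X⟧)
    (fun i : Fin d => PowerSeries.X ^ (i : ℕ)) (fun y => exists_evalHom_sum_eq h2 hd y) ζ.2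
  rw [Fintype.card_fin] at hHd
  have hdiv := Polynomial.modByMonic_add_div P H
  have hP1 := (fst_eval₂ h1 h2 P).symm.trans (congrArg Prod.fst hP)
  have hP2 := (snd_eval₂ h1 h2 P).symm.trans (congrArg Prod.snd hP)
  rw [← hdiv, Polynomial.eval₂_add, Polynomial.eval₂_mul] at hP1 hP2
  rw [hH0, zero_mul, add_zero] at hP2
  have hmod : (P.modByMonic H).natDegree ≤ d :=
    (Polynomial.natDegree_modByMonic_le P hHm).trans hHd
  have h6 := hlow _ hmod hP2
  have h7 := hlow H hHd hH0
  change _ = a at hP1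
  rw [← hP1]
  exact dvd_add h6 (h7.mul_right _)

/-- Quadratic transforms of a curve with two branches. -/
theorem IsArcPair.exists_quadraticTransform (p : ℕ) [Fact p.Prime] [CharP k p]
    (hΓ : IsArcPair Γ) {n : ℕ} (hn0 : 0 < n)
    (hn : InterGE Γ (n + curveOrder (fstCurve Γ) * curveOrder (sndCurve Γ))) :
    ∃ Γ' : Subalgebra k (k⟦X⟧ × k⟦X⟧), Γ ≤ Γ' ∧ IsArcPair Γ' ∧ InterGE Γ' n ∧
      fstCurve Γ' = quadraticTransform (fstCurve Γ) ∧
      sndCurve Γ' = quadraticTransform (sndCurve Γ) := by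
  obtain ⟨τ, hτ, hτ1, hτ2⟩ := hΓ.exists_order_eq
  have h1 := constantCoeff_eq_zero_of_order hΓ.open_fst.curveOrder_pos hτ1
  have h2 := constantCoeff_eq_zero_of_order hΓ.open_snd.curveOrder_pos hτ2
  have h01 := ne_zero_of_order hτ1
  have h02 := ne_zero_of_order hτ2
  obtain ⟨ζ, hζ, hζ2, hgen⟩ := hΓ.exists_tangent_parameter hτ hτ1 hτ2
  have hφ : ∀ c, pairHom τ h1 h2 c ∈ Γ := pairHom_mem hΓ.closed hτ h1 h2
  have hpoly : ∀ w ∈ Γ, ∃ P : Polynomial k⟦X⟧,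
      P.eval₂ (pairHom τ h1 h2 : k⟦X⟧ →+* k⟦X⟧ × k⟦X⟧) (τ * ζ) = w := fun w hw =>
    hΓ.exists_eval₂_eq h1 h2 h01 h02 hζ (by simp [h1]) hgen hw
  set Γ' := Algebra.adjoin k ((Γ : Set (k⟦X⟧ × k⟦X⟧)) ∪ {ζ}) with hΓ'
  have hle : Γ ≤ Γ' := fun w hw => Algebra.subset_adjoin (Or.inl hw)
  have hζ' : ζ ∈ Γ' := Algebra.subset_adjoin (Or.inr rfl)
  have hinter : InterGE Γ' n := interGE_adjoin h1 h2 hφ hζ hτ1 hτ2 hpoly hn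
  have hclosed : IsXClosed (Γ' : Set (k⟦X⟧ × k⟦X⟧)) :=
    isXClosed_of_pairHom_mem h1 h2 h01 h02 fun c => hle (hφ c)
  -- If the centers separated, the powers `(c⁻¹ ζ) ^ (p ^ j)` would converge to the idempotent `(1,
  -- 0)`: in characteristic `p` the difference from `1` on the first branch is a `p ^ j`-th power of
  -- a non-unit. This contradicts contact at least `n > 0`.
  have hζ1 : PowerSeries.constantCoeff ζ.1 = 0 := by
    by_contra hc
    set c := PowerSeries.constantCoeff ζ.1 with hcdef
    have h3 : ((1, 0) : k⟦X⟧ × k⟦X⟧) ∈ Γ' := by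
      refine hclosed _ fun j => ⟨(algebraMap k _ c⁻¹ * ζ) ^ p ^ j,
        Γ'.pow_mem (Γ'.mul_mem (Γ'.algebraMap_mem _) hζ') _, ?_, ?_⟩
      · rw [Prod.pow_fst]
        have h4 : (1 : k⟦X⟧) = 1 ^ p ^ j := (one_pow _).symm
        have : CharP k⟦X⟧ p := charP_of_injective_algebraMap
          (FaithfulSMul.algebraMap_injective k k⟦X⟧) p
        change _ ∣ (1 : k⟦X⟧) - _
        rw [h4, ← sub_pow_char_pow]
        refine (pow_dvd_pow _ (Nat.lt_pow_self (Fact.out : p.Prime).one_lt).le).trans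
          (X_pow_dvd_pow ?_ _)
        simp [← hcdef, hc]
      · rw [Prod.pow_snd]
        change _ ∣ (0 : k⟦X⟧) - _
        rw [zero_sub, dvd_neg]
        refine (pow_dvd_pow _ (Nat.lt_pow_self (Fact.out : p.Prime).one_lt).le).trans
          (X_pow_dvd_pow ?_ _)
        simp [hζ2]
    have h5 := hinter 1 h3
    rw [X_pow_dvd_iff_le_order, PowerSeries.order_one] at h5
    have : n ≤ 0 := by exact_mod_cast h5
    omega
  have hloc : ∀ w ∈ Γ', PowerSeries.constantCoeff w.1 = PowerSeries.constantCoeff w.2 := by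
    intro w hw
    induction hw using Algebra.adjoin_induction with
    | mem x hx =>
      rcases hx with hx | rfl
      · exact hΓ.constantCoeff_eq x hx
      · rw [hζ1, hζ2]
    | algebraMap r => exact hΓ.constantCoeff_eq _ (Γ.algebraMap_mem r)
    | add x y _ _ hx hy => simp [hx, hy]
    | mul x y _ _ hx hy => simp [hx, hy]
  have hmapf : fstCurve Γ' = Algebra.adjoin k ((fstCurve Γ : Set k⟦X⟧) ∪ {ζ.1}) := by
    rw [fstCurve, hΓ', AlgHom.map_adjoin, Set.image_union, Set.image_singleton]
    rfl
  have hmaps : sndCurve Γ' = Algebra.adjoin k ((sndCurve Γ : Set k⟦X⟧) ∪ {ζ.2}) := by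
    rw [sndCurve, hΓ', AlgHom.map_adjoin, Set.image_union, Set.image_singleton]
    rfl
  have hlef : fstCurve Γ ≤ fstCurve Γ' := Subalgebra.map_mono hle
  have hles : sndCurve Γ ≤ sndCurve Γ' := Subalgebra.map_mono hle
  refine ⟨Γ', hle, ⟨hloc, hclosed, ⟨τ, hle hτ, ζ, hζ', h1, hζ1, fun w hw hw0 => ?_⟩,
    hΓ.open_fst.mono hlef, hΓ.open_snd.mono hles⟩, hinter, ?_, ?_⟩
  · obtain ⟨P, rfl⟩ := eval₂_mem_range_of_mem_adjoin h1 h2 hpoly hw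
    have hS : ∀ Q : Polynomial k⟦X⟧,
        Q.eval₂ (pairHom τ h1 h2 : k⟦X⟧ →+* k⟦X⟧ × k⟦X⟧) ζ ∈ Γ' := by
      intro Q
      have := pow_mul_eval₂_mem (pairHom τ h1 h2 : k⟦X⟧ →+* k⟦X⟧ × k⟦X⟧) Γ'.toSubring
        (fun c => hle (hφ c)) (τ := 1) (ζ := ζ) Γ'.one_mem (by simpa using hζ') Q le_rfl
      simpa using this
    -- A polynomial in `ζ` is a multiple of `ζ` plus its constant term, a series in `τ`. If the
    -- whole vanishes at the center, this series is divisible by `τ`.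
    have hP := Polynomial.divX_mul_X_add P
    rw [← hP, Polynomial.eval₂_add, Polynomial.eval₂_mul, Polynomial.eval₂_X,
      Polynomial.eval₂_C] at hw0
    have hc : PowerSeries.constantCoeff (P.coeff 0) = 0 := by
      rw [Prod.fst_add, Prod.fst_mul, map_add, map_mul, hζ1, mul_zero, zero_add] at hw0
      rwa [← constantCoeff_evalHom h1]
    obtain ⟨q, hq⟩ := PowerSeries.X_dvd_iff.mpr hc
    refine ⟨pairHom τ h1 h2 q, hle (hφ q), _, hS P.divX, ?_⟩
    nth_rewrite 1 [← hP]
    rw [Polynomial.eval₂_add, Polynomial.eval₂_mul, Polynomial.eval₂_X, Polynomial.eval₂_C, hq,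
      AlgHom.coe_toRingHom, map_mul, pairHom_X]
    ring
  · refine (hΓ.open_fst.quadraticTransform_eq hlef (ξ := τ.1) ⟨τ, hτ, rfl⟩ hτ1 ?_ ?_).symm
    · rintro y ⟨w, hw, hwy⟩ hy0
      rw [← hwy] at hy0
      obtain ⟨a, ha, b, hb, rfl⟩ := hgen w hw hy0
      have h3 : y = (a + ζ * b).1 := by
        refine mul_left_cancel₀ h01 (hwy.symm.trans ?_)
        change (τ * a + τ * ζ * b).1 = (τ * (a + ζ * b)).1
        congr 1
        ring
      rw [h3]
      exact ⟨_, Γ'.add_mem (hle ha) (Γ'.mul_mem hζ' (hle hb)), rfl⟩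
    · rw [hmapf]
      refine Algebra.adjoin_mono (Set.union_subset_union_right _ ?_)
      rintro _ rfl
      exact ⟨τ * ζ, hζ, rfl⟩
  · refine (hΓ.open_snd.quadraticTransform_eq hles (ξ := τ.2) ⟨τ, hτ, rfl⟩ hτ2 ?_ ?_).symm
    · rintro y ⟨w, hw, hwy⟩ hy0
      rw [← hwy] at hy0
      obtain ⟨a, ha, b, hb, rfl⟩ := hgen w hw ((hΓ.constantCoeff_eq w hw).trans hy0)
      have h3 : y = (a + ζ * b).2 := by
        refine mul_left_cancel₀ h02 (hwy.symm.trans ?_)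
        change (τ * a + τ * ζ * b).2 = (τ * (a + ζ * b)).2
        congr 1
        ring
      rw [h3]
      exact ⟨_, Γ'.add_mem (hle ha) (Γ'.mul_mem hζ' (hle hb)), rfl⟩
    · rw [hmaps]
      refine Algebra.adjoin_mono (Set.union_subset_union_right _ ?_)
      rintro _ rfl
      exact ⟨τ * ζ, hζ, rfl⟩

end

/-! ### Simultaneous resolution and smooth branches of high contact -/

section Comparison

variable {k : Type u} [Field k] {Γ : Subalgebra k (k⟦X⟧ × k⟦X⟧)}

theorem InterGE.mono {m n : ℕ} (hmn : m ≤ n) (h : InterGE Γ n) : InterGE Γ m :=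
  fun a ha => (pow_dvd_pow _ hmn).trans (h a ha)

/-- Simultaneous resolution of two branches of high contact. -/
theorem IsArcPair.exists_resolution (p : ℕ) [Fact p.Prime] [CharP k p] {n : ℕ} (hn0 : 0 < n)
    (c d M : ℕ) (hΓ : IsArcPair Γ) (hc : curveOrder (fstCurve Γ) ≤ c)
    (hd : curveOrder (sndCurve Γ) ≤ d) (hn : InterGE Γ (n + M * (c * d)))
    (hf : quadraticTransform^[M] (fstCurve Γ) = ⊤) (hs : quadraticTransform^[M] (sndCurve Γ) = ⊤) :
    ∃ Γ' : Subalgebra k (k⟦X⟧ × k⟦X⟧), Γ ≤ Γ' ∧ IsArcPair Γ' ∧ InterGE Γ' n ∧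
      fstCurve Γ' = ⊤ ∧ sndCurve Γ' = ⊤ := by
  induction M generalizing Γ with
  | zero => exact ⟨Γ, le_rfl, hΓ, by simpa using hn, hf, hs⟩
  | succ M ih =>
    -- The least orders do not grow when the rings are enlarged, so the initial product bounds the
    -- loss in every transform.
    have hmul := Nat.mul_le_mul hc hd
    obtain ⟨Γ₁, hle, hΓ₁, hn₁, hf₁, hs₁⟩ := hΓ.exists_quadraticTransform p
      (n := n + M * (c * d)) (by omega) (hn.mono (by rw [Nat.succ_mul]; omega))
    obtain ⟨Γ', h1, h2, h3, h4, h5⟩ := ih hΓ₁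
      ((curveOrder_anti (Subalgebra.map_mono hle) hΓ.open_fst).trans hc)
      ((curveOrder_anti (Subalgebra.map_mono hle) hΓ.open_snd).trans hd) hn₁
      (by rw [hf₁]; exact hf) (by rw [hs₁]; exact hs)
    exact ⟨Γ', hle.trans h1, h2, h3, h4, h5⟩

theorem evalHom_eq_self {τ : k⟦X⟧} (hτ) (h : τ = PowerSeries.X) (c : k⟦X⟧) :
    evalHom τ hτ c = c := by
  subst h
  rw [evalHom, PowerSeries.coe_substAlgHom]
  exact PowerSeries.X_subst c

/-- Two smooth branches of contact at least `n` coincide modulo `X ^ n` up to a change of the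
parameter. -/
theorem IsArcPair.exists_evalHom_congr (hΓ : IsArcPair Γ) {n : ℕ} (hn2 : 2 ≤ n)
    (hn : InterGE Γ n) (hf : fstCurve Γ = ⊤) (hs : sndCurve Γ = ⊤) :
    ∃ (τ : k⟦X⟧) (hτ : PowerSeries.constantCoeff τ = 0), τ.order = 1 ∧
      ∀ w ∈ Γ, PowerSeries.X ^ n ∣ w.1 - evalHom τ hτ w.2 := by
  obtain ⟨w, hw, hwX⟩ : (PowerSeries.X : k⟦X⟧) ∈ sndCurve Γ := hs ▸ Algebra.mem_top
  obtain ⟨v, hv, hvX⟩ : (PowerSeries.X : k⟦X⟧) ∈ fstCurve Γ := hf ▸ Algebra.mem_top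
  change w.2 = PowerSeries.X at hwX
  change v.1 = PowerSeries.X at hvX
  have h2 : PowerSeries.constantCoeff w.2 = 0 := by simp [hwX]
  have h1 : PowerSeries.constantCoeff w.1 = 0 := (hΓ.constantCoeff_eq w hw).trans h2
  -- The element `w = (τ, X)` makes `Γ` a graph up to contact: subtracting from `u` the series `u.2`
  -- evaluated at `w` kills the second coordinate, so that the first one has order at least `n`.
  have key : ∀ u ∈ Γ, PowerSeries.X ^ n ∣ u.1 - evalHom w.1 h1 u.2 := by
    intro u hu
    refine hn _ ?_
    have h3 := Γ.sub_mem hu (pairHom_mem hΓ.closed hw h1 h2 u.2)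
    convert h3 using 1
    refine Prod.ext rfl ?_
    change 0 = u.2 - evalHom w.2 h2 u.2
    rw [evalHom_eq_self h2 hwX, sub_self]
  refine ⟨w.1, h1, ?_, key⟩
  -- For `v = (X, v.2)` this says that `X` is, modulo `X ^ 2`, a series in `τ` without constant
  -- term. This excludes order at least two for `τ` and is the reason for `2 ≤ n`.
  have h3 := (pow_dvd_pow _ hn2).trans (key v hv)
  rw [hvX] at h3
  have h4 : PowerSeries.constantCoeff v.2 = 0 := by
    rw [← hΓ.constantCoeff_eq v hv, hvX]; simp
  obtain ⟨z, hz⟩ := PowerSeries.X_dvd_iff.mpr h4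
  rw [hz, map_mul, evalHom_X] at h3
  refine le_antisymm (le_of_not_gt fun hlt => ?_) ?_
  · have h5 : (PowerSeries.X : k⟦X⟧) ^ 2 ∣ w.1 := by
      rw [X_pow_dvd_iff_le_order]
      have h5' := Order.add_one_le_of_lt hlt
      rw [one_add_one_eq_two] at h5'
      exact_mod_cast h5'
    have h6 := dvd_add h3 (h5.mul_right (evalHom w.1 h1 z))
    rw [sub_add_cancel, X_pow_dvd_iff_le_order, PowerSeries.order_X] at h6
    have h7 : 2 ≤ 1 := by exact_mod_cast h6
    omega
  · rw [← Nat.cast_one, ← X_pow_dvd_iff_le_order, pow_one, PowerSeries.X_dvd_iff]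
    exact h1

theorem evalHom_bijective {τ : k⟦X⟧} (hτ) (h : τ.order = 1) : Function.Bijective (evalHom τ hτ) := by
  refine ⟨evalHom_injective hτ (ne_zero_of_order (n := 1) (by exact_mod_cast h)), fun y => ?_⟩
  -- For order one the module of remainders has the single generator `1`.
  obtain ⟨c, hc⟩ := exists_evalHom_sum_eq hτ (e := 1) (by exact_mod_cast h) y
  exact ⟨c 0, by simpa using hc.symm⟩

end Comparison

/-! ### The multiplicity and the resolution of an algebroid curve -/

section Multiplicity

theorem finrank_quotient_map_of_injective {K V V' : Type*} [Field K] [AddCommGroup V]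
    [AddCommGroup V'] [Module K V] [Module K V'] (f : V' →ₗ[K] V) (hf : Function.Injective f)
    (N : Submodule K V') [FiniteDimensional K (V ⧸ N.map f)] :
    Module.finrank K (V ⧸ N.map f) =
      Module.finrank K (V' ⧸ N) + Module.finrank K (V ⧸ LinearMap.range f) := by
  let g : V' ⧸ N →ₗ[K] V ⧸ N.map f := N.mapQ (N.map f) f (Submodule.le_comap_map f N)
  have hg : Function.Injective g := by
    rw [← LinearMap.ker_eq_bot, Submodule.ker_mapQ, Submodule.comap_map_eq_of_injective hf,
      Submodule.mkQ_map_self]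
  have hr : LinearMap.range g = (LinearMap.range f).map (N.map f).mkQ := by
    rw [← LinearMap.range_comp, ← LinearMap.range_comp_of_range_eq_top g N.range_mkQ]
    rfl
  have h1 := Submodule.finrank_quotient_add_finrank (LinearMap.range g)
  rw [LinearMap.finrank_range_of_inj hg] at h1
  rw [← h1, add_comm, hr]
  congr 1
  exact (Submodule.quotientQuotientEquivQuotient _ _ (LinearMap.map_le_range)).finrank_eq

variable {k : Type u} [Field k]

/-- The `k`-subspace of the multiples of a power series. -/
def multiples (a : k⟦X⟧) : Submodule k k⟦X⟧ := LinearMap.range (LinearMap.mulLeft k a)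

theorem mem_multiples {a y : k⟦X⟧} : y ∈ multiples a ↔ a ∣ y :=
  ⟨fun ⟨z, hz⟩ => ⟨z, hz.symm⟩, fun ⟨z, hz⟩ => ⟨z, hz.symm⟩⟩

/-- The quotient by the multiples of `X ^ n` is given by the first `n` coefficients. -/
def quotientMultiplesEquiv (n : ℕ) :
    (k⟦X⟧ ⧸ multiples (PowerSeries.X ^ n : k⟦X⟧)) ≃ₗ[k] (Fin n → k) :=
  let f : k⟦X⟧ →ₗ[k] (Fin n → k) := LinearMap.pi fun i => PowerSeries.coeff (i : ℕ)
  have hk : multiples (PowerSeries.X ^ n) = LinearMap.ker f := by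
    ext y
    rw [mem_multiples, PowerSeries.X_pow_dvd_iff, LinearMap.mem_ker, funext_iff]
    exact ⟨fun h i => h i i.2, fun h m hm => h ⟨m, hm⟩⟩
  have hf : Function.Surjective f := fun c =>
    ⟨PowerSeries.mk fun m => if h : m < n then c ⟨m, h⟩ else 0, by ext i; simp [f]⟩
  (Submodule.quotEquivOfEq _ _ hk).trans (f.quotKerEquivOfSurjective hf)

theorem finrank_quotient_multiples {a : k⟦X⟧} {n : ℕ} (ha : a.order = n) :
    Module.finrank k (k⟦X⟧ ⧸ multiples a) = n := by
  have h : multiples a = multiples (PowerSeries.X ^ n) := by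
    ext y
    rw [mem_multiples, mem_multiples, dvd_iff_order_le, dvd_iff_order_le, ha,
      PowerSeries.order_X_pow]
  rw [h, (quotientMultiplesEquiv n).finrank_eq, Module.finrank_fin_fun]

theorem finiteDimensional_quotient {S : Submodule k k⟦X⟧} {c : ℕ}
    (h : ∀ y, PowerSeries.X ^ c ∣ y → y ∈ S) : FiniteDimensional k (k⟦X⟧ ⧸ S) := by
  have h1 : FiniteDimensional k (k⟦X⟧ ⧸ multiples (PowerSeries.X ^ c : k⟦X⟧)) :=
    Module.Finite.equiv (quotientMultiplesEquiv c).symm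
  have h2 : multiples (PowerSeries.X ^ c : k⟦X⟧) ≤ S := fun y hy => h y (mem_multiples.mp hy)
  exact Module.Finite.of_surjective (Submodule.factor h2) (Submodule.factor_surjective h2)

/-- The multiplicity of an algebroid curve is the least positive order of its elements. -/
theorem IsOpenCurve.curveMultiplicity_eq {R : Subalgebra k k⟦X⟧} (hR : IsOpenCurve R) :
    curveMultiplicity R = curveOrder R := by
  obtain ⟨ξ, hξ, hξo⟩ := hR.exists_order_eq
  have hpos := hR.curveOrder_pos
  have hξ0 := constantCoeff_eq_zero_of_order hpos hξo
  have hξne := ne_zero_of_order hξo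
  obtain ⟨c, hc⟩ := hR
  set e := curveOrder R with he
  have hξm : (⟨ξ, hξ⟩ : R) ∈ curveIdeal R := mem_curveIdeal.mpr hξ0
  let ι : R →ₗ[k] k⟦X⟧ := R.val.toLinearMap
  have hι : Function.Injective ι := Subtype.val_injective
  let J : ℕ → Submodule k R := fun n => (curveIdeal R ^ n).restrictScalars k
  -- `N n` consists of the `y` with `ξ ^ n y ∈ 𝔪 ^ n`, that is, `N n = ξ⁻ⁿ 𝔪 ^ n`. These spaces
  -- increase with `n` and contain all series of order at least `c`, so their codimensions become
  -- constant.
  let N : ℕ → Submodule k k⟦X⟧ := fun n => ((J n).map ι).comap (LinearMap.mulLeft k (ξ ^ n))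
  have hmulinj : ∀ n, Function.Injective (LinearMap.mulLeft k (ξ ^ n)) := fun n a b hab =>
    mul_left_cancel₀ (pow_ne_zero n hξne) hab
  have hNc : ∀ n y, PowerSeries.X ^ c ∣ y → y ∈ N n := fun n y hy =>
    ⟨⟨ξ, hξ⟩ ^ n * ⟨y, hc y hy⟩, Ideal.mul_mem_right _ _ (Ideal.pow_mem_pow hξm n), rfl⟩
  have hNfin : ∀ n, FiniteDimensional k (k⟦X⟧ ⧸ N n) := fun n => finiteDimensional_quotient (hNc n)
  have hordn : ∀ n, (ξ ^ n).order = ((e * n : ℕ) : ℕ∞) := by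
    intro n
    rw [PowerSeries.order_pow, hξo, nsmul_eq_mul, mul_comm]
    norm_cast
  have hNmap : ∀ n, (N n).map (LinearMap.mulLeft k (ξ ^ n)) = (J n).map ι := by
    intro n
    refine Submodule.map_comap_eq_of_le ?_
    rintro _ ⟨y, hy, rfl⟩
    refine mem_multiples.mpr ?_
    rw [dvd_iff_order_le, hordn, ← X_pow_dvd_iff_le_order]
    exact X_pow_dvd_of_mem_curveIdeal_pow n hy
  have hJfin : ∀ n, FiniteDimensional k (k⟦X⟧ ⧸ (J n).map ι) := by
    intro n
    refine finiteDimensional_quotient (c := e * n + c) fun y hy => ?_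
    have h1 : ξ ^ n ∣ y := by
      rw [dvd_iff_order_le, hordn, ← X_pow_dvd_iff_le_order]
      exact (pow_dvd_pow _ (Nat.le_add_right _ _)).trans hy
    obtain ⟨z, rfl⟩ := h1
    have h2 : PowerSeries.X ^ c ∣ z := by
      obtain ⟨w, hw, hw2⟩ := exists_isUnit_mul_X_pow (hordn n)
      rw [hw2, mul_assoc, hw.dvd_mul_left, pow_add] at hy
      exact (mul_dvd_mul_iff_left (pow_ne_zero _ PowerSeries.X_ne_zero)).mp hy
    exact hNc n z h2
  -- The codimension of `𝔪 ^ n` in `k⟦X⟧` is computed in two ways: through `R`, and through `ξ ^ n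
  -- k⟦X⟧`, whose codimension is `e n`.
  have hdim : ∀ n, Module.finrank k (R ⧸ curveIdeal R ^ n) +
      Module.finrank k (k⟦X⟧ ⧸ LinearMap.range ι) =
        Module.finrank k (k⟦X⟧ ⧸ N n) + e * n := by
    intro n
    have := hJfin n
    have h1 := finrank_quotient_map_of_injective ι hι (J n)
    have : FiniteDimensional k (k⟦X⟧ ⧸ (N n).map (LinearMap.mulLeft k (ξ ^ n))) := by
      rw [hNmap]; exact hJfin n
    have h2 := finrank_quotient_map_of_injective (LinearMap.mulLeft k (ξ ^ n)) (hmulinj n) (N n)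
    rw [hNmap, h1] at h2
    have h3 := finrank_quotient_multiples (hordn n)
    rw [multiples] at h3
    rw [h3] at h2
    exact h2
  have hanti : Antitone fun n => Module.finrank k (k⟦X⟧ ⧸ N n) := by
    refine antitone_nat_of_succ_le fun n => ?_
    have hle : N n ≤ N (n + 1) := by
      rintro y ⟨z, hz, hzy⟩
      refine ⟨⟨ξ, hξ⟩ * z, ?_, ?_⟩
      · change _ ∈ curveIdeal R ^ (n + 1)
        rw [pow_succ']
        exact Ideal.mul_mem_mul hξm hz
      · change ξ * ι z = ξ ^ (n + 1) * y
        rw [hzy, pow_succ']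
        exact (mul_assoc _ _ _).symm
    have := hNfin n
    exact LinearMap.finrank_le_finrank_of_surjective (Submodule.factor_surjective hle)
  obtain ⟨n₀, hn₀⟩ : ∃ n₀, ∀ n, n₀ ≤ n →
      Module.finrank k (k⟦X⟧ ⧸ N n) = Module.finrank k (k⟦X⟧ ⧸ N n₀) := by
    have hne : (Set.range fun n => Module.finrank k (k⟦X⟧ ⧸ N n)).Nonempty := Set.range_nonempty _
    obtain ⟨n₀, hn₀⟩ := Nat.sInf_mem hne
    exact ⟨n₀, fun n hn => le_antisymm (hanti hn) (hn₀.trans_le (Nat.sInf_le ⟨n, rfl⟩))⟩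
  have hset : {e' : ℕ | ∃ q : ℤ, ∀ᶠ n : ℕ in Filter.atTop,
      (Module.finrank k (R ⧸ curveIdeal R ^ n) : ℤ) = e' * n + q} = {e} := by
    have hmem : ∀ n, n₀ ≤ n → (Module.finrank k (R ⧸ curveIdeal R ^ n) : ℤ) =
        e * n + ((Module.finrank k (k⟦X⟧ ⧸ N n₀) : ℤ) -
          Module.finrank k (k⟦X⟧ ⧸ LinearMap.range ι)) := by
      intro n hn
      have h1 := hdim n
      rw [hn₀ n hn] at h1
      have h2 : (Module.finrank k (R ⧸ curveIdeal R ^ n) : ℤ) +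
        Module.finrank k (k⟦X⟧ ⧸ LinearMap.range ι) =
          Module.finrank k (k⟦X⟧ ⧸ N n₀) + e * n := by exact_mod_cast h1
      linarith
    ext e'
    constructor
    · rintro ⟨q, hq⟩
      obtain ⟨n₁, hn₁⟩ := Filter.eventually_atTop.mp hq
      set m := max n₀ n₁
      have h1 := (hmem m (le_max_left _ _)).symm.trans (hn₁ m (le_max_right _ _))
      have h2 := (hmem (m + 1) ((le_max_left _ _).trans (Nat.le_succ m))).symm.trans
        (hn₁ (m + 1) ((le_max_right _ _).trans (Nat.le_succ m)))
      push_cast at h2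
      have h3 : (e' : ℤ) = e := by linarith
      exact_mod_cast h3
    · rintro rfl
      exact ⟨_, Filter.eventually_atTop.mpr ⟨n₀, hmem⟩⟩
  rw [curveMultiplicity, hset, csInf_singleton]

/-- Successive quadratic transforms resolve an algebroid curve. -/
theorem IsOpenCurve.exists_iterate_eq_top {R : Subalgebra k k⟦X⟧} (hR : IsOpenCurve R) :
    ∃ i, quadraticTransform^[i] R = ⊤ := by
  have hmono : Monotone fun i => quadraticTransform^[i] R := by
    refine monotone_nat_of_le_succ fun i => ?_
    rw [Function.iterate_succ_apply']
    exact le_quadraticTransform _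
  have hopen : ∀ i, IsOpenCurve (quadraticTransform^[i] R) := fun i =>
    hR.mono (hmono (Nat.zero_le i))
  obtain ⟨c, hc⟩ := hR
  let I := multiples (PowerSeries.X ^ c : k⟦X⟧)
  have hfin : FiniteDimensional k (k⟦X⟧ ⧸ I) :=
    finiteDimensional_quotient fun y hy => mem_multiples.mpr hy
  -- All the transforms contain the series of order at least `c`, so the chain can be followed in a
  -- finite-dimensional quotient, where it becomes stationary.
  let f : ℕ →o Submodule k (k⟦X⟧ ⧸ I) :=
    ⟨fun i => (Subalgebra.toSubmodule (quadraticTransform^[i] R)).map I.mkQ,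
      fun i j hij => Submodule.map_mono (hmono hij)⟩
  obtain ⟨n, hn⟩ := monotone_stabilizes_iff_noetherian.mpr inferInstance f
  refine ⟨n, (hopen n).eq_top_of_quadraticTransform_le ?_⟩
  rw [← Function.iterate_succ_apply' quadraticTransform n R]
  intro y hy
  have h1 : I.mkQ y ∈ f n := by
    rw [hn (n + 1) (Nat.le_succ n)]
    exact Submodule.mem_map_of_mem hy
  obtain ⟨z, hz, hzy⟩ := h1
  rw [← sub_eq_zero, ← map_sub, ← LinearMap.mem_ker, Submodule.ker_mkQ] at hzy
  have h2 := hmono (Nat.zero_le n) (hc _ (mem_multiples.mp hzy))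
  have h3 := Subalgebra.sub_mem _ hz h2
  rwa [sub_sub_cancel] at h3

/-- Integrality follows from the finiteness of `k⟦X⟧` over `k⟦ξ⟧ ⊆ R`, and `y = X ^ c y / X ^ c` is
a fraction because `R` contains all series of large order. -/
theorem curveNormalization_eq_univ {R : Subalgebra k k⟦X⟧} (hR : IsOpenCurve R) {ξ : k⟦X⟧}
    (hξ0 : PowerSeries.constantCoeff ξ = 0) (hξne : ξ ≠ 0) (h : ∀ c, evalHom ξ hξ0 c ∈ R) :
    curveNormalization R = Set.univ := by
  obtain ⟨c, hc⟩ := hR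
  refine Set.eq_univ_of_forall fun y => ⟨?_, ?_⟩
  · obtain ⟨H, hH, -, hH0⟩ := exists_monic_eval₂_eq_zero (evalHom ξ hξ0 : k⟦X⟧ →+* k⟦X⟧)
      (fun i : Fin ξ.order.toNat => PowerSeries.X ^ (i : ℕ))
      (fun y => exists_evalHom_sum_eq hξ0 (PowerSeries.coe_toNat_order hξne).symm y) y
    let φ : k⟦X⟧ →+* R := (evalHom ξ hξ0 : k⟦X⟧ →+* k⟦X⟧).codRestrict R h
    refine ⟨H.map φ, hH.map φ, ?_⟩
    rw [Polynomial.eval₂_map]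
    exact hH0
  · refine ⟨⟨PowerSeries.X ^ c * y, hc _ (Dvd.intro _ rfl)⟩,
      ⟨PowerSeries.X ^ c, hc _ dvd_rfl⟩, ?_, rfl⟩
    intro h0
    exact pow_ne_zero c PowerSeries.X_ne_zero (congrArg Subtype.val h0)

/-- A resolution exists, so the infimum defining the length is attained, and further transforms
leave `k⟦X⟧` unchanged. Two branches of different lengths can thus be given the same number of
steps. -/
theorem iterate_quadraticTransform_eq_top {R : Subalgebra k k⟦X⟧} (hR : IsOpenCurve R)
    (hn : curveNormalization R = Set.univ) {M : ℕ} (hM : resolutionLength R ≤ M) :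
    quadraticTransform^[M] R = ⊤ := by
  obtain ⟨i, hi⟩ := hR.exists_iterate_eq_top
  have hne : {i : ℕ | ((quadraticTransform^[i] R : Subalgebra k k⟦X⟧) : Set k⟦X⟧) =
      curveNormalization R}.Nonempty := ⟨i, by rw [Set.mem_ofPred_eq, hn, hi]; rfl⟩
  have h1 := Nat.sInf_mem hne
  change ((quadraticTransform^[resolutionLength R] R : Subalgebra k k⟦X⟧) : Set k⟦X⟧) = _ at h1
  rw [hn] at h1
  obtain ⟨j, rfl⟩ := Nat.exists_eq_add_of_le' hM
  rw [Function.iterate_add_apply]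
  have h2 : quadraticTransform^[resolutionLength R] R = ⊤ := SetLike.coe_injective h1
  rw [h2]
  clear hM
  induction j with
  | zero => rfl
  | succ j ih =>
    rw [Function.iterate_succ_apply', ih]
    exact top_le_iff.mp (le_quadraticTransform _)

/-- A closed curve of degree one contains a power of the maximal ideal of its normalization. -/
theorem isOpenCurve_of_curveDegree_eq_one {R : Subalgebra k k⟦X⟧} {ξ : k⟦X⟧}
    (hξ0 : PowerSeries.constantCoeff ξ = 0) (hξne : ξ ≠ 0) (h : ∀ c, evalHom ξ hξ0 c ∈ R)
    (hdeg : curveDegree R = 1) : IsOpenCurve R := by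
  -- The infimum of the empty set is `0`, so degree `1` guarantees that a uniformizer of order one
  -- really exists.
  have hne : {n : ℕ | 0 < n ∧ ∃ t ∈ curveNormalization R, t.order = (n : ℕ∞)}.Nonempty := by
    refine Nat.nonempty_of_pos_sInf ?_
    rw [curveDegree] at hdeg
    rw [hdeg]; exact one_pos
  have hmem := Nat.sInf_mem hne
  change _ ∧ ∃ t ∈ curveNormalization R, t.order = ((curveDegree R : ℕ) : ℕ∞) at hmem
  obtain ⟨-, t, ⟨-, a, b, hb0, hab⟩, hto⟩ := hmem
  rw [hdeg] at hto
  let T : Subalgebra k k⟦X⟧ :=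
    { carrier := {y | ∃ b ∈ R, b ≠ 0 ∧ b * y ∈ R}
      mul_mem' := by
        rintro x y ⟨b, hb, hb0, hbx⟩ ⟨d, hd, hd0, hdy⟩
        refine ⟨b * d, R.mul_mem hb hd, mul_ne_zero hb0 hd0, ?_⟩
        rw [mul_mul_mul_comm]
        exact R.mul_mem hbx hdy
      add_mem' := by
        rintro x y ⟨b, hb, hb0, hbx⟩ ⟨d, hd, hd0, hdy⟩
        refine ⟨b * d, R.mul_mem hb hd, mul_ne_zero hb0 hd0, ?_⟩
        have : b * d * (x + y) = d * (b * x) + b * (d * y) := by ring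
        rw [this]
        exact R.add_mem (R.mul_mem hd hbx) (R.mul_mem hb hdy)
      algebraMap_mem' := fun r => ⟨1, R.one_mem, one_ne_zero, by
        rw [one_mul]; exact R.algebraMap_mem r⟩ }
  have hRT : ∀ y ∈ R, y ∈ T := fun y hy => ⟨1, R.one_mem, one_ne_zero, by rwa [one_mul]⟩
  have htT : t ∈ T := ⟨b, b.2, fun h => hb0 (Subtype.ext h), by rw [hab]; exact a.2⟩
  have hto1 : t.order = 1 := by exact_mod_cast hto
  have ht0 := constantCoeff_eq_zero_of_order one_pos hto
  -- `T` is the intersection of `k⟦X⟧` with the fraction field of `R`. It is a `k⟦ξ⟧`-module, hence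
  -- closed, and contains all polynomials in the parameter `t`.
  have hT : ∀ y, y ∈ T := by
    intro y
    refine mem_of_closed_single hξ0 hξne T.toSubring.toAddSubgroup
      (fun c n hn => T.mul_mem (hRT _ (h c)) hn) y fun j => ?_
    obtain ⟨z, rfl⟩ := (evalHom_bijective ht0 hto1).2 y
    refine ⟨evalHom t ht0 (PowerSeries.trunc j z : Polynomial k), ?_, ?_⟩
    · rw [evalHom_coe]
      exact aeval_mem htT _
    · rw [← map_sub]
      exact X_pow_dvd_evalHom ht0 (X_pow_dvd_sub_trunc j z)
  -- The product `B` of denominators of the finitely many generators `X ^ i` over `k⟦ξ⟧` satisfies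
  -- `B k⟦X⟧ ⊆ R`; its order is a conductor exponent.
  choose β hβR hβ0 hβ using fun i : Fin ξ.order.toNat => hT (PowerSeries.X ^ (i : ℕ))
  set B := ∏ i, β i with hB
  have hB0 : B ≠ 0 := Finset.prod_ne_zero_iff.mpr fun i _ => hβ0 i
  refine ⟨B.order.toNat, fun y hy => ?_⟩
  obtain ⟨z, rfl⟩ : B ∣ y := by
    rw [dvd_iff_order_le, ← PowerSeries.coe_toNat_order hB0, ← X_pow_dvd_iff_le_order]
    exact hy
  obtain ⟨c, hc⟩ := exists_evalHom_sum_eq hξ0 (PowerSeries.coe_toNat_order hξne).symm z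
  rw [hc, Finset.mul_sum]
  refine R.sum_mem fun i _ => ?_
  rw [hB, ← Finset.prod_erase_mul _ _ (Finset.mem_univ i)]
  have : (∏ x ∈ Finset.univ.erase i, β x) * β i * (evalHom ξ hξ0 (c i) * PowerSeries.X ^ (i : ℕ)) =
      (∏ x ∈ Finset.univ.erase i, β x) * evalHom ξ hξ0 (c i) * (β i * PowerSeries.X ^ (i : ℕ)) := by
    ring
  rw [this]
  exact R.mul_mem (R.mul_mem (R.prod_mem fun j _ => hβR j) (h _)) (hβ i)

end Multiplicity

/-! ### Pairs of arcs on a local ring -/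

section

variable {k : Type u} [Field k] {A : Type u} [CommRing A] [IsLocalRing A]

theorem X_pow_dvd_completedHom_sub (f : A →+* k⟦X⟧) [IsLocalHom f] (n : ℕ)
    (G : AdicCompletion (maximalIdeal A) A) (y : A)
    (hy : AdicCompletion.evalₐ (maximalIdeal A) n G = Ideal.Quotient.mk _ y) :
    PowerSeries.X ^ n ∣ completedHom f G - f y := by
  rw [← Ideal.mem_span_singleton, ← Ideal.span_singleton_pow,
    ← Ideal.Quotient.mk_eq_mk_iff_sub_mem, completedHom,
    IsAdicComplete.mk_liftRingHom _ _ (truncatedHom_compat f)]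
  simp [truncatedHom, hy]

/-- The approximating element of `A` depends only on `G` and `n`, so one choice serves both arcs. -/
theorem exists_X_pow_dvd_completedHom_sub (n : ℕ) (G : AdicCompletion (maximalIdeal A) A) :
    ∃ y : A, ∀ (f : A →+* k⟦X⟧) [IsLocalHom f], PowerSeries.X ^ n ∣ completedHom f G - f y := by
  obtain ⟨y, hy⟩ := Ideal.Quotient.mk_surjective (AdicCompletion.evalₐ (maximalIdeal A) n G)
  exact ⟨y, fun f _ => X_pow_dvd_completedHom_sub f n G y hy.symm⟩

theorem constantCoeff_map_eq_zero (f : A →+* k⟦X⟧) [IsLocalHom f] {a : A} :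
    PowerSeries.constantCoeff (f a) = 0 ↔ a ∈ maximalIdeal A := by
  rw [mem_maximalIdeal, mem_nonunits_iff, ← isUnit_map_iff f, PowerSeries.isUnit_iff_constantCoeff,
    isUnit_iff_ne_zero, not_not]

/-- The truncations of `c`, evaluated at `a`, form a Cauchy sequence in `A`. Its limit does not
depend on `f`, so it shows that the curve of each arc, and also that of the pair, contains the power
series in the image of `a`. -/
theorem exists_completedHom_eq_evalHom (κ : k →+* A) (a : A) (ha : a ∈ maximalIdeal A)
    (c : k⟦X⟧) : ∃ G : AdicCompletion (maximalIdeal A) A, ∀ (f : A →+* k⟦X⟧) [IsLocalHom f],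
      (∀ b, f (κ b) = PowerSeries.C b) → ∀ h, completedHom f G = evalHom (f a) h c := by
  let s : ℕ → A := fun n => ((PowerSeries.trunc n c).eval₂ κ a)
  have hs : ∀ n, s n ≡ s (n + 1) [SMOD (maximalIdeal A ^ n • ⊤ : Submodule A A)] := by
    intro n
    rw [SModEq.comm, SModEq.sub_mem, smul_eq_mul, Ideal.mul_top]
    simp only [s, PowerSeries.trunc_succ, Polynomial.eval₂_add, Polynomial.eval₂_monomial,
      add_sub_cancel_left]
    exact Ideal.mul_mem_left _ _ (Ideal.pow_mem_pow ha n)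
  let S := AdicCompletion.AdicCauchySequence.mk (maximalIdeal A) A s hs
  refine ⟨AdicCompletion.mk _ _ S, fun f _ hf h => sub_eq_zero.mp
    (eq_zero_of_forall_X_pow_dvd fun n => ?_)⟩
  have h1 := X_pow_dvd_completedHom_sub f n (AdicCompletion.mk _ _ S) (s n)
    (AdicCompletion.evalₐ_mk _ n S)
  have h2 : f (s n) = evalHom (f a) h (PowerSeries.trunc n c : Polynomial k) := by
    have h3 : f.comp κ = algebraMap k k⟦X⟧ := RingHom.ext hf
    rw [evalHom_coe, Polynomial.hom_eval₂, h3, Polynomial.aeval_def]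
  rw [h2] at h1
  have h4 := X_pow_dvd_evalHom h (X_pow_dvd_sub_trunc n c)
  rw [map_sub] at h4
  have h5 := dvd_sub h1 h4
  rwa [sub_sub_sub_cancel_right] at h5

theorem exists_mem_maximalIdeal_ne_zero {f g : A →+* k⟦X⟧}
    (hf0 : ¬ maximalIdeal A ≤ RingHom.ker f)
    (hg0 : ¬ maximalIdeal A ≤ RingHom.ker g) :
    ∃ a ∈ maximalIdeal A, f a ≠ 0 ∧ g a ≠ 0 := by
  rw [SetLike.not_le_iff_exists] at hf0 hg0
  obtain ⟨a, ha, haf⟩ := hf0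
  obtain ⟨b, hb, hbg⟩ := hg0
  rw [RingHom.mem_ker] at haf hbg
  by_cases hag : g a = 0
  · by_cases hbf : f b = 0
    · refine ⟨a + b, Ideal.add_mem _ ha hb, ?_, ?_⟩
      · rwa [map_add, hbf, add_zero]
      · rwa [map_add, hag, zero_add]
    · exact ⟨b, hb, hbf, hbg⟩
  · exact ⟨a, ha, haf, hag⟩

/-- The curve with two branches given by two arcs: the image of the completion in the product of
the two power series rings. -/
def pairCurve (f g : A →+* k⟦X⟧) [IsLocalHom f] [IsLocalHom g] (κ : k →+* A)
    (hf : ∀ b, f (κ b) = PowerSeries.C b) (hg : ∀ b, g (κ b) = PowerSeries.C b) :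
    Subalgebra k (k⟦X⟧ × k⟦X⟧) where
  __ := ((completedHom f).prod (completedHom g)).range
  algebraMap_mem' c := ⟨AdicCompletion.of _ _ (κ c), Prod.ext
    ((completedHom_of f _).trans (hf c)) ((completedHom_of g _).trans (hg c))⟩

variable {f g : A →+* k⟦X⟧} [IsLocalHom f] [IsLocalHom g] {κ : k →+* A}
  {hf : ∀ b, f (κ b) = PowerSeries.C b} {hg : ∀ b, g (κ b) = PowerSeries.C b}

theorem mem_pairCurve {w : k⟦X⟧ × k⟦X⟧} : w ∈ pairCurve f g κ hf hg ↔
    ∃ G, completedHom f G = w.1 ∧ completedHom g G = w.2 :=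
  ⟨fun ⟨G, hG⟩ => ⟨G, congrArg Prod.fst hG, congrArg Prod.snd hG⟩,
    fun ⟨G, h1, h2⟩ => ⟨G, Prod.ext h1 h2⟩⟩

theorem fstCurve_pairCurve : fstCurve (pairCurve f g κ hf hg) =
    arcCurve f fun c => ⟨κ c, hf c⟩ := by
  ext y
  constructor
  · rintro ⟨w, ⟨G, rfl⟩, rfl⟩
    exact ⟨G, rfl⟩
  · rintro ⟨G, rfl⟩
    exact ⟨_, ⟨G, rfl⟩, rfl⟩

theorem sndCurve_pairCurve : sndCurve (pairCurve f g κ hf hg) =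
    arcCurve g fun c => ⟨κ c, hg c⟩ := by
  ext y
  constructor
  · rintro ⟨w, ⟨G, rfl⟩, rfl⟩
    exact ⟨G, rfl⟩
  · rintro ⟨G, rfl⟩
    exact ⟨_, ⟨G, rfl⟩, rfl⟩

/-- The constant terms agree because `A` has residue field `k`; the ring is closed because it
contains the power series in `(f a, g a)`; and `t, u` generate the maximal ideal of the completion
as well. -/
theorem isArcPair_pairCurve [IsNoetherianRing A] {t u : A}
    (htu : Ideal.span {t, u} = maximalIdeal A) {a : A} (ha : a ∈ maximalIdeal A) (haf : f a ≠ 0)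
    (hag : g a ≠ 0) (hof : IsOpenCurve (arcCurve f fun c => ⟨κ c, hf c⟩))
    (hog : IsOpenCurve (arcCurve g fun c => ⟨κ c, hg c⟩)) :
    IsArcPair (pairCurve f g κ hf hg) where
  constantCoeff_eq w hw := by
    obtain ⟨G, h1, h2⟩ := mem_pairCurve.mp hw
    obtain ⟨y, hy⟩ := exists_X_pow_dvd_completedHom_sub (k := k) 1 G
    have hyf := hy f
    have hyg := hy g
    rw [pow_one, PowerSeries.X_dvd_iff, map_sub, sub_eq_zero] at hyf hyg
    rw [← h1, ← h2, hyf, hyg]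
    set c := PowerSeries.constantCoeff (f y)
    have h3 : y - κ c ∈ maximalIdeal A := by
      rw [← constantCoeff_map_eq_zero f, map_sub, hf]
      simp [c]
    rw [← constantCoeff_map_eq_zero g, map_sub, hg, map_sub, sub_eq_zero] at h3
    simpa using h3.symm
  closed := by
    have h1 := (constantCoeff_map_eq_zero f).mpr ha
    have h2 := (constantCoeff_map_eq_zero g).mpr ha
    refine isXClosed_of_pairHom_mem (τ := (f a, g a)) h1 h2 haf hag fun c => mem_pairCurve.mpr ?_
    obtain ⟨G, hG⟩ := exists_completedHom_eq_evalHom κ a ha c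
    exact ⟨G, hG f hf h1, hG g hg h2⟩
  gen := by
    have ht : t ∈ maximalIdeal A := htu ▸ Ideal.subset_span (by simp)
    have hu : u ∈ maximalIdeal A := htu ▸ Ideal.subset_span (by simp)
    have hmem : ∀ b : A, (f b, g b) ∈ pairCurve f g κ hf hg := fun b =>
      mem_pairCurve.mpr ⟨AdicCompletion.of _ _ b, completedHom_of f b, completedHom_of g b⟩
    refine ⟨(f t, g t), hmem t, (f u, g u), hmem u, (constantCoeff_map_eq_zero f).mpr ht,
      (constantCoeff_map_eq_zero f).mpr hu, fun w hw hw0 => ?_⟩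
    obtain ⟨G, h1, h2⟩ := mem_pairCurve.mp hw
    have hG : G ∈ maximalIdeal (AdicCompletion (maximalIdeal A) A) := by
      rw [mem_maximalIdeal, mem_nonunits_iff]
      intro hunit
      have h3 := hunit.map (completedHom f)
      rw [h1, PowerSeries.isUnit_iff_constantCoeff, hw0] at h3
      exact not_isUnit_zero h3
    have hmap : (maximalIdeal A).map (algebraMap A (AdicCompletion (maximalIdeal A) A)) =
        Ideal.span {algebraMap A _ t, algebraMap A _ u} := by
      refine (congrArg (Ideal.map _) htu.symm).trans ?_
      rw [Ideal.map_span, Set.image_pair]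
    rw [AdicCompletion.maximalIdeal_eq_map, hmap, Ideal.mem_span_pair] at hG
    obtain ⟨x, y, rfl⟩ := hG
    have hof' : ∀ b, completedHom f (algebraMap A _ b) = f b := completedHom_of f
    have hog' : ∀ b, completedHom g (algebraMap A _ b) = g b := completedHom_of g
    rw [map_add, map_mul, map_mul, hof', hof'] at h1
    rw [map_add, map_mul, map_mul, hog', hog'] at h2
    refine ⟨(completedHom f x, completedHom g x), ⟨x, rfl⟩,
      (completedHom f y, completedHom g y), ⟨y, rfl⟩, Prod.ext ?_ ?_⟩
    · rw [← h1]
      change _ = f t * completedHom f x + f u * completedHom f y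
      ring
    · rw [← h2]
      change _ = g t * completedHom g x + g u * completedHom g y
      ring
  open_fst := by rwa [fstCurve_pairCurve]
  open_snd := by rwa [sndCurve_pairCurve]

/-- Two primitive arcs of high contact coincide up to a change of the parameter and up to a high
power of the parameter. -/
theorem exists_evalHom_congr_of_inter (p : ℕ) [Fact p.Prime] [CharP k p] [IsNoetherianRing A]
    {t u : A} (htu : Ideal.span {t, u} = maximalIdeal A) (hf0 : ¬ maximalIdeal A ≤ RingHom.ker f)
    (hg0 : ¬ maximalIdeal A ≤ RingHom.ker g) (hf : ∀ b, f (κ b) = PowerSeries.C b)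
    (hg : ∀ b, g (κ b) = PowerSeries.C b) {R S : Subalgebra k k⟦X⟧}
    (hR : (R : Set k⟦X⟧) = (completedHom f).range) (hS : (S : Set k⟦X⟧) = (completedHom g).range)
    (hdR : curveDegree R = 1) (hdS : curveDegree S = 1) {n : ℕ} (hn2 : 2 ≤ n)
    (hn : ∀ G ∈ RingHom.ker (completedHom g),
      ((n * curveMultiplicity S + curveMultiplicity R * curveMultiplicity S *
        max (resolutionLength R) (resolutionLength S) : ℕ) : ℕ∞) ≤ (completedHom f G).order) :
    ∃ (τ : k⟦X⟧) (hτ : PowerSeries.constantCoeff τ = 0), τ.order = 1 ∧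
      ∀ b : A, PowerSeries.X ^ n ∣ f b - evalHom τ hτ (g b) := by
  obtain ⟨a, ha, haf, hag⟩ := exists_mem_maximalIdeal_ne_zero hf0 hg0
  have hRe : R = arcCurve f fun c => ⟨κ c, hf c⟩ := SetLike.coe_injective hR
  have hSe : S = arcCurve g fun c => ⟨κ c, hg c⟩ := SetLike.coe_injective hS
  have haf0 := (constantCoeff_map_eq_zero f).mpr ha
  have hag0 := (constantCoeff_map_eq_zero g).mpr ha
  have hRc : ∀ c, evalHom (f a) haf0 c ∈ R := by
    intro c
    obtain ⟨G, hG⟩ := exists_completedHom_eq_evalHom κ a ha c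
    rw [← SetLike.mem_coe, hR]
    exact ⟨G, hG f hf haf0⟩
  have hSc : ∀ c, evalHom (g a) hag0 c ∈ S := by
    intro c
    obtain ⟨G, hG⟩ := exists_completedHom_eq_evalHom κ a ha c
    rw [← SetLike.mem_coe, hS]
    exact ⟨G, hG g hg hag0⟩
  have hoR := isOpenCurve_of_curveDegree_eq_one haf0 haf hRc hdR
  have hoS := isOpenCurve_of_curveDegree_eq_one hag0 hag hSc hdS
  rw [hoR.curveMultiplicity_eq, hoS.curveMultiplicity_eq] at hn
  have hnR := curveNormalization_eq_univ hoR haf0 haf hRc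
  have hnS := curveNormalization_eq_univ hoS hag0 hag hSc
  set M := max (resolutionLength R) (resolutionLength S) with hM
  have hΓ : IsArcPair (pairCurve f g κ hf hg) :=
    isArcPair_pairCurve htu ha haf hag (hRe ▸ hoR) (hSe ▸ hoS)
  have hf1 : fstCurve (pairCurve f g κ hf hg) = R := fstCurve_pairCurve.trans hRe.symm
  have hs1 : sndCurve (pairCurve f g κ hf hg) = S := sndCurve_pairCurve.trans hSe.symm
  -- Since the multiplicity of the second curve is at least `1`, the summand `n * curveOrder S`
  -- leaves at least `n` after the resolution.
  have hin : InterGE (pairCurve f g κ hf hg) (n + M * (curveOrder R * curveOrder S)) := by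
    intro b hb
    obtain ⟨G, h1, h2⟩ := mem_pairCurve.mp hb
    have h3 := hn G h2
    rw [h1, ← X_pow_dvd_iff_le_order] at h3
    refine (pow_dvd_pow _ ?_).trans h3
    have h4 := hoS.curveOrder_pos
    have h5 : n * 1 ≤ n * curveOrder S := Nat.mul_le_mul_left n h4
    rw [mul_comm M]
    omega
  obtain ⟨Γ', hle, hΓ', hn', hf', hs'⟩ := hΓ.exists_resolution p (by omega) _ _ M
    (by rw [hf1]) (by rw [hs1]) hin
    (by rw [hf1]; exact iterate_quadraticTransform_eq_top hoR hnR (le_max_left _ _))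
    (by rw [hs1]; exact iterate_quadraticTransform_eq_top hoS hnS (le_max_right _ _))
  obtain ⟨τ, hτ, hτo, h⟩ := hΓ'.exists_evalHom_congr hn2 hn' hf' hs'
  exact ⟨τ, hτ, hτo, fun b => h (f b, g b) (hle (mem_pairCurve.mpr
    ⟨AdicCompletion.of _ _ b, completedHom_of f b, completedHom_of g b⟩))⟩

end

/-! ### Unramified extensions and traces -/

section Unramified

/-- Homomorphisms from an unramified algebra to a domain which coincide modulo a proper ideal are
equal. -/
theorem algHom_eq_of_unramified {A B D : Type*} [CommRing A] [CommRing B] [Algebra A B]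
    [CommRing D] [IsDomain D] [Algebra A D] [Algebra.FormallyUnramified A B]
    [Algebra.EssFiniteType A B] (σ τ : B →ₐ[A] D) (I : Ideal D) (hI : I ≠ ⊤)
    (h : ∀ b, σ b - τ b ∈ I) : σ = τ := by
  -- `t` is the separability element of `B ⊗ B`. The product map `ψ` of `σ` and `τ` sends it to `1`
  -- modulo `I`, hence not to `0`, while `ψ t` annihilates all differences `σ b - τ b` in the domain
  -- `D`.
  obtain ⟨t, ht, ht1⟩ := Algebra.FormallyUnramified.iff_exists_tensorProduct.mp
    ‹Algebra.FormallyUnramified A B›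
  let ψ : B ⊗[A] B →ₐ[A] D := Algebra.TensorProduct.productMap σ τ
  have h1 : ∀ z, ψ z - σ (Algebra.TensorProduct.lmul' A z) ∈ I := by
    intro z
    induction z using TensorProduct.induction_on with
    | zero => simp
    | tmul x y =>
      have h2 : ψ (x ⊗ₜ y) - σ (Algebra.TensorProduct.lmul' A (x ⊗ₜ y)) = -σ x * (σ y - τ y) := by
        simp only [ψ, Algebra.TensorProduct.productMap_apply_tmul,
          Algebra.TensorProduct.lmul'_apply_tmul, map_mul]
        ring
      rw [h2]
      exact I.mul_mem_left _ (h y)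
    | add x y hx hy =>
      rw [map_add, map_add, map_add, add_sub_add_comm]
      exact I.add_mem hx hy
  have hψ : ψ t ≠ 0 := by
    intro h0
    have h2 := h1 t
    rw [h0, ht1, map_one, zero_sub, neg_mem_iff] at h2
    exact hI ((Ideal.eq_top_iff_one I).mpr h2)
  ext b
  have h2 := congrArg ψ (ht b)
  rw [map_mul, map_zero, mul_eq_zero, or_iff_left hψ, map_sub, sub_eq_zero] at h2
  simpa [ψ] using h2.symm

/-- A family of distinct homomorphisms from an unramified algebra to a domain has a sum which does
not vanish modulo a prime ideal. -/
theorem exists_sum_algHom_notMem {A B D ι : Type*} [CommRing A] [CommRing B] [Algebra A B]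
    [CommRing D] [IsDomain D] [Algebra A D] [Algebra.FormallyUnramified A B]
    [Algebra.EssFiniteType A B] [Fintype ι] [Nonempty ι] (σ : ι → B →ₐ[A] D)
    (hσ : Function.Injective σ) (I : Ideal D) [I.IsPrime] : ∃ b, ∑ i, σ i b ∉ I := by
  by_contra! hcon
  let f : ι → B →* (D ⧸ I) := fun i => ((Ideal.Quotient.mk I).comp (σ i : B →+* D) : B →+* D ⧸ I)
  have hf : Function.Injective f := by
    intro i j hij
    refine hσ (algHom_eq_of_unramified _ _ I (Ideal.IsPrime.ne_top ‹_›) fun b => ?_)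
    rw [← Ideal.Quotient.mk_eq_mk_iff_sub_mem]
    exact DFunLike.congr_fun hij b
  -- The homomorphisms stay distinct modulo `I`, so Dedekind's independence of characters forbids
  -- that their sum vanishes there.
  have hli := (linearIndependent_monoidHom B (D ⧸ I)).comp f hf
  rw [Fintype.linearIndependent_iff] at hli
  have h1 := hli (fun _ => 1) (by
    ext b
    simp only [Function.comp_apply, one_smul, Finset.sum_apply, Pi.zero_apply]
    have := Ideal.Quotient.eq_zero_iff_mem.mpr (hcon b)
    rw [map_sum] at this
    exact this) (Classical.arbitrary ι)
  exact one_ne_zero h1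

/-- The trace of an unramified extension of a local ring takes a unit value. -/
theorem exists_isUnit_trace {A K L : Type*} [CommRing A] [IsDomain A] [IsLocalRing A]
    [IsNoetherianRing A] [IsIntegrallyClosed A] [Field K] [Algebra A K] [IsFractionRing A K]
    [Field L] [Algebra K L] [Algebra A L] [IsScalarTower A K L] [FiniteDimensional K L]
    [IsGalois K L] (hΩ : Subsingleton (Ω[integralClosure A L⁄A])) :
    ∃ (b : L) (c : A), IsIntegral A b ∧ IsUnit c ∧
      algebraMap A K c = Algebra.trace K L b := by
  have : Algebra.FormallyUnramified A (integralClosure A L) :=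
    (Algebra.formallyUnramified_iff _ _).mpr hΩ
  have : Module.Finite A (integralClosure A L) := IsIntegralClosure.finite A K L _
  have hinj : Function.Injective (algebraMap A (integralClosure A L)) := by
    have h1 : Function.Injective (algebraMap A L) := by
      rw [IsScalarTower.algebraMap_eq A K L]
      exact (algebraMap K L).injective.comp (IsFractionRing.injective A K)
    exact fun y z hyz => h1 (congrArg Subtype.val hyz)
  obtain ⟨Q, hQ, hQ2⟩ := Ideal.exists_ideal_over_prime_of_isIntegral_of_isDomain
    (S := integralClosure A L) (maximalIdeal A) (by
      rw [(RingHom.injective_iff_ker_eq_bot _).mp hinj]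
      exact bot_le)
  -- The sum of the conjugates of `b` is its trace and lies in `A`. Since `Q` lies over the maximal
  -- ideal of `A`, avoiding `Q` makes the trace a unit.
  obtain ⟨b, hb⟩ := exists_sum_algHom_notMem
    (fun g : Gal(L/K) => (galRestrictHom A K L (integralClosure A L) g : _ →ₐ[A] _))
    (fun g h hgh => by
      ext x
      exact DFunLike.congr_fun ((galRestrictHom A K L (integralClosure A L)).injective hgh) x) Q
  have hbi : IsIntegral A (b : L) := b.2
  obtain ⟨c, hc⟩ := IsIntegrallyClosed.isIntegral_iff.mp (Algebra.isIntegral_trace (L := K) hbi)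
  refine ⟨b, c, hbi, ?_, hc⟩
  by_contra hcu
  have hcm : c ∈ Q.comap (algebraMap A (integralClosure A L)) := by
    rw [hQ2]; exact (mem_maximalIdeal c).mpr hcu
  apply hb
  convert Ideal.mem_comap.mp hcm
  apply Subtype.ext
  change _ = algebraMap A L c
  rw [IsScalarTower.algebraMap_apply A K L, hc, trace_eq_sum_automorphisms,
    AddSubmonoidClass.coe_finsetSum]
  exact Finset.sum_congr rfl fun g _ => algebraMap_galRestrictHom_apply A K L _ _ b

end Unramified

/-! ### Artin–Schreier extensions -/

section ArtinSchreier

open Polynomial in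
-- The polynomial is `T ^ p - T` with `T` replaced by `T - x`, and `T ^ p - T` already splits over
-- the prime field. Reducible polynomials are included, so trivial extensions need no separate
-- treatment.
theorem isSplittingField_artinSchreier (p : ℕ) [hp : Fact p.Prime] {F E : Type*} [Field F] [CharP F p]
    [Field E] [Algebra F E] {a : F} {x : E} (hx : x ^ p - x = algebraMap F E a)
    (hE : IntermediateField.adjoin F {x} = ⊤) :
    (X ^ p - X - C a : F[X]).IsSplittingField F E := by
  have : CharP E p := charP_of_injective_algebraMap (algebraMap F E).injective p
  let _ : Algebra (ZMod p) E := ZMod.algebra E p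
  have hroot : aeval x (X ^ p - X - C a : F[X]) = 0 := by simp [hx]
  have hne : (X ^ p - X - C a : F[X]) ≠ 0 := by
    intro h
    have h1 := congrArg (fun q : F[X] => q.coeff p) h
    simp [coeff_X, coeff_C, hp.out.one_lt.ne, hp.out.ne_zero] at h1
  constructor
  · have h1 := (FiniteField.splits_X_pow_card_sub_X (K := ZMod p) p).map (algebraMap (ZMod p) E)
    have h2 := h1.comp_X_sub_C x
    have h3 : Polynomial.map (algebraMap F E) (X ^ p - X - C a) =
        (Polynomial.map (algebraMap (ZMod p) E) (Polynomial.map (algebraMap (ZMod p) (ZMod p))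
          (X ^ Fintype.card (ZMod p) - X))).comp (X - C x) := by
      simp only [ZMod.card, Polynomial.map_sub, Polynomial.map_pow, map_X, sub_comp, pow_comp,
        X_comp, map_C]
      rw [sub_pow_char, ← hx, C_sub, C_pow]
      ring
    rw [h3]
    exact h2
  · have h1 := IntermediateField.adjoin_simple_toSubalgebra_of_isAlgebraic
      (F := F) (α := x) ⟨_, hne, hroot⟩
    rw [hE, IntermediateField.top_toSubalgebra] at h1
    rw [eq_top_iff, h1]
    refine Algebra.adjoin_mono (Set.singleton_subset_iff.mpr ?_)
    rw [mem_rootSet]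
    exact ⟨hne, hroot⟩

open Polynomial in
theorem separable_artinSchreier (p : ℕ) [Fact p.Prime] {F : Type*} [Field F] [CharP F p]
    (a : F) : (X ^ p - X - C a : F[X]).Separable := by
  have h : derivative (X ^ p - X - C a : F[X]) = -1 := by simp [derivative_X_pow]
  exact ⟨0, -1, by rw [h]; ring⟩

open Polynomial in
theorem isGalois_artinSchreier (p : ℕ) [Fact p.Prime] {F E : Type*} [Field F] [CharP F p]
    [Field E] [Algebra F E] {a : F} {x : E} (hx : x ^ p - x = algebraMap F E a)
    (hE : IntermediateField.adjoin F {x} = ⊤) : FiniteDimensional F E ∧ IsGalois F E := by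
  have h1 := isSplittingField_artinSchreier p hx hE
  exact ⟨Polynomial.IsSplittingField.finiteDimensional E (X ^ p - X - C a),
    IsGalois.of_separable_splitting_field (p := X ^ p - X - C a) (separable_artinSchreier p a)⟩

/-- An Artin–Schreier extension whose trace takes a value `ρ ^ N` on an integral element has an
Artin–Schreier generator with the poles only at `ρ`. -/
theorem exists_artinSchreier_representative (p : ℕ) [hp : Fact p.Prime] {A K L : Type*} [CommRing A]
    [IsDomain A] [IsIntegrallyClosed A] [Field K] [CharP K p] [Algebra A K] [IsFractionRing A K]
    [Field L] [Algebra K L] [Algebra A L] [IsScalarTower A K L] [FiniteDimensional K L]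
    [IsGalois K L] {a : K} {x : L} (hx : x ^ p - x = algebraMap K L a) {ρ : A} (hρ : ρ ≠ 0)
    {b : L} (hb : IsIntegral A b) (hbρ : algebraMap A K ρ = Algebra.trace K L b) :
    ∃ (c : K) (n : A), (a - (c ^ p - c)) * algebraMap A K ρ ^ p = algebraMap A K n := by
  have : CharP L p := charP_of_injective_algebraMap (algebraMap K L).injective p
  have hρK : algebraMap A K ρ ≠ 0 := by
    rwa [Ne, map_eq_zero_iff _ (IsFractionRing.injective A K)]
  set r := algebraMap A K ρ with hr
  have hrL : algebraMap K L r = algebraMap A L ρ := (IsScalarTower.algebraMap_apply A K L ρ).symm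
  have hrL0 : algebraMap K L r ≠ 0 := by
    rwa [Ne, map_eq_zero_iff _ (algebraMap K L).injective]
  -- A weighted average of the conjugates of `x`, so that `r (x - c)` is the sum of the `g b * (x -
  -- g x)`. The factors `x - g x` are roots of `T ^ p - T`, hence integral however bad the poles of
  -- `x` are.
  set c := Algebra.trace K L (b * x) / r with hc
  have hy : IsIntegral A (algebraMap K L r * (x - algebraMap K L c)) := by
    have h1 : algebraMap K L r * (x - algebraMap K L c) = ∑ g : Gal(L/K), g b * (x - g x) := by
      rw [mul_sub, ← map_mul, hc, mul_div_cancel₀ _ hρK, hbρ, trace_eq_sum_automorphisms,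
        trace_eq_sum_automorphisms, Finset.sum_mul, ← Finset.sum_sub_distrib]
      exact Finset.sum_congr rfl fun g _ => by rw [map_mul, mul_sub]
    rw [h1]
    refine IsIntegral.sum _ fun g _ => IsIntegral.mul ?_ ?_
    · exact hb.map (g.toAlgHom.restrictScalars A)
    · have h2 : (x - g x) ^ p - (x - g x) = 0 := by
        have h3 := congrArg g hx
        rw [map_sub, map_pow, g.commutes] at h3
        rw [sub_pow_char]
        linear_combination hx - h3
      refine ⟨Polynomial.X ^ p - Polynomial.X, ?_, by simpa using h2⟩
      refine Polynomial.monic_X_pow_sub ?_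
      rw [Polynomial.degree_X]
      exact_mod_cast hp.out.one_lt
  have h2 : (x - algebraMap K L c) ^ p - (x - algebraMap K L c) =
      algebraMap K L (a - (c ^ p - c)) := by
    rw [sub_pow_char, map_sub, map_sub, map_pow, ← hx]
    ring
  have h3 : algebraMap K L ((a - (c ^ p - c)) * r ^ p) =
      (algebraMap K L r * (x - algebraMap K L c)) ^ p -
        algebraMap K L r ^ (p - 1) * (algebraMap K L r * (x - algebraMap K L c)) := by
    rw [map_mul, ← h2, map_pow]
    obtain ⟨m, hm⟩ := Nat.exists_eq_succ_of_ne_zero hp.out.ne_zero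
    rw [hm, Nat.succ_sub_one]
    rw [mul_pow]
    simp only [Nat.succ_eq_add_one]
    ring
  have h4 : IsIntegral A (algebraMap K L ((a - (c ^ p - c)) * r ^ p)) := by
    rw [h3]
    refine (hy.pow p).sub (IsIntegral.mul (IsIntegral.pow ?_ _) hy)
    rw [hrL]
    exact isIntegral_algebraMap
  rw [isIntegral_algebraMap_iff (algebraMap K L).injective] at h4
  obtain ⟨n, hn⟩ := IsIntegrallyClosed.isIntegral_iff.mp h4
  exact ⟨c, n, hn.symm⟩

end ArtinSchreier

/-! ### Parameters of two-dimensional regular local rings -/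

section Parameters

variable {A : Type*} [CommRing A] [IsLocalRing A] {t u : A}

theorem mem_maximalIdeal_iff_of_span (htu : Ideal.span {t, u} = maximalIdeal A) (z : A) :
    z ∈ maximalIdeal A ↔ ∃ y, t ∣ z - u * y := by
  rw [← htu, Ideal.mem_span_pair]
  constructor
  · rintro ⟨b, c, rfl⟩
    exact ⟨c, b, by ring⟩
  · rintro ⟨y, b, hb⟩
    exact ⟨b, y, by linear_combination -hb⟩

variable [IsNoetherianRing A]

/-- In `A / t` the maximal ideal is generated by `u`. An element divisible by `u` arbitrarily often
is zero there by Krull's intersection theorem, so every other one is a unit times a power of `u`. -/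
theorem exists_isUnit_dvd_sub_pow_mul (htu : Ideal.span {t, u} = maximalIdeal A) {z : A}
    (hz : ¬ t ∣ z) : ∃ (i : ℕ) (c : A), IsUnit c ∧ t ∣ z - u ^ i * c := by
  classical
  have htm : t ∈ maximalIdeal A := htu ▸ Ideal.subset_span (by simp)
  by_contra! hcon
  have h1 : ∀ i, ∃ y, t ∣ z - u ^ i * y := by
    intro i
    induction i with
    | zero => exact ⟨z, by simp⟩
    | succ i ih =>
      obtain ⟨y, hy⟩ := ih
      have hym : y ∈ maximalIdeal A := (mem_maximalIdeal y).mpr fun hu => hcon i y hu hy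
      obtain ⟨y', hy'⟩ := (mem_maximalIdeal_iff_of_span htu y).mp hym
      refine ⟨y', ?_⟩
      have := dvd_add hy (hy'.mul_left (u ^ i))
      convert this using 1
      ring
  have hum : u ∈ maximalIdeal A := htu ▸ Ideal.subset_span (by simp)
  have h2 : Ideal.Quotient.mk (Ideal.span {t}) z ∈
      ⨅ i : ℕ, Ideal.map (Ideal.Quotient.mk (Ideal.span {t})) (maximalIdeal A) ^ i := by
    rw [Ideal.mem_iInf]
    intro i
    obtain ⟨y, hy⟩ := h1 i
    have h3 := Ideal.Quotient.eq_zero_iff_mem.mpr (Ideal.mem_span_singleton.mpr hy)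
    rw [map_sub, sub_eq_zero] at h3
    rw [h3, map_mul, map_pow]
    exact Ideal.mul_mem_right _ _ (Ideal.pow_mem_pow (Ideal.mem_map_of_mem _ hum) i)
  have hne : Ideal.span {t} ≠ ⊤ := by
    rw [Ne, Ideal.span_singleton_eq_top]
    exact htm
  have : Nontrivial (A ⧸ Ideal.span {t}) := Ideal.Quotient.nontrivial_iff.mpr hne
  have : IsLocalRing (A ⧸ Ideal.span {t}) :=
    IsLocalRing.of_surjective' _ Ideal.Quotient.mk_surjective
  rw [Ideal.iInf_pow_eq_bot_of_isLocalRing] at h2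
  · exact hz (Ideal.mem_span_singleton.mp (Ideal.Quotient.eq_zero_iff_mem.mp h2))
  · intro htop
    rw [Ideal.eq_top_iff_one, ← map_one (Ideal.Quotient.mk (Ideal.span {t})),
      Ideal.mem_map_iff_of_surjective _ Ideal.Quotient.mk_surjective] at htop
    obtain ⟨y, hy, hy1⟩ := htop
    have h3 : y - 1 ∈ maximalIdeal A := (Ideal.span_singleton_le_iff_mem _).mpr htm
      ((Ideal.Quotient.mk_eq_mk_iff_sub_mem _ _).mp hy1)
    exact (maximalIdeal.isMaximal A).ne_top
      ((Ideal.eq_top_iff_one _).mpr (by simpa using sub_mem hy h3))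

theorem dvd_sub_or_dvd_sub_of_span (htu : Ideal.span {t, u} = maximalIdeal A) (y z : A) :
    (∃ g, t ∣ z - g * y) ∨ ∃ g, t ∣ y - g * z := by
  by_cases hy : t ∣ y
  · exact Or.inr ⟨0, by simpa using hy⟩
  by_cases hz : t ∣ z
  · exact Or.inl ⟨0, by simpa using hz⟩
  obtain ⟨i, c, hc, h1⟩ := exists_isUnit_dvd_sub_pow_mul htu hy
  obtain ⟨j, d, hd, h2⟩ := exists_isUnit_dvd_sub_pow_mul htu hz
  obtain ⟨c', hc'⟩ := hc.exists_right_inv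
  obtain ⟨d', hd'⟩ := hd.exists_right_inv
  rcases le_total i j with h | h
  · refine Or.inl ⟨u ^ (j - i) * c' * d, ?_⟩
    have h3 : z - u ^ (j - i) * c' * d * y =
        (z - u ^ j * d) - u ^ (j - i) * c' * d * (y - u ^ i * c) := by
      rw [← Nat.sub_add_cancel h, pow_add, Nat.add_sub_cancel]
      linear_combination (-(u ^ (j - i) * u ^ i * d)) * hc'
    rw [h3]
    exact dvd_sub h2 (h1.mul_left _)
  · refine Or.inr ⟨u ^ (i - j) * d' * c, ?_⟩
    have h3 : y - u ^ (i - j) * d' * c * z =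
        (y - u ^ i * c) - u ^ (i - j) * d' * c * (z - u ^ j * d) := by
      rw [← Nat.sub_add_cancel h, pow_add, Nat.add_sub_cancel]
      linear_combination (-(u ^ (i - j) * u ^ j * c)) * hd'
    rw [h3]
    exact dvd_sub h1 (h2.mul_left _)

/-- By Krull's principal ideal theorem a maximal ideal of height two is not minimal over a single
element. -/
theorem isUnit_of_forall_maximalIdeal_le (hd : ringKrullDim A = 2) (z : A)
    (h : ∀ q : Ideal A, q.IsPrime → z ∈ q → maximalIdeal A ≤ q) : IsUnit z := by
  by_contra hz
  have hmin : maximalIdeal A ∈ (Ideal.span {z}).minimalPrimes := by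
    refine ⟨⟨inferInstance, (Ideal.span_singleton_le_iff_mem _).mpr hz⟩, fun q hq _ => ?_⟩
    exact h q hq.1 ((Ideal.span_singleton_le_iff_mem _).mp hq.2)
  have h1 := Ideal.height_le_one_of_isPrincipal_of_mem_minimalPrimes (Ideal.span {z}) _ hmin
  have h2 := IsLocalRing.maximalIdeal_height_eq_ringKrullDim (R := A)
  rw [hd] at h2
  have h3 : ((maximalIdeal A).height : WithBot ℕ∞) ≤ ((1 : ℕ∞) : WithBot ℕ∞) := by
    exact_mod_cast h1
  rw [h2] at h3
  exact absurd h3 (by decide)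

/-- If `t` divided a power of `u`, only the maximal ideal could contain `t`, against dimension two.
So powers of `u` survive in `A / t`, and products of nonzero elements `u ^ i c`, with `c` a unit,
are nonzero. -/
theorem prime_of_span_eq_maximalIdeal (hd : ringKrullDim A = 2)
    (htu : Ideal.span {t, u} = maximalIdeal A) : Prime t ∧ ¬ t ∣ u := by
  have htm : t ∈ maximalIdeal A := htu ▸ Ideal.subset_span (by simp)
  have hum : u ∈ maximalIdeal A := htu ▸ Ideal.subset_span (by simp)
  have hpow : ∀ n, ¬ t ∣ u ^ n := by
    intro n hn
    refine htm (isUnit_of_forall_maximalIdeal_le hd t fun q hq htq => ?_)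
    rw [← htu, Ideal.span_le, Set.insert_subset_iff, Set.singleton_subset_iff]
    exact ⟨htq, hq.mem_of_pow_mem n (q.mem_of_dvd hn htq)⟩
  refine ⟨⟨?_, htm, ?_⟩, by simpa using hpow 1⟩
  · rintro rfl
    refine hum (isUnit_of_forall_maximalIdeal_le hd u fun q hq huq => ?_)
    rw [← htu, Ideal.span_le, Set.insert_subset_iff, Set.singleton_subset_iff]
    exact ⟨q.zero_mem, huq⟩
  · intro y z hyz
    by_contra! hcon
    obtain ⟨i, c, hc, h1⟩ := exists_isUnit_dvd_sub_pow_mul htu hcon.1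
    obtain ⟨j, d, hd, h2⟩ := exists_isUnit_dvd_sub_pow_mul htu hcon.2
    apply hpow (i + j)
    rw [← (hc.mul hd).dvd_mul_right]
    have h3 : u ^ (i + j) * (c * d) =
        y * z - (y - u ^ i * c) * z - u ^ i * c * (z - u ^ j * d) := by ring
    rw [h3]
    exact dvd_sub (dvd_sub hyz (h1.mul_right _)) (h2.mul_left _)

end Parameters

/-! ### Reduction of the poles of an Artin–Schreier representative -/

section Poles

variable {A K : Type*} [CommRing A] [IsDomain A] [IsLocalRing A] [IsNoetherianRing A] {t u : A}
  [Field K] [Algebra A K] [IsFractionRing A K]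

/-- With `e` minimal, this is the pole order of `c` along `t` together with a leading coefficient `b
/ d`; unique factorization in `A` is not needed. -/
theorem exists_mul_pow_mul_eq (ht : Prime t) (c : K) : ∃ (e : ℕ) (b d : A), ¬ t ∣ d ∧
    c * algebraMap A K (t ^ e * d) = algebraMap A K b ∧ (e = 0 ∨ ¬ t ∣ b) := by
  classical
  have hex : ∃ e : ℕ, ∃ b d : A, ¬ t ∣ d ∧ c * algebraMap A K (t ^ e * d) = algebraMap A K b := by
    obtain ⟨b, d, hd, rfl⟩ := IsFractionRing.div_surjective (A := A) c
    have hd0 := nonZeroDivisors.ne_zero hd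
    obtain ⟨e, d', hd', rfl⟩ := WfDvdMonoid.max_power_factor hd0 ht.irreducible
    refine ⟨e, b, d', hd', div_mul_cancel₀ _ ?_⟩
    rwa [Ne, map_eq_zero_iff _ (IsFractionRing.injective A K)]
  obtain ⟨b, d, hd, hb⟩ := Nat.find_spec hex
  refine ⟨Nat.find hex, b, d, hd, hb, ?_⟩
  by_contra! hcon
  obtain ⟨h0, b', rfl⟩ := hcon
  obtain ⟨e, he⟩ := Nat.exists_eq_succ_of_ne_zero h0
  refine Nat.find_min hex (m := e) (by omega) ⟨b', d, hd, ?_⟩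
  have ht0 : algebraMap A K t ≠ 0 := by
    rw [Ne, map_eq_zero_iff _ (IsFractionRing.injective A K)]
    exact ht.ne_zero
  apply mul_left_cancel₀ ht0
  rw [← map_mul, ← hb, he, pow_succ]
  simp only [map_mul]
  ring

/-- A pole of order `M + 1 > m` cannot come from `a`, hence comes from `c ^ p`; so `M + 1 = p e` and
the leading coefficient is a `p`-th power up to `u ^ M'`. A fraction `w` with denominator `t ^ e u ^
q` and the same leading term is subtracted from `c`. The point is that no new poles arise outside `t
u = 0`. -/
theorem exists_reduce_pole (p : ℕ) [hp : Fact p.Prime] [CharP K p] (ht : Prime t) (hu : ¬ t ∣ u)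
    (htu : Ideal.span {t, u} = maximalIdeal A) {a c : K} {n s z : A} {m M M' : ℕ} (hm : m ≤ M)
    (hn : (a - (c ^ p - c)) * algebraMap A K (t ^ (M + 1) * u ^ M') = algebraMap A K n)
    (hs : ¬ t ∣ s) (hz : a * algebraMap A K (t ^ m * s) = algebraMap A K z) :
    ∃ (c' : K) (n' : A), (a - (c' ^ p - c')) * algebraMap A K (t ^ M * u ^ M') =
      algebraMap A K n' := by
  have hinj := IsFractionRing.injective A K
  have ht0 : algebraMap A K t ≠ 0 := by
    rw [Ne, map_eq_zero_iff _ hinj]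
    exact ht.ne_zero
  have hu0 : algebraMap A K u ≠ 0 := by
    rw [Ne, map_eq_zero_iff _ hinj]
    rintro rfl
    exact hu (dvd_zero t)
  have hdiv : ∀ (c' : K) (n' : A), t ∣ n' →
      (a - (c' ^ p - c')) * algebraMap A K (t ^ (M + 1) * u ^ M') = algebraMap A K n' →
      ∃ (c' : K) (n' : A), (a - (c' ^ p - c')) * algebraMap A K (t ^ M * u ^ M') =
        algebraMap A K n' := by
    rintro c' _ ⟨n', rfl⟩ h
    refine ⟨c', n', mul_left_cancel₀ ht0 ?_⟩
    rw [← map_mul, ← h, pow_succ]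
    simp only [map_mul]
    ring
  by_cases htn : t ∣ n
  · exact hdiv c n htn hn
  obtain ⟨e, b, d, hd, hb, heb⟩ := exists_mul_pow_mul_eq ht c
  have hp1 : ∃ r, p = r + 1 ∧ 1 ≤ r :=
    ⟨p - 1, by have := hp.out.two_le; omega, by have := hp.out.two_le; omega⟩
  obtain ⟨r, rfl, hr1⟩ := hp1
  obtain ⟨l, rfl⟩ := Nat.exists_eq_add_of_le hm
  have hkey : n * d ^ (r + 1) * s * t ^ ((r + 1) * e) =
      z * t ^ (l + 1) * u ^ M' * d ^ (r + 1) * t ^ ((r + 1) * e) -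
      b ^ (r + 1) * t ^ (m + l + 1) * u ^ M' * s +
      b * t ^ (e * r) * d ^ r * t ^ (m + l + 1) * u ^ M' * s := by
    apply hinj
    simp only [map_add, map_sub, map_mul, map_pow] at hn hz hb ⊢
    rw [← hn, ← hz, ← hb]
    ring
  -- Here `p = r + 1` and `M = m + l`. If the pole orders `p e` of `c ^ p` and `M + 1` of the
  -- representative differed, `t` would divide a product of elements that it does not divide.
  rcases lt_trichotomy ((r + 1) * e) (m + l + 1) with h | h | h
  · exfalso
    obtain ⟨i, hi⟩ := Nat.exists_eq_add_of_lt h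
    rw [hi] at hkey
    have h1 : n * d ^ (r + 1) * s = t * (z * t ^ l * u ^ M' * d ^ (r + 1) -
        b ^ (r + 1) * t ^ i * u ^ M' * s + b * t ^ (e * r) * d ^ r * t ^ i * u ^ M' * s) := by
      apply mul_right_cancel₀ (pow_ne_zero ((r + 1) * e) ht.ne_zero)
      rw [hkey]
      ring
    have h2 : t ∣ n * d ^ (r + 1) * s := ⟨_, h1⟩
    rcases ht.dvd_or_dvd h2 with h3 | h3
    · rcases ht.dvd_or_dvd h3 with h4 | h4
      · exact htn h4
      · exact hd (ht.dvd_of_dvd_pow h4)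
    · exact hs h3
  · have he : e ≠ 0 := by rintro rfl; simp at h
    have htb := heb.resolve_left he
    obtain ⟨e', rfl⟩ := Nat.exists_eq_succ_of_ne_zero he
    obtain ⟨r', rfl⟩ := Nat.exists_eq_add_of_le' hr1
    rw [Nat.succ_eq_add_one] at *
    have h1 : t ∣ s * (n * d ^ (r' + 1 + 1) + b ^ (r' + 1 + 1) * u ^ M') := by
      refine ⟨z * t ^ l * u ^ M' * d ^ (r' + 1 + 1) +
        b * t ^ (e' * (r' + 1) + r') * d ^ (r' + 1) * u ^ M' * s, ?_⟩
      apply mul_right_cancel₀ (pow_ne_zero (m + l + 1) ht.ne_zero)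
      rw [h] at hkey
      linear_combination hkey
    have h2 := (ht.dvd_or_dvd h1).resolve_left hs
    -- With `M' = p q + j`, the relation `h2` says that `-n` is `u ^ j` times the `p`-th power of `u
    -- ^ q b / d` modulo `t`. Since `j < p`, this quotient has nonnegative `u`-adic value and so is
    -- represented by some `g ∈ A`. A strictly negative value would make `1` a multiple of `u`
    -- modulo `t`.
    set q := M' / (r' + 1 + 1) with hq
    set j := M' % (r' + 1 + 1) with hj
    have hM' : M' = (r' + 1 + 1) * q + j := (Nat.div_add_mod M' (r' + 1 + 1)).symm
    have hjlt : j < r' + 1 + 1 := Nat.mod_lt _ (by omega)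
    obtain ⟨g, hg⟩ : ∃ g, t ∣ u ^ q * b - g * d := by
      rcases dvd_sub_or_dvd_sub_of_span htu d (u ^ q * b) with h3 | ⟨g, hg⟩
      · exact h3
      by_cases hgu : IsUnit g
      · obtain ⟨g', hg'⟩ := hgu.exists_right_inv
        refine ⟨g', ?_⟩
        have h4 : u ^ q * b - g' * d = -g' * (d - g * (u ^ q * b)) := by
          linear_combination (-(u ^ q * b)) * hg'
        rw [h4]
        exact hg.mul_left _
      exfalso
      obtain ⟨y, hy⟩ := (mem_maximalIdeal_iff_of_span htu g).mp hgu
      have h5 : t ∣ d - u * y * (u ^ q * b) := by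
        have h6 := dvd_add hg (hy.mul_right (u ^ q * b))
        convert h6 using 1
        ring
      have h6 : t ∣ n * (d ^ (r' + 1 + 1) - (u * y * (u ^ q * b)) ^ (r' + 1 + 1)) :=
        (h5.trans (sub_dvd_pow_sub_pow _ _ _)).mul_left _
      obtain ⟨i, hi⟩ := Nat.exists_eq_add_of_lt hjlt
      have h7 : t ∣ b ^ (r' + 1 + 1) * (u ^ M' * (n * u ^ (i + 1) * y ^ (r' + 1 + 1) + 1)) := by
        have h8 := dvd_sub h2 h6
        convert h8 using 1
        have h9 : (u * y * (u ^ q * b)) ^ (r' + 1 + 1) =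
            u ^ (j + i + 1) * y ^ (r' + 1 + 1) * u ^ ((r' + 1 + 1) * q) * b ^ (r' + 1 + 1) := by
          rw [← hi]
          ring
        rw [h9, hM']
        ring
      have h8 := (ht.dvd_or_dvd h7).resolve_left fun h => htb (ht.dvd_of_dvd_pow h)
      have h9 := (ht.dvd_or_dvd h8).resolve_left fun h => hu (ht.dvd_of_dvd_pow h)
      have htm : t ∈ maximalIdeal A := htu ▸ Ideal.subset_span (by simp)
      have hum : u ∈ maximalIdeal A := htu ▸ Ideal.subset_span (by simp)
      have h10 := Ideal.mem_of_dvd _ h9 htm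
      have h11 : n * u ^ (i + 1) * y ^ (r' + 1 + 1) ∈ maximalIdeal A :=
        Ideal.mul_mem_right _ _ (Ideal.mul_mem_left _ _ (Ideal.pow_mem_of_mem _ hum _ (by omega)))
      exact (maximalIdeal.isMaximal A).ne_top
        ((Ideal.eq_top_iff_one _).mpr (by simpa using sub_mem h10 h11))
    have h3 : t ∣ n + u ^ j * g ^ (r' + 1 + 1) := by
      have h4 : t ∣ (u ^ q * b) ^ (r' + 1 + 1) - (g * d) ^ (r' + 1 + 1) :=
        hg.trans (sub_dvd_pow_sub_pow _ _ _)
      have h5 : t ∣ (n + u ^ j * g ^ (r' + 1 + 1)) * d ^ (r' + 1 + 1) := by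
        have h6 := dvd_sub h2 (h4.mul_left (u ^ j))
        convert h6 using 1
        rw [hM']
        ring
      exact (ht.dvd_or_dvd h5).resolve_right fun h => hd (ht.dvd_of_dvd_pow h)
    -- Replacing `c` by `c - w` adds `w ^ p - w` to the representative. The `p`-th power cancels the
    -- leading term modulo `t`, and `w` itself has a pole of smaller order `e < p e`.
    set w : K := algebraMap A K g / algebraMap A K (t ^ (e' + 1) * u ^ q) with hw
    have hw0 : algebraMap A K (t ^ (e' + 1) * u ^ q) ≠ 0 := by
      rw [map_mul, map_pow, map_pow]
      exact mul_ne_zero (pow_ne_zero _ ht0) (pow_ne_zero _ hu0)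
    have hwg : w * algebraMap A K (t ^ (e' + 1) * u ^ q) = algebraMap A K g :=
      div_mul_cancel₀ _ hw0
    refine hdiv (c - w) (n + u ^ j * g ^ (r' + 1 + 1) -
      t * (t ^ (e' * (r' + 1) + r') * u ^ (q * (r' + 1) + j) * g)) (dvd_sub h3 (dvd_mul_right _ _)) ?_
    rw [sub_pow_char]
    rw [← h, hM'] at hn ⊢
    simp only [map_add, map_sub, map_mul, map_pow] at hn hwg ⊢
    rw [← hn, ← hwg]
    ring
  · exfalso
    have he : e ≠ 0 := by rintro rfl; simp at h
    have htb := heb.resolve_left he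
    obtain ⟨e', rfl⟩ := Nat.exists_eq_succ_of_ne_zero he
    obtain ⟨r', rfl⟩ := Nat.exists_eq_add_of_le' hr1
    rw [Nat.succ_eq_add_one] at *
    obtain ⟨i, hi⟩ := Nat.exists_eq_add_of_lt h
    rw [hi] at hkey
    have h1 : b ^ (r' + 1 + 1) * u ^ M' * s = t * (z * t ^ l * t ^ (i + 1) * u ^ M' *
        d ^ (r' + 1 + 1) + b * t ^ (e' * (r' + 1) + r') * d ^ (r' + 1) * u ^ M' * s -
        n * d ^ (r' + 1 + 1) * s * t ^ i) := by
      apply mul_right_cancel₀ (pow_ne_zero (m + l + 1) ht.ne_zero)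
      linear_combination hkey
    have h2 : t ∣ b ^ (r' + 1 + 1) * u ^ M' * s := ⟨_, h1⟩
    rcases ht.dvd_or_dvd h2 with h3 | h3
    · rcases ht.dvd_or_dvd h3 with h4 | h4
      · exact htb (ht.dvd_of_dvd_pow h4)
      · exact hu (ht.dvd_of_dvd_pow h4)
    · exact hs h3

theorem exists_le_pole (p : ℕ) [Fact p.Prime] [CharP K p] (ht : Prime t) (hu : ¬ t ∣ u)
    (htu : Ideal.span {t, u} = maximalIdeal A) {a c : K} {n s z : A} {m M M' : ℕ}
    (hn : (a - (c ^ p - c)) * algebraMap A K (t ^ M * u ^ M') = algebraMap A K n)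
    (hs : ¬ t ∣ s) (hz : a * algebraMap A K (t ^ m * s) = algebraMap A K z) :
    ∃ (c' : K) (n' : A), (a - (c' ^ p - c')) * algebraMap A K (t ^ m * u ^ M') =
      algebraMap A K n' := by
  rcases le_total M m with h | h
  · refine ⟨c, n * t ^ (m - M), ?_⟩
    rw [map_mul _ n, ← hn, ← Nat.sub_add_cancel h, pow_add, Nat.add_sub_cancel]
    simp only [map_mul]
    ring
  · induction M, h using Nat.le_induction generalizing c n with
    | base => exact ⟨c, n, hn⟩
    | succ M hM ih =>
      obtain ⟨c', n', h'⟩ := exists_reduce_pole p ht hu htu hM hn hs hz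
      exact ih h'

end Poles

/-! ### Normality of regular local rings of dimension at most two -/

section Normality

theorem isIntegrallyClosed_of_isRegularLocalRing {B : Type*} [CommRing B] [IsDomain B]
    [IsRegularLocalRing B] (h : ringKrullDim B ≤ 1) : IsIntegrallyClosed B := by
  have h1 := IsRegularLocalRing.spanFinrank_maximalIdeal (R := B)
  rw [IsLocalRing.spanFinrank_maximalIdeal_eq_finrank_cotangentSpace] at h1
  rw [← h1] at h
  have h2 : Module.finrank (ResidueField B) (CotangentSpace B) ≤ 1 := by exact_mod_cast h
  have h3 := (tfae_of_isNoetherianRing_of_isLocalRing_of_isDomain B).out 5 3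
  exact (h3.mp h2).1

/-- The denominators of `x` form an ideal contained in no prime but possibly the maximal one, so
powers of `t` and of `u` are denominators. As `t` is prime and does not divide `u`, the power of `t`
cancels. -/
theorem mem_range_of_forall_prime {A K : Type*} [CommRing A] [IsDomain A] [IsLocalRing A]
    [IsNoetherianRing A] {t u : A} [Field K] [Algebra A K] [IsFractionRing A K]
    (ht : Prime t) (hu : ¬ t ∣ u) (htu : Ideal.span {t, u} = maximalIdeal A) {x : K}
    (h : ∀ q : Ideal A, q.IsPrime → q ≠ maximalIdeal A →
      ∃ d ∉ q, ∃ y, x * algebraMap A K d = algebraMap A K y) :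
    ∃ y, algebraMap A K y = x := by
  have hinj := IsFractionRing.injective A K
  let I : Ideal A :=
    { carrier := {d | ∃ y, x * algebraMap A K d = algebraMap A K y}
      zero_mem' := ⟨0, by simp⟩
      add_mem' := by
        rintro d d' ⟨y, hy⟩ ⟨y', hy'⟩
        exact ⟨y + y', by rw [map_add, map_add, mul_add, hy, hy']⟩
      smul_mem' := by
        rintro c d ⟨y, hy⟩
        exact ⟨c * y, by rw [smul_eq_mul, map_mul, map_mul, ← hy]; ring⟩ }
  have hI : maximalIdeal A ≤ I.radical := by
    rw [Ideal.radical_eq_sInf]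
    refine le_sInf fun q hq => ?_
    by_contra hne
    obtain ⟨d, hd, hd2⟩ := h q hq.2 fun h => hne h.ge
    exact hd (hq.1 hd2)
  obtain ⟨r, y, hy⟩ := hI (htu ▸ Ideal.subset_span (by simp) : t ∈ maximalIdeal A)
  obtain ⟨r', z, hz⟩ := hI (htu ▸ Ideal.subset_span (by simp) : u ∈ maximalIdeal A)
  have ht0 : algebraMap A K t ≠ 0 := by
    rw [Ne, map_eq_zero_iff _ hinj]
    exact ht.ne_zero
  have h1 : y * u ^ r' = z * t ^ r := by
    apply hinj
    rw [map_mul, map_mul, ← hy, ← hz]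
    ring
  have h2 : t ^ r ∣ y :=
    ht.pow_dvd_of_dvd_mul_right r (fun h => hu (ht.dvd_of_dvd_pow h)) ⟨z, by rw [h1, mul_comm]⟩
  obtain ⟨w, rfl⟩ := h2
  refine ⟨w, mul_right_cancel₀ (pow_ne_zero r ht0) ?_⟩
  rw [← map_pow, hy, map_mul, mul_comm]

end Normality

/-! ### The trace ideal -/

section TraceIdeal

/-- The ideal of the traces of integral elements. -/
def traceIdeal (A K L : Type*) [CommRing A] [Field K] [Algebra A K] [Field L] [Algebra K L]
    [Algebra A L] [IsScalarTower A K L] : Ideal A where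
  carrier := {d | ∃ b : L, IsIntegral A b ∧ algebraMap A K d = Algebra.trace K L b}
  zero_mem' := ⟨0, isIntegral_zero, by simp⟩
  add_mem' := by
    rintro d d' ⟨y, hy, h⟩ ⟨y', hy', h'⟩
    exact ⟨y + y', hy.add hy', by rw [map_add, map_add, h, h']⟩
  smul_mem' := by
    rintro c d ⟨y, hy, h⟩
    refine ⟨algebraMap A L c * y, isIntegral_algebraMap.mul hy, ?_⟩
    rw [smul_eq_mul, map_mul, h, IsScalarTower.algebraMap_apply A K L,
      ← Algebra.smul_def (algebraMap A K c) y, map_smul, smul_eq_mul]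

/-- An integral element over the localization with unit trace becomes integral over `A` after
multiplication by an element outside `q`, and its trace stays outside `q`. -/
theorem exists_mem_traceIdeal_notMem {A K L : Type*} [CommRing A] [IsIntegrallyClosed A] [Field K]
    [Algebra A K] [IsFractionRing A K] [Field L] [Algebra K L] [Algebra A L] [IsScalarTower A K L]
    [FiniteDimensional K L] [IsGalois K L] (q : Ideal A) [q.IsPrime]
    (S : Type*) [CommRing S] [IsDomain S] [IsLocalRing S] [IsNoetherianRing S]
    [IsIntegrallyClosed S] [Algebra A S] [IsLocalization.AtPrime S q] [Algebra S K]
    [IsScalarTower A S K] [IsFractionRing S K] [Algebra S L] [IsScalarTower S K L]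
    (hΩ : Subsingleton (Ω[integralClosure S L⁄S])) : ∃ d ∈ traceIdeal A K L, d ∉ q := by
  obtain ⟨b, c, hb, hc, hcb⟩ := exists_isUnit_trace (K := K) hΩ
  have : IsScalarTower A S L := IsScalarTower.of_algebraMap_eq fun y => by
    rw [IsScalarTower.algebraMap_apply A K L, IsScalarTower.algebraMap_apply A S K,
      ← IsScalarTower.algebraMap_apply S K L]
  obtain ⟨m, hm⟩ := IsIntegral.exists_multiple_integral_of_isLocalization q.primeCompl b hb
  obtain ⟨d, hd⟩ := IsIntegrallyClosed.isIntegral_iff.mp (Algebra.isIntegral_trace (L := K) hm)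
  refine ⟨d, ⟨_, hm, hd⟩, fun hdq => ?_⟩
  have h1 : algebraMap A S d = algebraMap A S m * c := by
    apply IsFractionRing.injective S K
    rw [← IsScalarTower.algebraMap_apply A S K, hd, map_mul,
      ← IsScalarTower.algebraMap_apply A S K, hcb, Submonoid.smul_def, Algebra.smul_def,
      IsScalarTower.algebraMap_apply A K L, ← Algebra.smul_def, map_smul, smul_eq_mul]
  have h2 : IsUnit (algebraMap A S d) := by
    rw [h1]
    exact (IsLocalization.map_units S m).mul hc
  exact (IsLocalization.AtPrime.isUnit_to_map_iff S q d).mp h2 hdq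

end TraceIdeal

/-! ### Integral elements of an Artin–Schreier extension -/

section Generation

variable {A K L : Type*} [CommRing A] [IsDomain A] [IsIntegrallyClosed A] [Field K] [Algebra A K]
  [IsFractionRing A K] [Field L] [Algebra K L] [Algebra A L] [IsScalarTower A K L]

open Polynomial in
-- The element `y = d (x - c)` is a root of a polynomial `f` over `A` whose derivative is the
-- constant `-d ^ (p - 1)`. Hence the discriminant of `y` divides a power of `d`, and this power
-- carries all integral elements into `A[y]`.
theorem exists_integral_generator (p : ℕ) [hp : Fact p.Prime] [CharP K p] {a c : K} {x : L}
    (hx : x ^ p - x = algebraMap K L a) (hL : IntermediateField.adjoin K {x} = ⊤) {d n : A}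
    (hd : d ≠ 0) (hn : (a - (c ^ p - c)) * algebraMap A K d = algebraMap A K n) :
    ∃ y : L, IsIntegral A y ∧
      y ^ p - algebraMap A L d ^ (p - 1) * y = algebraMap A L (d ^ (p - 1) * n) ∧
      ∀ b : L, IsIntegral A b → ∃ N : ℕ, algebraMap A L d ^ N * b ∈ Algebra.adjoin A {y} := by
  have : CharP L p := charP_of_injective_algebraMap (algebraMap K L).injective p
  obtain ⟨hfin, hgal⟩ := isGalois_artinSchreier p hx hL
  have hdK : algebraMap A K d ≠ 0 := by
    rwa [Ne, map_eq_zero_iff _ (IsFractionRing.injective A K)]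
  have hdL : algebraMap A L d ≠ 0 := by
    rw [IsScalarTower.algebraMap_apply A K L]
    rwa [Ne, map_eq_zero_iff _ (algebraMap K L).injective]
  have hinj : Function.Injective (algebraMap A L) := by
    rw [IsScalarTower.algebraMap_eq A K L]
    exact (algebraMap K L).injective.comp (IsFractionRing.injective A K)
  set y : L := algebraMap A L d * (x - algebraMap K L c) with hy
  obtain ⟨r, hr⟩ := Nat.exists_eq_add_of_le' hp.out.one_le
  have hnL : (x ^ p - x - (algebraMap K L c ^ p - algebraMap K L c)) * algebraMap A L d =
      algebraMap A L n := by
    rw [IsScalarTower.algebraMap_apply A K L, IsScalarTower.algebraMap_apply A K L n, ← hn, hx]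
    simp only [map_mul, map_sub, map_pow]
  have hyeq : y ^ p - algebraMap A L d ^ (p - 1) * y = algebraMap A L (d ^ (p - 1) * n) := by
    rw [map_mul, ← hnL, hy, mul_pow, sub_pow_char]
    rw [hr, Nat.add_sub_cancel, map_pow]
    ring
  set f : A[X] := X ^ p - C (d ^ (p - 1)) * X - C (d ^ (p - 1) * n) with hf
  have hfy : aeval y f = 0 := by
    simp only [hf, map_sub, map_mul, map_pow, aeval_X, aeval_C] at hyeq ⊢
    rw [hyeq, sub_self]
  have hfm : f.Monic := by
    rw [hf, sub_sub]
    refine monic_X_pow_sub (lt_of_le_of_lt degree_linear_le ?_)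
    exact_mod_cast hp.out.one_lt
  have hyint : IsIntegral A y := ⟨f, hfm, by simpa [aeval_def] using hfy⟩
  refine ⟨y, hyint, hyeq, fun b hb => ?_⟩
  have htop : IntermediateField.adjoin K {y} = ⊤ := by
    rw [eq_top_iff, ← hL, IntermediateField.adjoin_le_iff, Set.singleton_subset_iff]
    have h1 : x = algebraMap K L (algebraMap A K d)⁻¹ * y + algebraMap K L c := by
      rw [hy, map_inv₀, ← IsScalarTower.algebraMap_apply A K L, inv_mul_cancel_left₀ hdL]
      ring
    rw [h1]
    exact add_mem (mul_mem (IntermediateField.algebraMap_mem _ _)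
      (IntermediateField.mem_adjoin_simple_self K y)) (IntermediateField.algebraMap_mem _ _)
  let B : PowerBasis K L := PowerBasis.ofAdjoinEqTop (hyint.tower_top (A := K))
    (by rwa [← IntermediateField.adjoin_simple_eq_top_iff_of_isAlgebraic
      (hyint.tower_top (A := K)).isAlgebraic])
  have hB : B.gen = y := rfl
  have hdisc := Algebra.discr_mul_isIntegral_mem_adjoin K (B := B) (by rwa [hB]) hb
  have : FaithfulSMul A L := (faithfulSMul_iff_algebraMap_injective A L).mpr hinj
  have : Module.IsTorsionFree A L := .trans_faithfulSMul A K L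
  obtain ⟨g, hg⟩ := minpoly.isIntegrallyClosed_dvd hyint hfy
  -- `f` may be reducible, so it is written as the minimal polynomial times `g`. The norm of `f'(y)`
  -- is then the norm of the derivative of the minimal polynomial, which is the discriminant up to
  -- sign, times an element of `A`.
  have hnorm : ∃ (w : A) (N : ℕ),
      algebraMap A K d ^ N = algebraMap A K w * Algebra.discr K B.basis := by
    have h1 : aeval y (derivative f) = algebraMap K L (-algebraMap A K d ^ (p - 1)) := by
      have hpL : (p : L) = 0 := CharP.cast_eq_zero L p
      rw [map_neg, map_pow, ← IsScalarTower.algebraMap_apply A K L]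
      rw [hf, derivative_sub, derivative_sub, derivative_X_pow, derivative_C_mul, derivative_X,
        derivative_C, mul_one, sub_zero, map_sub, map_mul, aeval_C, aeval_C, map_natCast, hpL,
        zero_mul, zero_sub, map_pow]
    have h2 : aeval y (derivative f) = aeval y (minpoly K y).derivative * aeval y g := by
      rw [hg, derivative_mul, map_add, map_mul, map_mul, minpoly.aeval, zero_mul, add_zero,
        minpoly.isIntegrallyClosed_eq_field_fractions' K hyint, derivative_map,
        aeval_map_algebraMap]
    have h3 : IsIntegral A (Algebra.norm K (aeval y g)) := by
      refine Algebra.isIntegral_norm K ?_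
      exact adjoin_le_integralClosure hyint (aeval_mem_adjoin_singleton A y)
    obtain ⟨w, hw⟩ := IsIntegrallyClosed.isIntegral_iff.mp h3
    refine ⟨(-1) ^ Module.finrank K L * (-1) ^ (Module.finrank K L * (Module.finrank K L - 1) / 2) * w,
      (p - 1) * Module.finrank K L, ?_⟩
    have h4 := congrArg (Algebra.norm K) (h1.symm.trans h2)
    rw [Algebra.norm_algebraMap, map_mul, ← hw] at h4
    have h5 : ((-1 : K) ^ (Module.finrank K L * (Module.finrank K L - 1) / 2)) * (-1) ^ (Module.finrank K L * (Module.finrank K L - 1) / 2) = 1 := by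
      rw [← mul_pow]; simp
    have h6 : ((-1 : K) ^ Module.finrank K L) * (-1) ^ Module.finrank K L = 1 := by
      rw [← mul_pow]; simp
    rw [Algebra.discr_powerBasis_eq_norm, hB]
    rw [neg_pow, ← pow_mul] at h4
    simp only [map_mul, map_pow, map_neg, map_one]
    linear_combination ((-1 : K) ^ Module.finrank K L) * h4 -
      algebraMap A K d ^ ((p - 1) * Module.finrank K L) * h6 - (-1 : K) ^ Module.finrank K L *
      algebraMap A K w * Algebra.norm K (aeval y (minpoly K y).derivative) * h5
  obtain ⟨w, N, hw⟩ := hnorm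
  refine ⟨N, ?_⟩
  have h2 := Subalgebra.smul_mem _ hdisc w
  convert h2 using 1
  rw [hB] at *
  rw [IsScalarTower.algebraMap_apply A K L, ← map_pow, hw, ← Algebra.smul_def, mul_smul,
    algebraMap_smul]

end Generation

/-! ### Transport of the wild jumps along semilinear isomorphisms -/

section Transport

variable {R F M M' : Type*} [CommRing R] [Field F] [CommRing M] [CommRing M'] [Algebra R F]
  [Algebra F M] [Algebra R M] [IsScalarTower R F M] [Algebra F M'] [Algebra R M']
  [IsScalarTower R F M']

/-- Conjugation with a semilinear isomorphism. -/
def semilinearConj (φ : F ≃+* F) (e : M ≃+* M')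
    (he : ∀ x, e (algebraMap F M x) = algebraMap F M' (φ x)) : (M ≃ₐ[F] M) ≃* (M' ≃ₐ[F] M') where
  toFun g := AlgEquiv.ofRingEquiv (f := (e.symm.trans (g : M ≃+* M)).trans e) fun x => by
    obtain ⟨y, rfl⟩ := φ.surjective x
    change e (g (e.symm _)) = _
    rw [← he, e.symm_apply_apply, g.commutes]
  invFun g := AlgEquiv.ofRingEquiv (f := (e.trans (g : M' ≃+* M')).trans e.symm) fun x => by
    change e.symm (g (e _)) = _
    rw [he, g.commutes, ← he, e.symm_apply_apply]
  left_inv g := by ext; simp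
  right_inv g := by ext; simp
  map_mul' g h := by ext; simp

/-- A semilinear isomorphism restricts to the integral closures. -/
def semilinearIntegralClosure (σ : R ≃+* R) (e : M ≃+* M')
    (he : ∀ x, e (algebraMap R M x) = algebraMap R M' (σ x)) :
    integralClosure R M ≃+* integralClosure R M' where
  toFun x := ⟨e x, by
    have h : (algebraMap R M').comp (σ : R →+* R) = (e : M →+* M').comp (algebraMap R M) := by
      ext y; simp [he]
    have hx : (algebraMap R M).IsIntegralElem x := x.2
    obtain ⟨q, hq, hq2⟩ := hx
    refine ⟨q.map (σ : R →+* R), hq.map _, ?_⟩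
    rw [Polynomial.eval₂_map, h, ← RingHom.coe_coe e, ← Polynomial.hom_eval₂, hq2, map_zero]⟩
  invFun x := ⟨e.symm x, by
    have h : (algebraMap R M).comp (σ.symm : R →+* R) =
        (e.symm : M' →+* M).comp (algebraMap R M') := by
      ext y
      obtain ⟨y, rfl⟩ := σ.surjective y
      simp [← he]
    have hx : (algebraMap R M').IsIntegralElem x := x.2
    obtain ⟨q, hq, hq2⟩ := hx
    refine ⟨q.map (σ.symm : R →+* R), hq.map _, ?_⟩
    rw [Polynomial.eval₂_map, h, ← RingHom.coe_coe e.symm, ← Polynomial.hom_eval₂, hq2, map_zero]⟩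
  left_inv x := by ext; simp
  right_inv x := by ext; simp
  map_mul' x y := by ext; simp
  map_add' x y := by ext; simp

theorem map_jacobson_semilinear {O O' : Type*} [CommRing O] [CommRing O'] (e : O ≃+* O') (j : ℕ)
    (x : O) : e x ∈ Ideal.jacobson (⊥ : Ideal O') ^ j ↔ x ∈ Ideal.jacobson (⊥ : Ideal O) ^ j := by
  have h : Ideal.jacobson (⊥ : Ideal O') ^ j = (Ideal.jacobson (⊥ : Ideal O) ^ j).map e := by
    have h1 := Ideal.map_jacobson_of_bijective (f := (e : O →+* O')) e.bijective (I := ⊥)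
    rw [Ideal.map_bot] at h1
    rw [← h1, ← Ideal.map_pow]
    rfl
  rw [h]
  constructor
  · intro hx
    obtain ⟨y, hy, hyx⟩ := (Ideal.mem_map_iff_of_surjective e e.surjective).mp hx
    rwa [← e.injective hyx]
  · exact Ideal.mem_map_of_mem e

theorem mem_ramificationGroup_iff (j : ℕ) (g : M ≃ₐ[F] M) : g ∈ ramificationGroup R F M j ↔
    ∀ x : integralClosure R M, g • x - x ∈
      Ideal.jacobson (⊥ : Ideal (integralClosure R M)) ^ (j + 1) := Iff.rfl

theorem map_ramificationGroup (σ : R ≃+* R) (φ : F ≃+* F) (e : M ≃+* M')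
    (he : ∀ x, e (algebraMap F M x) = algebraMap F M' (φ x))
    (hσ : ∀ x, algebraMap R F (σ x) = φ (algebraMap R F x)) (j : ℕ) :
    (ramificationGroup R F M j).map (semilinearConj φ e he : _ →* _) =
      ramificationGroup R F M' j := by
  have heR : ∀ x, e (algebraMap R M x) = algebraMap R M' (σ x) := fun x => by
    rw [IsScalarTower.algebraMap_apply R F M, he, ← hσ, ← IsScalarTower.algebraMap_apply]
  let E := semilinearIntegralClosure σ e heR
  have key : ∀ (g : M ≃ₐ[F] M) (x : integralClosure R M),
      E (g • x - x) = semilinearConj φ e he g • E x - E x := by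
    intro g x
    apply Subtype.ext
    change e (g x - x) = e (g (e.symm (e x))) - e x
    rw [map_sub, e.symm_apply_apply]
  have h1 : ∀ g : M ≃ₐ[F] M, semilinearConj φ e he g ∈ ramificationGroup R F M' j ↔
      g ∈ ramificationGroup R F M j := by
    intro g
    rw [mem_ramificationGroup_iff, mem_ramificationGroup_iff, E.surjective.forall]
    refine forall_congr' fun x => ?_
    rw [← key, map_jacobson_semilinear]
  ext g
  obtain ⟨g, rfl⟩ := (semilinearConj φ e he).surjective g
  rw [h1]
  exact Subgroup.mem_map_equiv.trans (by simp)

/-- Conjugation matches the ramification groups of the two extensions in every degree, so all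
indices and orders agree. Semilinearity is needed because the arcs coincide only after a change of
the parameter. -/
theorem wildJump_eq_of_semilinear (σ : R ≃+* R) (φ : F ≃+* F) (e : M ≃+* M')
    (he : ∀ x, e (algebraMap F M x) = algebraMap F M' (φ x))
    (hσ : ∀ x, algebraMap R F (σ x) = φ (algebraMap R F x)) (p i : ℕ) :
    wildJump R F M p i = wildJump R F M' p i := by
  have hinj : Function.Injective (semilinearConj φ e he : (M ≃ₐ[F] M) →* (M' ≃ₐ[F] M')) :=
    (semilinearConj φ e he).injective
  have h1 : tameIndex R F M = tameIndex R F M' := by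
    rw [tameIndex, tameIndex, ← map_ramificationGroup σ φ e he hσ 0,
      ← map_ramificationGroup σ φ e he hσ 1]
    exact (Subgroup.relIndex_map_map_of_injective _ _ hinj).symm
  have h2 : ∀ j, Nat.card (ramificationGroup R F M j) = Nat.card (ramificationGroup R F M' j) := by
    intro j
    rw [← map_ramificationGroup σ φ e he hσ j]
    exact (Subgroup.card_map_of_injective hinj).symm
  simp only [wildJump, ramificationJump, h1, h2]

end Transport

/-! ### Artin–Schreier fields -/

section ArtinSchreierField

/-- The field `E` is generated over `F` by a root of `T ^ p - T - α`. -/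
def IsArtinSchreier (p : ℕ) {F : Type*} [Field F] (α : F) (E : Type*) [CommRing E] [Algebra F E] :
    Prop :=
  ∃ y : E, y ^ p - y = algebraMap F E α ∧
    Subring.closure (Set.range (algebraMap F E) ∪ {y}) = ⊤

open Polynomial in
theorem IsArtinSchreier.isSplittingField {p : ℕ} [Fact p.Prime] {F E : Type*} [Field F] [CharP F p]
    {α : F} [Field E] [Algebra F E] (h : IsArtinSchreier p α E) :
    (X ^ p - X - C α : F[X]).IsSplittingField F E := by
  obtain ⟨y, hy, hgen⟩ := h
  refine isSplittingField_artinSchreier p hy (eq_top_iff.mpr fun z _ => ?_)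
  have hle : Subring.closure (Set.range (algebraMap F E) ∪ {y}) ≤
      (IntermediateField.adjoin F {y}).toSubring := by
    rw [Subring.closure_le, Set.union_subset_iff]
    refine ⟨?_, Set.singleton_subset_iff.mpr (IntermediateField.mem_adjoin_simple_self F y)⟩
    rintro _ ⟨w, rfl⟩
    exact IntermediateField.algebraMap_mem _ w
  rw [hgen] at hle
  exact hle (Subring.mem_top z)

theorem IsArtinSchreier.exists_ringEquiv {p : ℕ} [Fact p.Prime] {F E E' : Type*} [Field F]
    [CharP F p] {α : F} [Field E] [Algebra F E] [Field E'] (h : IsArtinSchreier p α E)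
    (ψ : F →+* E') {y : E'} (hy : y ^ p - y = ψ α)
    (hgen : Subring.closure (Set.range ψ ∪ {y}) = ⊤) :
    ∃ e : E ≃+* E', ∀ x, e (algebraMap F E x) = ψ x := by
  let _ : Algebra F E' := ψ.toAlgebra
  have hs := h.isSplittingField
  have hs' := IsArtinSchreier.isSplittingField (E := E') ⟨y, hy, hgen⟩
  let e := (Polynomial.IsSplittingField.algEquiv E
      (Polynomial.X ^ p - Polynomial.X - Polynomial.C α)).trans
    (Polynomial.IsSplittingField.algEquiv E'
      (Polynomial.X ^ p - Polynomial.X - Polynomial.C α)).symm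
  exact ⟨e, e.commutes⟩

/-- Shifting the root by `γ` makes `E'` an Artin–Schreier extension for `φ α` over `F` acting
through `φ`; splitting fields are unique. -/
theorem IsArtinSchreier.exists_semilinear {p : ℕ} [Fact p.Prime] {F E E' : Type*} [Field F]
    [CharP F p] {α α' γ : F} [Field E] [Algebra F E] [Field E'] [Algebra F E']
    (h : IsArtinSchreier p α E) (h' : IsArtinSchreier p α' E') (φ : F ≃+* F)
    (hφ : φ α = α' + (γ ^ p - γ)) :
    ∃ e : E ≃+* E', ∀ x, e (algebraMap F E x) = algebraMap F E' (φ x) := by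
  have : CharP E' p := charP_of_injective_algebraMap (algebraMap F E').injective p
  obtain ⟨y, hy, hgen⟩ := h'
  refine h.exists_ringEquiv ((algebraMap F E').comp (φ : F →+* F)) (y := y + algebraMap F E' γ) ?_ ?_
  · change _ = algebraMap F E' (φ α)
    rw [hφ, add_pow_char, map_add, ← hy, map_sub, map_pow]
    ring
  · rw [eq_top_iff, ← hgen, Subring.closure_le, Set.union_subset_iff, Set.singleton_subset_iff]
    have hF : ∀ w, algebraMap F E' w ∈ Subring.closure
        (Set.range ((algebraMap F E').comp (φ : F →+* F)) ∪ {y + algebraMap F E' γ}) := by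
      intro w
      obtain ⟨w, rfl⟩ := φ.surjective w
      exact Subring.subset_closure (Or.inl ⟨w, rfl⟩)
    constructor
    · rintro _ ⟨w, rfl⟩
      exact hF w
    · have h1 : y + algebraMap F E' γ ∈ Subring.closure
          (Set.range ((algebraMap F E').comp (φ : F →+* F)) ∪ {y + algebraMap F E' γ}) :=
        Subring.subset_closure (Or.inr (Set.mem_singleton _))
      have h2 := sub_mem h1 (hF γ)
      rwa [add_sub_cancel_right] at h2

open Polynomial in
-- The constant term is solved in the algebraically closed field `k`, and Hensel's lemma lifts the
-- root because the derivative of `T ^ p - T - β` is `-1`.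
theorem exists_pow_sub_self_eq {k : Type*} [Field k] [IsAlgClosed k] (p : ℕ) [hp : Fact p.Prime]
    [CharP k p] (β : k⟦X⟧) : ∃ γ : k⟦X⟧, γ ^ p - γ = β := by
  have : CharP k⟦X⟧ p :=
    charP_of_injective_ringHom (RingHom.injective (PowerSeries.C : k →+* k⟦X⟧)) p
  have hlt : (1 : WithBot ℕ) < p := by exact_mod_cast hp.out.one_lt
  have hmonic : ∀ c : k⟦X⟧, (X ^ p - X - C c : k⟦X⟧[X]).Monic := by
    intro c
    rw [sub_sub]
    refine monic_X_pow_sub (lt_of_le_of_lt ?_ hlt)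
    exact (degree_X_add_C _).le
  obtain ⟨c, hc⟩ := IsAlgClosed.exists_root (X ^ p - X - C (PowerSeries.constantCoeff β) : k[X]) (by
    rw [sub_sub, degree_sub_eq_left_of_degree_lt, degree_X_pow]
    · exact_mod_cast hp.out.ne_zero
    · rw [degree_X_pow]
      exact lt_of_le_of_lt (degree_X_add_C _).le hlt)
  have := IsAdicComplete.henselianRing k⟦X⟧ (Ideal.span {(PowerSeries.X : k⟦X⟧)})
  obtain ⟨γ, hγ, -⟩ := HenselianRing.is_henselian (I := Ideal.span {(PowerSeries.X : k⟦X⟧)})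
    (X ^ p - X - C β) (hmonic β) (PowerSeries.C c) (by
      rw [Ideal.mem_span_singleton, PowerSeries.X_dvd_iff]
      simpa [IsRoot] using hc) (by
      have h1 : derivative (X ^ p - X - C β : k⟦X⟧[X]) = -1 := by simp [derivative_X_pow]
      rw [h1]
      simp)
  refine ⟨γ, ?_⟩
  simpa [IsRoot, sub_eq_zero] using hγ

end ArtinSchreierField

/-! ### Fields in the generic fibre of an arc -/

section Fibre

theorem GenericFibre.exists_ringHom {k A : Type u} [Field k] [CommRing A] [IsLocalRing A]
    (f : A →+* k⟦X⟧) (B : Type v) [CommRing B] [Algebra A B] :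
    ∃ j : B →+* GenericFibre f B,
      (∀ a, j (algebraMap A B a) = algebraMap (LaurentSeries k) (GenericFibre f B)
        (algebraMap k⟦X⟧ (LaurentSeries k) (f a))) ∧
      Subring.closure (Set.range (algebraMap (LaurentSeries k) (GenericFibre f B)) ∪
        Set.range j) = ⊤ := by
  let _ : Algebra A (LaurentSeries k) := ((algebraMap k⟦X⟧ (LaurentSeries k)).comp f).toAlgebra
  let j : B →ₐ[A] (LaurentSeries k ⊗[A] B) := Algebra.TensorProduct.includeRight
  refine ⟨(j : B →+* (LaurentSeries k ⊗[A] B)), fun a => ?_, ?_⟩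
  · exact (j.commutes a)
  · refine eq_top_iff.mpr fun z _ => ?_
    change z ∈ Subring.closure (Set.range (algebraMap (LaurentSeries k) (LaurentSeries k ⊗[A] B)) ∪
        Set.range j)
    change (LaurentSeries k ⊗[A] B) at z
    induction z using TensorProduct.induction_on with
    | zero => exact zero_mem _
    | add x y hx hy => exact add_mem (hx trivial) (hy trivial)
    | tmul x y =>
      have h : (x ⊗ₜ y : LaurentSeries k ⊗[A] B) = algebraMap _ _ x * j y := by
        simp [j]
      rw [h]
      exact mul_mem (Subring.subset_closure (Or.inl ⟨x, rfl⟩))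
        (Subring.subset_closure (Or.inr ⟨y, rfl⟩))

/-- As `d` becomes invertible on the arc, the fibre depends only on `A[y][1/d]`. There the image of
`y / d` is a root for `f n / f d` and generates everything. -/
theorem isArtinSchreier_fibre {k A : Type u} [Field k] [CommRing A] [IsLocalRing A] (p : ℕ)
    [hp : Fact p.Prime] (f : A →+* k⟦X⟧) (B : Type v) [CommRing B] [Algebra A B] {y : B} {d n : A}
    (hd : f d ≠ 0)
    (hy : y ^ p - algebraMap A B d ^ (p - 1) * y = algebraMap A B (d ^ (p - 1) * n))
    (hgen : ∀ b : B, ∃ N : ℕ, algebraMap A B d ^ N * b ∈ Algebra.adjoin A {y})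
    (m : Ideal (GenericFibre f B)) :
    IsArtinSchreier p (algebraMap k⟦X⟧ (LaurentSeries k) (f n) /
      algebraMap k⟦X⟧ (LaurentSeries k) (f d)) (GenericFibre f B ⧸ m) := by
  obtain ⟨j', hj', hgen'⟩ := GenericFibre.exists_ringHom f B
  set q := Ideal.Quotient.mk m with hq
  set j : B →+* GenericFibre f B ⧸ m := q.comp j' with hj0
  set F := LaurentSeries k
  set φ : A →+* F := (algebraMap k⟦X⟧ F).comp f with hφ
  have hj : ∀ a, j (algebraMap A B a) = algebraMap F (GenericFibre f B ⧸ m) (φ a) := fun a =>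
    congrArg q (hj' a)
  have hd0 : φ d ≠ 0 := by
    rw [hφ, RingHom.comp_apply, Ne, map_eq_zero_iff _ (IsFractionRing.injective k⟦X⟧ F)]
    exact hd
  have hinv : algebraMap F (GenericFibre f B ⧸ m) (φ d)⁻¹ *
      algebraMap F (GenericFibre f B ⧸ m) (φ d) = 1 := by
    rw [← map_mul, inv_mul_cancel₀ hd0, map_one]
  obtain ⟨r, hr⟩ := Nat.exists_eq_add_of_le' hp.out.one_le
  have hy' := congrArg j hy
  simp only [map_sub, map_mul, map_pow, hj] at hy'
  refine ⟨algebraMap F _ (φ d)⁻¹ * j y, ?_, ?_⟩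
  · change _ = algebraMap F _ (φ n / φ d)
    rw [div_eq_mul_inv, map_mul]
    rw [hr, Nat.add_sub_cancel] at hy'
    rw [hr]
    set i := algebraMap F (GenericFibre f B ⧸ m) (φ d)⁻¹
    set D := algebraMap F (GenericFibre f B ⧸ m) (φ d)
    set N := algebraMap F (GenericFibre f B ⧸ m) (φ n)
    have hinv' : i ^ r * D ^ r = 1 := by rw [← mul_pow, hinv, one_pow]
    calc (i * j y) ^ (r + 1) - i * j y
        = i ^ (r + 1) * (j y ^ (r + 1) - D ^ r * j y) + i * j y * (i ^ r * D ^ r - 1) := by ring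
      _ = N * i * (i ^ r * D ^ r) := by rw [hy']; linear_combination (i * j y) * hinv'
      _ = N * i := by rw [hinv', mul_one]
  · set S := Subring.closure (Set.range (algebraMap F (GenericFibre f B ⧸ m)) ∪
      {algebraMap F _ (φ d)⁻¹ * j y}) with hS
    have hF : ∀ x, algebraMap F (GenericFibre f B ⧸ m) x ∈ S := fun x =>
      Subring.subset_closure (Or.inl ⟨x, rfl⟩)
    have hjy : j y ∈ S := by
      have h1 := mul_mem (hF (φ d)) (Subring.subset_closure (Or.inr (Set.mem_singleton _)) :
        algebraMap F _ (φ d)⁻¹ * j y ∈ S)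
      rwa [← mul_assoc, mul_comm (algebraMap F _ (φ d)), hinv, one_mul] at h1
    have hadj : ∀ b ∈ Algebra.adjoin A {y}, j b ∈ S := by
      intro b hb
      induction hb using Algebra.adjoin_induction with
      | mem b hb => rw [Set.mem_singleton_iff.mp hb]; exact hjy
      | algebraMap a => rw [hj]; exact hF _
      | add b c _ _ hb hc => rw [map_add]; exact add_mem hb hc
      | mul b c _ _ hb hc => rw [map_mul]; exact mul_mem hb hc
    have hjS : ∀ b, j b ∈ S := by
      intro b
      obtain ⟨N, hN⟩ := hgen b
      have h1 := mul_mem (pow_mem (hF (φ d)⁻¹) N) (hadj _ hN)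
      rwa [map_mul, map_pow, hj, ← mul_assoc, ← mul_pow, hinv, one_pow, one_mul] at h1
    have hle : Subring.closure (Set.range (algebraMap F (GenericFibre f B)) ∪ Set.range j') ≤
        S.comap q := by
      rw [Subring.closure_le, Set.union_subset_iff]
      constructor
      · rintro _ ⟨x, rfl⟩
        exact hF x
      · rintro _ ⟨b, rfl⟩
        exact hjS b
    rw [hgen'] at hle
    refine eq_top_iff.mpr fun z _ => ?_
    obtain ⟨z, rfl⟩ := Ideal.Quotient.mk_surjective z
    exact hle (Subring.mem_top z)

end Fibre

/-! ### Primes of the local rings of a scheme -/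

section Stalks

variable {X : Scheme.{u}}

instance {F P : X} (h : F ⤳ P) : (primeAt h).IsPrime := by
  rw [primeAt]; infer_instance

theorem fromSpecStalk_primeAt {F P : X} (h : F ⤳ P) :
    X.fromSpecStalk P (⟨primeAt h, inferInstance⟩ : PrimeSpectrum (X.presheaf.stalk P)) = F := by
  have h1 := Scheme.fromSpecStalk_closedPoint (x := F)
  rw [← Scheme.SpecMap_stalkSpecializes_fromSpecStalk h] at h1
  exact h1

theorem primeAt_congr {F F' P : X} (h : F ⤳ P) (h' : F' ⤳ P) (he : primeAt h = primeAt h') :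
    F = F' := by
  rw [← fromSpecStalk_primeAt h, ← fromSpecStalk_primeAt h']
  congr 1
  exact PrimeSpectrum.ext he

theorem primeAt_eq_iff {F P : X} (h : F ⤳ P) (q : PrimeSpectrum (X.presheaf.stalk P)) :
    primeAt h = q.asIdeal ↔ X.fromSpecStalk P q = F := by
  constructor
  · intro he
    conv_rhs => rw [← fromSpecStalk_primeAt h]
    congr 1
    exact PrimeSpectrum.ext he.symm
  · intro he
    have hinj : Function.Injective (X.fromSpecStalk P) :=
      (X.fromSpecStalk P).isEmbedding.injective
    have := hinj (he.trans (fromSpecStalk_primeAt h).symm)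
    rw [this]

theorem exists_primeAt_eq {P : X} (q : Ideal (X.presheaf.stalk P)) [hq : q.IsPrime] :
    ∃ (F : X) (h : F ⤳ P), primeAt h = q := by
  have h1 : X.fromSpecStalk P (⟨q, hq⟩ : PrimeSpectrum (X.presheaf.stalk P)) ⤳ P := by
    have : X.fromSpecStalk P (⟨q, hq⟩ : PrimeSpectrum (X.presheaf.stalk P)) ∈
      Set.range (X.fromSpecStalk P) := ⟨_, rfl⟩
    rwa [Scheme.range_fromSpecStalk] at this
  exact ⟨_, h1, (primeAt_eq_iff h1 ⟨q, hq⟩).mpr rfl⟩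

theorem primeAt_refl (P : X) : primeAt (specializes_refl P) = maximalIdeal _ := by
  rw [primeAt]
  simp only [TopCat.Presheaf.stalkSpecializes_refl]
  rfl

theorem algebraMap_stalkSpecializes [IsIntegral X] {F P : X} (h : F ⤳ P)
    (a : X.presheaf.stalk P) :
    algebraMap (X.presheaf.stalk F) X.functionField ((X.presheaf.stalkSpecializes h).hom a) =
      algebraMap (X.presheaf.stalk P) X.functionField a := by
  simp only [RingHom.algebraMap_toAlgebra]
  rw [← CommRingCat.comp_apply, TopCat.Presheaf.stalkSpecializes_comp]

/-- An affine neighbourhood of `P` also contains `F`. Elements of the stalk at `F` are fractions of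
its sections, whose germs already exist at `P`; injectivity is seen in the function field. -/
theorem isLocalization_stalkSpecializes [IsIntegral X] {F P : X} (h : F ⤳ P) :
    letI := (X.presheaf.stalkSpecializes h).hom.toAlgebra
    IsLocalization.AtPrime (X.presheaf.stalk F) (primeAt h) := by
  obtain ⟨_, ⟨U, hU, rfl⟩, hPU, -⟩ :=
    X.isBasis_affineOpens.exists_subset_of_mem_open (Set.mem_univ P) isOpen_univ
  have hFU : F ∈ U := h.mem_open U.2 hPU
  let _ := (X.presheaf.stalkSpecializes h).hom.toAlgebra
  have hinj : Function.Injective (X.presheaf.stalkSpecializes h).hom := by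
    intro a b hab
    apply IsFractionRing.injective (X.presheaf.stalk P) X.functionField
    rw [← algebraMap_stalkSpecializes h, ← algebraMap_stalkSpecializes h, hab]
  have hgerm : ∀ d : Γ(X, U), (X.presheaf.stalkSpecializes h).hom (X.presheaf.germ U P hPU d) =
      X.presheaf.germ U F hFU d := by
    intro d
    rw [← TopCat.Presheaf.germ_stalkSpecializes (F := X.presheaf) (U := U) hPU h]
    rfl
  let _ : Algebra Γ(X, U) (X.presheaf.stalk F) :=
    TopCat.Presheaf.algebra_section_stalk X.presheaf ⟨F, hFU⟩
  have h2 : IsLocalization (hU.primeIdealOf ⟨F, hFU⟩).asIdeal.primeCompl (X.presheaf.stalk F) :=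
    hU.isLocalization_stalk ⟨F, hFU⟩
  refine ⟨fun y => ?_, fun z => ?_, fun {a b} hab => ⟨1, by rw [hinj hab]⟩⟩
  · by_contra hy
    exact y.2 ((mem_maximalIdeal _).mpr hy)
  · obtain ⟨⟨y, d⟩, hyd⟩ :=
      IsLocalization.surj (hU.primeIdealOf ⟨F, hFU⟩).asIdeal.primeCompl z
    have hd : IsUnit (X.presheaf.germ U F hFU d) :=
      IsLocalization.map_units (X.presheaf.stalk F) d
    refine ⟨⟨X.presheaf.germ U P hPU y, ⟨X.presheaf.germ U P hPU d, fun hmem => ?_⟩⟩, ?_⟩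
    · have h3 : (X.presheaf.stalkSpecializes h).hom (X.presheaf.germ U P hPU d) ∈
        maximalIdeal (X.presheaf.stalk F) := hmem
      rw [hgerm] at h3
      exact h3 hd
    · exact (congrArg (z * ·) (hgerm d)).trans (hyd.trans (hgerm y).symm)

end Stalks

/-! ### The local homomorphism of an arc -/

section ArcHom

variable {k : Type u} [Field k] {X : Scheme.{u}} {s : X ⟶ Spec (.of k)}

theorem Arc.specializes_center (C : Arc s) {P : X} (h : C.center = P) :
    C.hom (⊥ : PrimeSpectrum k⟦X⟧) ⤳ P := by
  subst h
  exact (IsLocalRing.specializes_closedPoint _).map C.hom.continuous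

/-- This translates conditions on the image of the generic point into algebra: an arc avoids the
branch divisor precisely when its local equation has a nonzero image. -/
theorem Arc.primeAt_generic (C : Arc s) {P : X} (h : C.center = P) :
    primeAt (C.specializes_center h) = RingHom.ker (C.localHom P h) := by
  subst h
  have h1 : (RingHom.ker (C.localHom C.center rfl)).IsPrime := RingHom.ker_isPrime _
  refine (primeAt_eq_iff _ ⟨_, h1⟩).mpr ?_
  have h2 := Scheme.Spec_stalkClosedPointTo_fromSpecStalk C.hom
  have h3 : C.hom (⊥ : PrimeSpectrum k⟦X⟧) = X.fromSpecStalk _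
      (Spec.map (Scheme.stalkClosedPointTo C.hom) (⊥ : PrimeSpectrum k⟦X⟧)) :=
    (congrArg (fun φ : Spec (.of k⟦X⟧) ⟶ X => φ (⊥ : PrimeSpectrum k⟦X⟧)) h2).symm
  refine Eq.trans ?_ h3.symm
  change X.fromSpecStalk (C.hom (closedPoint k⟦X⟧)) _ = _
  congr 1
  refine PrimeSpectrum.ext ?_
  change RingHom.ker (C.localHom C.center rfl) = _
  rw [C.localHom_center]
  rfl

theorem Arc.not_maximalIdeal_le_ker (C : Arc s) {P : X} (h : C.center = P) :
    ¬ maximalIdeal (X.presheaf.stalk P) ≤ RingHom.ker (C.localHom P h) := by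
  intro hle
  rw [← C.primeAt_generic h, ← primeAt_refl P] at hle
  have h1 : primeAt (C.specializes_center h) = primeAt (specializes_refl P) := by
    refine le_antisymm ?_ hle
    rw [primeAt_refl]
    exact IsLocalRing.le_maximalIdeal (Ideal.IsPrime.ne_top inferInstance)
  have h2 := primeAt_congr _ _ h1
  exact C.nonconstant (h2.trans h.symm)

theorem stalkClosedPointTo_germ_constant (g : Spec (.of k⟦X⟧) ⟶ Spec (.of k))
    (hg : g = Spec.map (CommRingCat.ofHom (PowerSeries.C : k →+* k⟦X⟧))) (c : k) :
    (Scheme.stalkClosedPointTo g).hom ((Spec (.of k)).presheaf.germ ⊤ (g (closedPoint k⟦X⟧)) trivial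
      ((Scheme.ΓSpecIso (.of k)).inv c)) = PowerSeries.C c := by
  subst hg
  have h := Scheme.germ_stalkClosedPointTo_Spec
    (CommRingCat.ofHom (PowerSeries.C : k →+* k⟦X⟧))
  refine ((congrArg (fun φ => φ.hom ((Scheme.ΓSpecIso (.of k)).inv c)) h).trans ?_)
  simp

/-- The constants of the local rings. -/
theorem exists_constants (s : X ⟶ Spec (.of k)) (P : X) : ∃ κ : k →+* X.presheaf.stalk P,
    ∀ (C : Arc s) (h : C.center = P) (c : k), C.localHom P h (κ c) = PowerSeries.C c := by
  refine ⟨(s.stalkMap P).hom.comp (((Spec (.of k)).presheaf.germ ⊤ (s P) trivial).hom.comp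
    (Scheme.ΓSpecIso (.of k)).inv.hom), fun C h c => ?_⟩
  subst h
  rw [C.localHom_center]
  have h1 := stalkClosedPointTo_germ_constant (C.hom ≫ s) C.hom_comp c
  rw [Scheme.stalkClosedPointTo_comp] at h1
  exact h1

theorem Arc.coe_curve (C : Arc s) {P : X} (h : C.center = P) :
    (C.curve : Set k⟦X⟧) = (completedHom (C.localHom P h)).range := by
  subst h
  rfl

end ArcHom

/-! ### Comparison of Artin–Schreier classes of power series -/

section Difference

variable {R : Type*} [CommRing R]

/-- Divisibility of the error by `T t`, and not only by `T`, makes `t'` a multiple of `t` with a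
cofactor that is `1` modulo `T`. -/
theorem exists_pow_eq_pow_mul {t t' T Y : R} (h : Y ∣ t - t') (hT : T * t ∣ Y) (m : ℕ) :
    ∃ w, t' ^ m = t ^ m * (1 + T * w) := by
  obtain ⟨z, hz⟩ := h
  obtain ⟨y, hy⟩ := hT
  have h1 : t' = t * (1 + T * (-y * z)) := by linear_combination (-1 : R) * hz - z * hy
  have h2 : T ∣ (1 + T * (-y * z)) ^ m - 1 ^ m :=
    Dvd.dvd.trans ⟨-y * z, by ring⟩ (sub_dvd_pow_sub_pow _ _ _)
  obtain ⟨w, hw⟩ := h2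
  rw [one_pow] at hw
  refine ⟨w, ?_⟩
  rw [h1, mul_pow]
  linear_combination t ^ m * hw

/-- Up to a unit, `n / T - n' / T'` is `(n - n' + T w n) / T`, and both `n - n'` and `T w n` are
multiples of `T`. -/
theorem exists_sub_eq_mul_of_dvd [IsLocalRing R] {T T' n n' Y w : R} (hT : T ∣ Y)
    (hTu : ¬ IsUnit T) (hw : T' = T * (1 + T * w)) (h : Y ∣ n - n') :
    ∃ β, n * T' - n' * T = β * (T * T') := by
  obtain ⟨y, rfl⟩ := hT
  obtain ⟨z, hz⟩ := h
  have h1 : IsUnit (1 + T * w) := by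
    by_contra hcon
    have h2 : 1 + T * w - T * w ∈ maximalIdeal R :=
      sub_mem ((mem_maximalIdeal _).mpr hcon) (Ideal.mul_mem_right _ _ hTu)
    exact (maximalIdeal.isMaximal R).ne_top ((Ideal.eq_top_iff_one _).mpr (by rwa [add_sub_cancel_right] at h2))
  obtain ⟨e, he⟩ := h1.exists_right_inv
  refine ⟨(y * z + w * n) * e, ?_⟩
  rw [hw]
  linear_combination T * hz - (T ^ 2 * (y * z + w * n)) * he

end Difference

/-! ### Equality of wild jumps over a local ring -/

section LocalJumps

/-- By `hdiff` the class `f n / f d` and the `σ`-image of `g n / g d` differ by a power series,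
which is trivial in the Artin–Schreier sense. The residue fields of the two fibres are thus
isomorphic along `σ`. -/
theorem wildJump_fibre_eq {k A : Type u} [Field k] [IsAlgClosed k] (p : ℕ) [Fact p.Prime]
    [CharP k p] [CommRing A] [IsDomain A] [IsLocalRing A] [IsIntegrallyClosed A] {K : Type*}
    [Field K] [CharP K p] [Algebra A K] [IsFractionRing A K] {L : Type v} [Field L] [Algebra K L]
    [Algebra A L] [IsScalarTower A K L] {a c : K} {x : L} (hx : x ^ p - x = algebraMap K L a)
    (hL : IntermediateField.adjoin K {x} = ⊤) {d n : A} (hd : d ≠ 0)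
    (hn : (a - (c ^ p - c)) * algebraMap A K d = algebraMap A K n) (f g : A →+* k⟦X⟧)
    (σ : k⟦X⟧ ≃+* k⟦X⟧) (hfd : f d ≠ 0) (hgd : g d ≠ 0)
    (hdiff : ∃ β, f n * σ (g d) - σ (g n) * f d = β * (f d * σ (g d)))
    (m : Ideal (GenericFibre f (integralClosure A L))) (hm : m.IsMaximal)
    (m' : Ideal (GenericFibre g (integralClosure A L))) (hm' : m'.IsMaximal) (i : ℕ) :
    wildJump k⟦X⟧ (LaurentSeries k) (GenericFibre f (integralClosure A L) ⧸ m) p i =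
      wildJump k⟦X⟧ (LaurentSeries k) (GenericFibre g (integralClosure A L) ⧸ m') p i := by
  obtain ⟨y, hyint, hy, hgen⟩ := exists_integral_generator p hx hL hd hn
  set F := LaurentSeries k
  have hcharF : CharP F p := charP_of_injective_algebraMap (algebraMap k F).injective p
  let yB : integralClosure A L := ⟨y, hyint⟩
  have hyB : yB ^ p - algebraMap A (integralClosure A L) d ^ (p - 1) * yB =
      algebraMap A (integralClosure A L) (d ^ (p - 1) * n) := Subtype.ext hy
  have hgenB : ∀ b : integralClosure A L, ∃ N : ℕ,
      algebraMap A (integralClosure A L) d ^ N * b ∈ Algebra.adjoin A {yB} := by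
    intro b
    obtain ⟨N, hN⟩ := hgen b b.2
    refine ⟨N, ?_⟩
    have h1 : (Algebra.adjoin A {yB}).map (integralClosure A L).val = Algebra.adjoin A {y} := by
      rw [AlgHom.map_adjoin, Set.image_singleton]
      rfl
    rw [← h1] at hN
    obtain ⟨b', hb', hbb'⟩ := hN
    have h2 : b' = algebraMap A (integralClosure A L) d ^ N * b := Subtype.ext hbb'
    rwa [← h2]
  have h1 := isArtinSchreier_fibre p f _ hfd hyB hgenB m
  have h2 := isArtinSchreier_fibre p g _ hgd hyB hgenB m'
  let _ := Ideal.Quotient.field m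
  let _ := Ideal.Quotient.field m'
  let φ : F ≃+* F := IsFractionRing.ringEquivOfRingEquiv σ
  have hφ : ∀ z, φ (algebraMap k⟦X⟧ F z) = algebraMap k⟦X⟧ F (σ z) := fun z =>
    IsFractionRing.ringEquivOfRingEquiv_algebraMap σ z
  obtain ⟨β, hβ⟩ := hdiff
  obtain ⟨γ, hγ⟩ := exists_pow_sub_self_eq p (-β)
  have hinj := IsFractionRing.injective k⟦X⟧ F
  have hfd0 : algebraMap k⟦X⟧ F (f d) ≠ 0 := by rwa [Ne, map_eq_zero_iff _ hinj]
  have hgd0 : algebraMap k⟦X⟧ F (σ (g d)) ≠ 0 := by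
    rwa [Ne, map_eq_zero_iff _ hinj, map_eq_zero_iff _ σ.injective]
  have hα : φ (algebraMap k⟦X⟧ F (g n) / algebraMap k⟦X⟧ F (g d)) =
      algebraMap k⟦X⟧ F (f n) / algebraMap k⟦X⟧ F (f d) +
        (algebraMap k⟦X⟧ F γ ^ p - algebraMap k⟦X⟧ F γ) := by
    rw [← map_pow, ← map_sub, hγ, map_div₀, hφ, hφ, map_neg]
    have h3 := congrArg (algebraMap k⟦X⟧ F) hβ
    simp only [map_sub, map_mul] at h3
    rw [← sub_eq_iff_eq_add', div_sub_div _ _ hgd0 hfd0, div_eq_iff (mul_ne_zero hgd0 hfd0)]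
    linear_combination (-1 : F) * h3
  obtain ⟨e, he⟩ := h2.exists_semilinear h1 φ hα
  exact (wildJump_eq_of_semilinear σ φ e he (fun z => (hφ z).symm) p i).symm

end LocalJumps

/-! ### Representatives of an Artin–Schreier class -/

section Representatives

variable {A K L : Type*} [CommRing A] [IsDomain A]
  [Field K] [Algebra A K] [IsFractionRing A K] [Field L] [Algebra K L] [Algebra A L]
  [IsScalarTower A K L] {a : K} {x : L}

/-- Every prime containing the trace ideal contains `ρ`, so a power of `ρ` is the trace of an
integral element. -/
theorem exists_representative (p : ℕ) [Fact p.Prime] [CharP K p] [IsIntegrallyClosed A]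
    (hx : x ^ p - x = algebraMap K L a) (hL : IntermediateField.adjoin K {x} = ⊤) {ρ : A}
    (hρ : ρ ≠ 0)
    (hJ : ∀ q : Ideal A, q.IsPrime → ρ ∉ q → ∃ d ∈ traceIdeal A K L, d ∉ q) :
    ∃ (N : ℕ) (c : K) (n : A), (a - (c ^ p - c)) * algebraMap A K (ρ ^ N) = algebraMap A K n := by
  obtain ⟨hfin, hgal⟩ := isGalois_artinSchreier p hx hL
  have hrad : ρ ∈ (traceIdeal A K L).radical := by
    rw [Ideal.radical_eq_sInf, Ideal.mem_sInf]
    intro q hq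
    by_contra hne
    obtain ⟨d, hd, hd2⟩ := hJ q hq.2 hne
    exact hd2 (hq.1 hd)
  obtain ⟨N, b, hb, hbρ⟩ := hrad
  obtain ⟨c, n, hn⟩ := exists_artinSchreier_representative p hx (pow_ne_zero N hρ) hb hbρ
  exact ⟨N * p, c, n, by rw [pow_mul, map_pow, hn]⟩

theorem exists_integral_representative (p : ℕ) [Fact p.Prime] [CharP K p] [IsLocalRing A]
    [IsNoetherianRing A] [IsIntegrallyClosed A]
    (hx : x ^ p - x = algebraMap K L a) (hL : IntermediateField.adjoin K {x} = ⊤)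
    (hΩ : Subsingleton (Ω[integralClosure A L⁄A])) :
    ∃ (c : K) (n : A), (a - (c ^ p - c)) * algebraMap A K 1 = algebraMap A K n := by
  obtain ⟨hfin, hgal⟩ := isGalois_artinSchreier p hx hL
  obtain ⟨b, d, hb, hd, hdb⟩ := exists_isUnit_trace (K := K) hΩ
  obtain ⟨N, c, n, hn⟩ := exists_representative p hx hL (one_ne_zero (α := A)) fun q hq _ =>
    ⟨d, ⟨b, hb, hdb⟩, fun hdq => hq.ne_top (Ideal.eq_top_of_isUnit_mem _ hdq hd)⟩
  exact ⟨c, n, by rw [← hn, one_pow]⟩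

theorem exists_le_poles (p : ℕ) [Fact p.Prime] [CharP K p] [IsLocalRing A] [IsNoetherianRing A]
    {t u : A}
    (ht : Prime t) (htu : ¬ t ∣ u) (hu : Prime u) (hut : ¬ u ∣ t)
    (hspan : Ideal.span {t, u} = maximalIdeal A) {M M' m m' : ℕ} {c : K} {n : A}
    (hn : (a - (c ^ p - c)) * algebraMap A K (t ^ M * u ^ M') = algebraMap A K n)
    {s z s' z' : A} (hs : ¬ t ∣ s) (hz : a * algebraMap A K (t ^ m * s) = algebraMap A K z)
    (hs' : ¬ u ∣ s') (hz' : a * algebraMap A K (u ^ m' * s') = algebraMap A K z') :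
    ∃ (c : K) (n : A), (a - (c ^ p - c)) * algebraMap A K (t ^ m * u ^ m') = algebraMap A K n := by
  obtain ⟨c₁, n₁, h₁⟩ := exists_le_pole p ht htu hspan hn hs hz
  rw [mul_comm (t ^ m)] at h₁
  obtain ⟨c₂, n₂, h₂⟩ := exists_le_pole p hu hut (by rw [Set.pair_comm]; exact hspan) h₁ hs' hz'
  exact ⟨c₂, n₂, by rw [← h₂, mul_comm (t ^ m)]⟩

/-- An Artin–Schreier extension is unramified if the right hand side of its equation is integral. -/
theorem subsingleton_kaehlerDifferential_artinSchreier (p : ℕ) [hp : Fact p.Prime] [CharP K p]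
    [IsIntegrallyClosed A]
    (hx : x ^ p - x = algebraMap K L a) (hL : IntermediateField.adjoin K {x} = ⊤) {n : A}
    (hn : a = algebraMap A K n) : Subsingleton (Ω[integralClosure A L⁄A]) := by
  have hcharA : CharP A p := (RingHom.charP_iff _ (IsFractionRing.injective A K) p).mpr ‹_›
  obtain ⟨y, hyint, hy, hgen⟩ := exists_integral_generator (A := A) (c := 0) (d := 1) p hx hL
    one_ne_zero (n := n) (by rw [hn]; simp [hp.out.ne_zero])
  simp only [map_one, one_pow, one_mul] at hy hgen
  set B := integralClosure A L
  let yB : B := ⟨y, hyint⟩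
  have hyB : yB ^ p - yB = algebraMap A B n := Subtype.ext hy
  have hBp : ((p : ℕ) : B) = 0 := by
    rw [← map_natCast (algebraMap A B) p, CharP.cast_eq_zero, map_zero]
  -- Differentiating `y ^ p - y = n` in characteristic `p` leaves `-dy = 0`. Since the denominator
  -- is `1`, the normalization is `A[y]`.
  have hDy : KaehlerDifferential.D A B yB = 0 := by
    have h1 := congrArg (KaehlerDifferential.D A B) hyB
    rw [map_sub, Derivation.leibniz_pow, Derivation.map_algebraMap, ← Nat.cast_smul_eq_nsmul B p,
      hBp, zero_smul, zero_sub, neg_eq_zero] at h1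
    exact h1
  have hadj : ∀ b ∈ Algebra.adjoin A {yB}, KaehlerDifferential.D A B b = 0 := by
    intro b hb
    induction hb using Algebra.adjoin_induction with
    | mem b hb => rw [Set.mem_singleton_iff.mp hb]; exact hDy
    | algebraMap a => exact Derivation.map_algebraMap _ _
    | add b c _ _ hb hc => rw [map_add, hb, hc, add_zero]
    | mul b c _ _ hb hc => rw [Derivation.leibniz, hb, hc, smul_zero, smul_zero, add_zero]
  have hD : ∀ b : B, KaehlerDifferential.D A B b = 0 := by
    intro b
    obtain ⟨N, hN⟩ := hgen b b.2
    have h1 : (Algebra.adjoin A {yB}).map B.val = Algebra.adjoin A {y} := by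
      rw [AlgHom.map_adjoin, Set.image_singleton]
      rfl
    rw [← h1] at hN
    obtain ⟨b', hb', hbb'⟩ := hN
    have h2 : b' = b := Subtype.ext hbb'
    rw [← h2]
    exact hadj b' hb'
  refine subsingleton_of_forall_eq 0 fun ω => ?_
  have h1 := KaehlerDifferential.span_range_derivation A B
  have h2 : Set.range (KaehlerDifferential.D A B) ⊆ {0} := by
    rintro _ ⟨b, rfl⟩
    exact hD b
  have h3 : ω ∈ Submodule.span B (Set.range (KaehlerDifferential.D A B)) := by
    rw [h1]; trivial
  have h4 := Submodule.span_mono h2 h3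
  simpa using h4

end Representatives

/-! ### Heights and orders in local rings -/

section Heights

variable {A : Type*} [CommRing A]

theorem height_le_one_of_ne_maximalIdeal [IsLocalRing A] (hd : ringKrullDim A = 2) (q : Ideal A) [q.IsPrime]
    (hq : q ≠ maximalIdeal A) : q.height ≤ 1 := by
  have h1 : q < maximalIdeal A :=
    lt_of_le_of_ne (IsLocalRing.le_maximalIdeal (Ideal.IsPrime.ne_top inferInstance)) hq
  have h2 := Ideal.height_add_one_le_of_lt_of_isPrime h1
  have h3 := IsLocalRing.maximalIdeal_height_eq_ringKrullDim (R := A)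
  rw [hd] at h3
  have h4 : (maximalIdeal A).height = 2 := WithBot.coe_injective h3
  rw [h4] at h2
  have h5 : q.height + 1 ≤ 1 + 1 := by rw [one_add_one_eq_two]; exact h2
  exact (ENat.add_le_add_iff_right ENat.one_ne_top).mp h5

theorem height_span_singleton_of_prime [IsDomain A] [IsNoetherianRing A] {t : A} (ht : Prime t) :
    (Ideal.span {t}).height = 1 := by
  have := (Ideal.span_singleton_prime ht.ne_zero).mpr ht
  refine le_antisymm ?_ (Ideal.one_le_height_span_singleton_of_mem_nonZeroDivisors
    (mem_nonZeroDivisors_of_ne_zero ht.ne_zero))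
  refine Ideal.height_le_one_of_isPrincipal_of_mem_minimalPrimes (Ideal.span {t}) _ ?_
  rw [Ideal.minimalPrimes_eq_subsingleton_self]
  rfl

end Heights

/-! ### Pole orders in discrete valuation rings -/

section Orders

theorem exists_mul_pow_eq_algebraMap {S K : Type*} [CommRing S] [IsDomain S]
    [IsDiscreteValuationRing S] [Field K] [Algebra S K] [IsFractionRing S K] {a : K} {n : ℤ}
    (ha : ∀ z, a ≠ algebraMap S K z)
    (hn : Ring.ordFrac S a = (Multiplicative.ofAdd n : Multiplicative ℤ)) {ϖ : S}
    (hϖ : Irreducible ϖ) : ∃ m : ℕ, 1 ≤ m ∧ (m : ℤ) = -n ∧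
      ∃ z, a * algebraMap S K ϖ ^ m = algebraMap S K z := by
  have hϖK : algebraMap S K ϖ ≠ 0 := by
    rw [Ne, map_eq_zero_iff _ (IsFractionRing.injective S K)]
    exact hϖ.ne_zero
  have h1 : Ring.ordFrac S (algebraMap S K ϖ ^ n) = Ring.ordFrac S a := by
    rw [map_zpow₀, Ring.ordFrac_irreducible hϖ, ← WithZero.exp_zsmul, hn]
    simp [WithZero.exp_eq_coe_ofAdd]
  obtain ⟨v, hv⟩ := Ring.associated_of_ordFrac_eq _ _ h1
  have hv' : a = algebraMap S K v * algebraMap S K ϖ ^ n := by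
    rw [← hv, Units.smul_def, Algebra.smul_def]
  rcases lt_or_ge n 0 with h | h
  · obtain ⟨m, hm⟩ := Int.exists_eq_neg_ofNat h.le
    refine ⟨m, by omega, by omega, v, ?_⟩
    rw [hv', hm, zpow_neg, zpow_natCast, mul_assoc, inv_mul_cancel₀ (pow_ne_zero _ hϖK), mul_one]
  · exfalso
    obtain ⟨m, rfl⟩ := Int.eq_ofNat_of_zero_le h
    refine ha (v * ϖ ^ m) ?_
    rw [hv', map_mul, map_pow, zpow_natCast]

end Orders

/-! ### Regular surfaces -/

section RegularSurface

open Classical in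
theorem IsRegularSurface.exists_span_eq_maximalIdeal {k : Type u} [Field k] {X : Scheme.{u}}
    [IsLocallyNoetherian X] {s : X ⟶ Spec (.of k)} (hX : IsRegularSurface s) {P : X}
    (hP : IsClosed {P}) :
    ∃ t u : X.presheaf.stalk P, Ideal.span {t, u} = maximalIdeal (X.presheaf.stalk P) := by
  have := hX.regular P
  have h1 := IsRegularLocalRing.spanFinrank_maximalIdeal (R := X.presheaf.stalk P)
  rw [hX.dim_eq_two P hP] at h1
  have h2 : (maximalIdeal (X.presheaf.stalk P)).spanFinrank = 2 := by exact_mod_cast h1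
  have hfg := (isNoetherianRing_iff_ideal_fg (X.presheaf.stalk P)).mp inferInstance
    (maximalIdeal (X.presheaf.stalk P))
  obtain ⟨S, hS, hS2⟩ := Submodule.FG.exists_span_finset_card_eq_spanFinrank hfg
  rw [h2] at hS
  obtain ⟨t, u, -, hS⟩ := Finset.card_eq_two.mp hS
  exact ⟨t, u, by rw [← hS2, hS, Finset.coe_pair]⟩

variable {k : Type u} [Field k] {X : Scheme.{u}} [IsIntegral X]
  {s : X ⟶ Spec (.of k)}

theorem ringKrullDim_stalk_eq_height {F P : X} (h : F ⤳ P) :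
    ringKrullDim (X.presheaf.stalk F) = (primeAt h).height := by
  let _ := (X.presheaf.stalkSpecializes h).hom.toAlgebra
  have := isLocalization_stalkSpecializes h
  exact IsLocalization.AtPrime.ringKrullDim_eq_height (primeAt h) (X.presheaf.stalk F)

theorem coheight_eq_height {F P : X} (h : F ⤳ P) : coheight F = (primeAt h).height := by
  have h1 := ringKrullDim_stalk_eq_height h
  rw [ringKrullDim_stalk_eq_coheight] at h1
  exact_mod_cast h1

theorem exists_mul_eq_of_specializes {F P : X} (h : F ⤳ P) (z : X.presheaf.stalk F) :
    ∃ y d : X.presheaf.stalk P, d ∉ primeAt h ∧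
      algebraMap _ X.functionField z * algebraMap _ X.functionField d =
        algebraMap _ X.functionField y := by
  let _ := (X.presheaf.stalkSpecializes h).hom.toAlgebra
  have := isLocalization_stalkSpecializes h
  obtain ⟨⟨y, d⟩, hyd⟩ := IsLocalization.surj (primeAt h).primeCompl z
  refine ⟨y, d, d.2, ?_⟩
  rw [← algebraMap_stalkSpecializes h, ← algebraMap_stalkSpecializes h, ← map_mul]
  exact congrArg _ hyd

/-- An integral right hand side would make the extension unramified at `F`. This is why all the
multiplicities `m_i` are positive. -/
theorem ne_algebraMap_of_mem_branchLocus (p : ℕ) [Fact p.Prime] [CharP X.functionField p]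
    {L : Type v} [Field L] [Algebra X.functionField L] {a : X.functionField} {x : L}
    (hx : x ^ p - x = algebraMap X.functionField L a)
    (hL : IntermediateField.adjoin X.functionField {x} = ⊤) {F : X}
    [IsIntegrallyClosed (X.presheaf.stalk F)] (hF : F ∈ branchLocus (X := X) L)
    (z : X.presheaf.stalk F) : a ≠ algebraMap (X.presheaf.stalk F) X.functionField z := by
  intro hz
  let _ : Algebra (X.presheaf.stalk F) L := ((algebraMap X.functionField L).comp
    (algebraMap (X.presheaf.stalk F) X.functionField)).toAlgebra
  have : IsScalarTower (X.presheaf.stalk F) X.functionField L := .of_algebraMap_eq' rfl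
  exact not_nontrivial_iff_subsingleton.mpr
    (subsingleton_kaehlerDifferential_artinSchreier p hx hL hz) hF

theorem IsRegularSurface.isIntegrallyClosed_of_specializes (hX : IsRegularSurface s) {F P : X}
    (hP : IsClosed {P}) (h : F ⤳ P) (hne : primeAt h ≠ maximalIdeal (X.presheaf.stalk P)) :
    IsIntegrallyClosed (X.presheaf.stalk F) := by
  have := hX.regular F
  refine isIntegrallyClosed_of_isRegularLocalRing ?_
  rw [ringKrullDim_stalk_eq_height h]
  exact_mod_cast height_le_one_of_ne_maximalIdeal (hX.dim_eq_two P hP) (primeAt h) hne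

variable [IsLocallyNoetherian X]

/-- At the generizations other than the closed point itself, the local rings have dimension at most
one and are normal by regularity. Integral elements thus lie in all of them, and two parameters
suffice to remove the denominators. -/
theorem IsRegularSurface.isIntegrallyClosed (hX : IsRegularSurface s) {P : X}
    (hP : IsClosed {P}) : IsIntegrallyClosed (X.presheaf.stalk P) := by
  obtain ⟨t, u, htu⟩ := hX.exists_span_eq_maximalIdeal hP
  obtain ⟨ht, hu⟩ := prime_of_span_eq_maximalIdeal (hX.dim_eq_two P hP) htu
  rw [isIntegrallyClosed_iff X.functionField]
  intro x hx
  refine mem_range_of_forall_prime ht hu htu fun q hq hne => ?_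
  obtain ⟨F, h, rfl⟩ := exists_primeAt_eq q
  have := hX.isIntegrallyClosed_of_specializes hP h hne
  let _ := (X.presheaf.stalkSpecializes h).hom.toAlgebra
  have : IsScalarTower (X.presheaf.stalk P) (X.presheaf.stalk F) X.functionField :=
    .of_algebraMap_eq fun y => (algebraMap_stalkSpecializes h y).symm
  obtain ⟨z, rfl⟩ := IsIntegrallyClosed.isIntegral_iff.mp (hx.tower_top (A := X.presheaf.stalk F))
  obtain ⟨y, d, hd, hyd⟩ := exists_mul_eq_of_specializes h z
  exact ⟨d, hd, y, hyd⟩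

theorem exists_trace_notMem_primeAt {L : Type v} [Field L] [Algebra X.functionField L]
    [FiniteDimensional X.functionField L] [IsGalois X.functionField L] {F P : X} (h : F ⤳ P)
    [IsIntegrallyClosed (X.presheaf.stalk P)] [IsIntegrallyClosed (X.presheaf.stalk F)]
    (hF : F ∉ branchLocus (X := X) L) :
    letI : Algebra (X.presheaf.stalk P) L := ((algebraMap X.functionField L).comp
      (algebraMap (X.presheaf.stalk P) X.functionField)).toAlgebra
    haveI : IsScalarTower (X.presheaf.stalk P) X.functionField L := .of_algebraMap_eq' rfl
    ∃ d ∈ traceIdeal (X.presheaf.stalk P) X.functionField L, d ∉ primeAt h := by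
  let _ : Algebra (X.presheaf.stalk P) L := ((algebraMap X.functionField L).comp
    (algebraMap (X.presheaf.stalk P) X.functionField)).toAlgebra
  have : IsScalarTower (X.presheaf.stalk P) X.functionField L := .of_algebraMap_eq' rfl
  let _ : Algebra (X.presheaf.stalk F) L := ((algebraMap X.functionField L).comp
    (algebraMap (X.presheaf.stalk F) X.functionField)).toAlgebra
  have : IsScalarTower (X.presheaf.stalk F) X.functionField L := .of_algebraMap_eq' rfl
  let _ := (X.presheaf.stalkSpecializes h).hom.toAlgebra
  have : IsScalarTower (X.presheaf.stalk P) (X.presheaf.stalk F) X.functionField :=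
    .of_algebraMap_eq fun y => (algebraMap_stalkSpecializes h y).symm
  have := isLocalization_stalkSpecializes h
  have hΩ : Subsingleton (Ω[integralClosure (X.presheaf.stalk F) L⁄X.presheaf.stalk F]) :=
    not_nontrivial_iff_subsingleton.mp hF
  exact exists_mem_traceIdeal_notMem (primeAt h) (X.presheaf.stalk F) hΩ

/-- The stalk at `F` is a discrete valuation ring with uniformizer `t`. The fraction of its elements
is cleared by some `d` prime to `t`, which may still carry the other poles of `a` through `P`. -/
theorem exists_pole_order (hX : IsRegularSurface s) (p : ℕ) [Fact p.Prime]
    [CharP X.functionField p] {L : Type v} [Field L] [Algebra X.functionField L]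
    {a : X.functionField} {x : L} (hx : x ^ p - x = algebraMap X.functionField L a)
    (hL : IntermediateField.adjoin X.functionField {x} = ⊤) {F P : X} (hP : IsClosed {P})
    (h : F ⤳ P) (hF : F ∈ branchLocus (X := X) L) {t : X.presheaf.stalk P} (ht : Prime t)
    (hFt : primeAt h = Ideal.span {t}) :
    ∃ m : ℕ, 1 ≤ m ∧ (m : ℤ) = -Scheme.ord a F ∧ ∃ y d : X.presheaf.stalk P, ¬ t ∣ d ∧
      a * algebraMap _ X.functionField (t ^ m * d) = algebraMap _ X.functionField y := by
  have hheight : (primeAt h).height = 1 := hFt ▸ height_span_singleton_of_prime ht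
  have hco : coheight F = 1 := (coheight_eq_height h).trans hheight
  have hne : primeAt h ≠ maximalIdeal (X.presheaf.stalk P) := by
    intro he
    have h1 := IsLocalRing.maximalIdeal_height_eq_ringKrullDim (R := X.presheaf.stalk P)
    rw [← he, hheight, hX.dim_eq_two P hP] at h1
    exact absurd h1 (by decide)
  have := hX.isIntegrallyClosed_of_specializes hP h hne
  have ha := ne_algebraMap_of_mem_branchLocus p hx hL hF
  let _ := (X.presheaf.stalkSpecializes h).hom.toAlgebra
  have := isLocalization_stalkSpecializes h
  have hmax : maximalIdeal (X.presheaf.stalk F) =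
      Ideal.span {algebraMap (X.presheaf.stalk P) (X.presheaf.stalk F) t} := by
    rw [← IsLocalization.AtPrime.map_eq_maximalIdeal (primeAt h), hFt, Ideal.map_span,
      Set.image_singleton]
  have ht0 : algebraMap (X.presheaf.stalk P) (X.presheaf.stalk F) t ≠ 0 := by
    intro h0
    apply ht.ne_zero
    apply IsFractionRing.injective (X.presheaf.stalk P) X.functionField
    rw [map_zero, ← algebraMap_stalkSpecializes h]
    exact (congrArg _ h0).trans (map_zero _)
  have hfield : ¬ IsField (X.presheaf.stalk F) := by
    rw [IsLocalRing.isField_iff_maximalIdeal_eq, hmax, Ideal.span_singleton_eq_bot]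
    exact ht0
  have hprinc : (maximalIdeal (X.presheaf.stalk F)).IsPrincipal := ⟨⟨_, hmax⟩⟩
  have hdvr : IsDiscreteValuationRing (X.presheaf.stalk F) :=
    ((IsDiscreteValuationRing.TFAE (X.presheaf.stalk F) hfield).out 4 0).mp hprinc
  have hirr := (IsDiscreteValuationRing.irreducible_iff_uniformizer _).mpr hmax
  have ha0 : a ≠ 0 := fun h0 => ha 0 (by rw [h0, map_zero])
  have hord := (Scheme.ord_eq_iff hco ha0).mp rfl
  obtain ⟨m, hm1, hm, z, hz⟩ := exists_mul_pow_eq_algebraMap ha hord hirr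
  obtain ⟨y, d, hd, hyd⟩ := exists_mul_eq_of_specializes h z
  refine ⟨m, hm1, hm, y, d, ?_, ?_⟩
  · rwa [hFt, Ideal.mem_span_singleton] at hd
  · rw [← hyd, ← hz, map_mul, map_pow]
    change _ = a * algebraMap _ X.functionField ((X.presheaf.stalkSpecializes h).hom t) ^ m * _
    rw [algebraMap_stalkSpecializes, mul_assoc]

end RegularSurface

/-! ### Intersection numbers -/

section Intersections

variable {k : Type u} [Field k] {X : Scheme.{u}} {s : X ⟶ Spec (.of k)}

theorem Arc.inter_eq (C D : Arc s) {P : X} (hC : C.center = P) (hD : D.center = P) :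
    C.inter D = D.degree * ⨅ g ∈ RingHom.ker (completedHom (D.localHom P hD)),
      (completedHom (C.localHom P hC) g).order := by
  subst hD
  rw [Arc.inter, dif_pos hC]

theorem Arc.interPrime_eq (C : Arc s) {P : X} (hC : C.center = P) {F : X} (h : F ⤳ P)
    {t : X.presheaf.stalk P} (ht : primeAt h = Ideal.span {t}) :
    C.interPrime F = (C.localHom P hC t).order := by
  subst hC
  rw [Arc.interPrime, dif_pos h]
  refine le_antisymm (iInf₂_le t (ht ▸ Ideal.mem_span_singleton_self t)) (le_iInf₂ fun g hg => ?_)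
  rw [ht, Ideal.mem_span_singleton] at hg
  obtain ⟨y, rfl⟩ := hg
  rw [← dvd_iff_order_le, map_mul]
  exact dvd_mul_right _ _

theorem Arc.interPrime_eq_zero (C : Arc s) {P : X} (hC : C.center = P) {F : X} (h : ¬ F ⤳ P) :
    C.interPrime F = 0 := by
  subst hC
  rw [Arc.interPrime, dif_neg h]

variable [IsIntegral X] [IsLocallyNoetherian X] (L : Type v) [Field L] [Algebra X.functionField L]

theorem Arc.interR0_eq_of_forall_eq (C : Arc s) {P : X} (hC : C.center = P) (a : X.functionField)
    {F : X} (hF : F ∈ branchLocus L) (hF1 : coheight F = 1)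
    (h : ∀ F' ∈ branchLocus (X := X) L, coheight F' = 1 → F' ⤳ P → F' = F) :
    C.interR0 L a = (-Scheme.ord a F + 1) * ((C.interPrime F).toNat : ℤ) := by
  rw [Arc.interR0, finsum_eq_single _ ⟨F, hF, hF1⟩]
  rintro ⟨F', hF', hF1'⟩ hne
  by_cases hs : F' ⤳ P
  · exact absurd (Subtype.ext (h F' hF' hF1' hs)) hne
  · simp [C.interPrime_eq_zero hC hs]

open Classical in
theorem Arc.interR0_eq_of_forall_eq_or (C : Arc s) {P : X} (hC : C.center = P)
    (a : X.functionField) {F F₂ : X} (hF : F ∈ branchLocus L) (hF1 : coheight F = 1)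
    (hF₂ : F₂ ∈ branchLocus L) (hF1₂ : coheight F₂ = 1) (hne : F ≠ F₂)
    (h : ∀ F' ∈ branchLocus (X := X) L, coheight F' = 1 → F' ⤳ P → F' = F ∨ F' = F₂) :
    C.interR0 L a = (-Scheme.ord a F + 1) * ((C.interPrime F).toNat : ℤ) +
      (-Scheme.ord a F₂ + 1) * ((C.interPrime F₂).toNat : ℤ) := by
  rw [Arc.interR0, finsum_eq_sum_of_support_subset
    (s := {⟨F, hF, hF1⟩, ⟨F₂, hF₂, hF1₂⟩}) _ ?_, Finset.sum_pair]
  · exact fun he => hne (congrArg Subtype.val he)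
  · rintro ⟨F', hF', hF1'⟩ hsup
    by_cases hs : F' ⤳ P
    · simpa [Subtype.ext_iff] using h F' hF' hF1' hs
    · exact absurd (by simp [C.interPrime_eq_zero hC hs]) hsup

end Intersections

/-! ### Comparison of arcs -/

section Comparison

variable {k : Type u} [Field k] {X : Scheme.{u}} {s : X ⟶ Spec (.of k)}

theorem Arc.equalWildJumps_of_forall [IsIntegral X] (L : Type v) [Field L]
    [Algebra X.functionField L] (p : ℕ) (C D : Arc s) {P : X} (hC : C.center = P)
    (hD : D.center = P)
    (h : ∀ (m : Ideal (GenericFibre (C.localHom P hC) (LocalNormalization L P)))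
      (m' : Ideal (GenericFibre (D.localHom P hD) (LocalNormalization L P))) (i : ℕ),
      m.IsMaximal → m'.IsMaximal →
      wildJump k⟦X⟧ (LaurentSeries k)
        (GenericFibre (C.localHom P hC) (LocalNormalization L P) ⧸ m) p i =
      wildJump k⟦X⟧ (LaurentSeries k)
        (GenericFibre (D.localHom P hD) (LocalNormalization L P) ⧸ m') p i) :
    Arc.EqualWildJumps L p C D := by
  have key : ∀ (D : Arc s) (P : X) (hD : D.center = P) (i : ℕ) (w : ℚ),
      (∀ m' : Ideal (GenericFibre (D.localHom P hD) (LocalNormalization L P)), m'.IsMaximal →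
        w = wildJump k⟦X⟧ (LaurentSeries k)
          (GenericFibre (D.localHom P hD) (LocalNormalization L P) ⧸ m') p i) →
      ∀ n : MaximalSpectrum (D.FibreRing L), w = D.wildJumpAt L p i n := by
    intro D P hD i w h n
    subst hD
    exact h n.asIdeal n.isMaximal
  intro m n i _
  subst hC
  exact key D _ hD i _ (fun m' hm' => h m.asIdeal m' i m.isMaximal hm') n

theorem Arc.exists_ringEquiv_congr [IsAlgClosed k] [IsLocallyNoetherian X] (p : ℕ) [Fact p.Prime]
    [CharP k p] (C D : Arc s) (hC : C.IsPrimitive) (hD : D.IsPrimitive) {P : X}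
    (hCP : C.center = P) (hDP : D.center = P) {t u : X.presheaf.stalk P}
    (htu : Ideal.span {t, u} = maximalIdeal (X.presheaf.stalk P)) {N : ℕ} (hN : 2 ≤ N)
    (h : (((N : ℤ) * D.mult + C.mult * D.mult * max C.resLength D.resLength : ℤ).toNat : ℕ∞)
      ≤ C.inter D) :
    ∃ σ : k⟦X⟧ ≃+* k⟦X⟧, ∀ b, (PowerSeries.X : k⟦X⟧) ^ N ∣
      C.localHom P hCP b - σ (D.localHom P hDP b) := by
  obtain ⟨κ, hκ⟩ := exists_constants s P
  have hC1 : curveDegree C.curve = 1 := hC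
  have hD1 : curveDegree D.curve = 1 := hD
  obtain ⟨τ, hτ, hτ1, hcong⟩ := exists_evalHom_congr_of_inter (κ := κ) p htu
    (C.not_maximalIdeal_le_ker hCP) (D.not_maximalIdeal_le_ker hDP) (hκ C hCP) (hκ D hDP)
    (C.coe_curve hCP) (D.coe_curve hDP) hC1 hD1 hN (by
      intro G hG
      have h1 : ((N : ℤ) * D.mult + C.mult * D.mult * max C.resLength D.resLength : ℤ).toNat =
          N * curveMultiplicity D.curve + curveMultiplicity C.curve * curveMultiplicity D.curve *
            max (resolutionLength C.curve) (resolutionLength D.curve) := by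
        rw [Arc.mult, Arc.mult, hC, hD, mul_one, mul_one, Arc.resLength, Arc.resLength]
        norm_cast
      rw [h1, C.inter_eq D hCP hDP, hD, Nat.cast_one, one_mul] at h
      exact h.trans (iInf₂_le G hG))
  exact ⟨RingEquiv.ofBijective (evalHom τ hτ) (evalHom_bijective hτ hτ1), hcong⟩

end Comparison

/-! ### Comparison over the local ring at the common center -/

section MainProof

/-- The precision `N` covers the order of the image of the denominator plus one further factor for
each component that occurs in it. By `exists_pow_eq_pow_mul` the two denominators then agree up to a
factor `1 + T w`, as `exists_sub_eq_mul_of_dvd` requires. -/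
theorem wildJump_fibre_eq_of_congr {k A : Type u} [Field k] [IsAlgClosed k] (p : ℕ) [Fact p.Prime]
    [CharP k p] [CommRing A] [IsDomain A] [IsLocalRing A] [IsIntegrallyClosed A] {K : Type*}
    [Field K] [CharP K p] [Algebra A K] [IsFractionRing A K] {L : Type v} [Field L] [Algebra K L]
    [Algebra A L] [IsScalarTower A K L] {a c : K} {x : L} (hx : x ^ p - x = algebraMap K L a)
    (hL : IntermediateField.adjoin K {x} = ⊤) {t u n : A} {m₁ m₂ : ℕ} (hm₁ : m₁ ≠ 0)
    (hn : (a - (c ^ p - c)) * algebraMap A K (t ^ m₁ * u ^ m₂) = algebraMap A K n)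
    (f g : A →+* k⟦X⟧) (σ : k⟦X⟧ ≃+* k⟦X⟧) {N : ℕ} (ht : ¬ IsUnit (f t))
    (hcong : ∀ b, (PowerSeries.X : k⟦X⟧) ^ N ∣ f b - σ (g b))
    (h₁ : f t ^ m₁ * f u ^ m₂ * f t ∣ PowerSeries.X ^ N)
    (h₂ : m₂ = 0 ∨ f t ^ m₁ * f u ^ m₂ * f u ∣ PowerSeries.X ^ N)
    (m : Ideal (GenericFibre f (integralClosure A L))) (hm : m.IsMaximal)
    (m' : Ideal (GenericFibre g (integralClosure A L))) (hm' : m'.IsMaximal) (i : ℕ) :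
    wildJump k⟦X⟧ (LaurentSeries k) (GenericFibre f (integralClosure A L) ⧸ m) p i =
      wildJump k⟦X⟧ (LaurentSeries k) (GenericFibre g (integralClosure A L) ⧸ m') p i := by
  set T := f t ^ m₁ * f u ^ m₂ with hT
  have hX0 : (PowerSeries.X : k⟦X⟧) ^ N ≠ 0 := pow_ne_zero _ PowerSeries.X_ne_zero
  have hfd : f (t ^ m₁ * u ^ m₂) = T := by rw [map_mul, map_pow, map_pow]
  have hT0 : T ≠ 0 := by
    intro h0
    rw [h0, zero_mul, zero_dvd_iff] at h₁
    exact hX0 h₁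
  have hTu : ¬ IsUnit T := fun h =>
    ht ((isUnit_pow_iff hm₁).mp (isUnit_of_mul_isUnit_left h))
  obtain ⟨w₁, hw₁⟩ := exists_pow_eq_pow_mul (hcong t) h₁ m₁
  obtain ⟨w₂, hw₂⟩ : ∃ w, σ (g u) ^ m₂ = f u ^ m₂ * (1 + T * w) := by
    rcases h₂ with rfl | h₂
    · exact ⟨0, by simp⟩
    · exact exists_pow_eq_pow_mul (hcong u) h₂ m₂
  have hw : σ (g (t ^ m₁ * u ^ m₂)) = T * (1 + T * (w₁ + w₂ + T * w₁ * w₂)) := by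
    rw [map_mul, map_mul, map_pow, map_pow, map_pow, map_pow, hw₁, hw₂, hT]
    ring
  -- `T` is a non-unit, so `1 + T w` cannot vanish; the congruence transfers the nonvanishing of the
  -- denominator from `f` to `g`.
  have hgd : g (t ^ m₁ * u ^ m₂) ≠ 0 := by
    intro h0
    rw [h0, map_zero] at hw
    have h3 := (mul_eq_zero.mp hw.symm).resolve_left hT0
    exact hTu (IsUnit.of_mul_eq_one (-(w₁ + w₂ + T * w₁ * w₂)) (by linear_combination (-1 : k⟦X⟧) * h3))
  have hd : t ^ m₁ * u ^ m₂ ≠ 0 := by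
    intro h0
    rw [h0, map_zero] at hfd
    exact hT0 hfd.symm
  refine wildJump_fibre_eq p hx hL hd hn f g σ (by rwa [hfd]) hgd ?_ m hm m' hm' i
  rw [hfd]
  exact exists_sub_eq_mul_of_dvd ((dvd_mul_right _ _).trans h₁) hTu hw (hcong n)

end MainProof

end ZhukovJets

end

open ZhukovJets in
theorem proposition6p1 {k : Type u} [Field k] [IsAlgClosed k] (p : ℕ) [Fact p.Prime] [CharP k p]
    {X : Scheme.{u}} [IsIntegral X] [IsLocallyNoetherian X]
    (s : X ⟶ Spec (.of k)) (hX : IsRegularSurface s)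
    {L : Type v} [Field L] [Algebra X.functionField L]
    (a : X.functionField) (x : L) (hx : x ^ p - x = algebraMap X.functionField L a)
    (hL : IntermediateField.adjoin X.functionField {x} = ⊤)
    (hR : IsSNC (branchLocus (X := X) L))
    (C D : Arc s) (hC : C.IsPrimitive) (hD : D.IsPrimitive)
    (hCU : C.IsAdmissible L) (hDU : D.IsAdmissible L) (hCD : C.center = D.center)
    (h : ((C.interR0 L a * D.mult + C.mult * D.mult * max C.resLength D.resLength : ℤ).toNat : ℕ∞)
      ≤ C.inter D) :
    Arc.EqualWildJumps L p C D := by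
  obtain ⟨P, hCP⟩ : ∃ P, C.center = P := ⟨_, rfl⟩
  have hDP : D.center = P := hCD ▸ hCP
  have hP : IsClosed {P} := hCP ▸ C.isClosed_center
  have hint := hX.isIntegrallyClosed hP
  have hdim := hX.dim_eq_two P hP
  obtain ⟨κ, hκ⟩ := exists_constants s P
  have hcharK : CharP X.functionField p := charP_of_injective_ringHom
    ((algebraMap (X.presheaf.stalk P) X.functionField).comp κ).injective p
  let _ : Algebra (X.presheaf.stalk P) L := ((algebraMap X.functionField L).comp
    (algebraMap (X.presheaf.stalk P) X.functionField)).toAlgebra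
  have : IsScalarTower (X.presheaf.stalk P) X.functionField L := .of_algebraMap_eq' rfl
  obtain ⟨hfin, hgal⟩ := isGalois_artinSchreier p hx hL
  set f := C.localHom P hCP with hf
  set g := D.localHom P hDP with hg
  refine Arc.equalWildJumps_of_forall L p C D hCP hDP fun m m' i hm hm' => ?_
  by_cases hPR : P ∈ branchLocus (X := X) L
  swap
  -- Off the branch locus there is a representative with denominator `1`. Any two power series
  -- differ by a power series, so no contact is needed and `σ` is the identity.
  · have hΩ : Subsingleton (Ω[integralClosure (X.presheaf.stalk P) L⁄X.presheaf.stalk P]) :=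
      not_nontrivial_iff_subsingleton.mp hPR
    obtain ⟨c, n, hn⟩ := exists_integral_representative p hx hL hΩ
    exact wildJump_fibre_eq p hx hL one_ne_zero hn f g (RingEquiv.refl _)
      (by rw [map_one]; exact one_ne_zero) (by rw [map_one]; exact one_ne_zero)
      ⟨f n - g n, by simp⟩ m hm m' hm' i
  obtain ⟨t, u, htu, hcases⟩ := hR P hPR hP
  have hut : Ideal.span {u, t} = maximalIdeal (X.presheaf.stalk P) := by
    rw [Set.pair_comm]; exact htu
  obtain ⟨ht, htnu⟩ := prime_of_span_eq_maximalIdeal hdim htu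
  obtain ⟨hu, hunt⟩ := prime_of_span_eq_maximalIdeal hdim hut
  have hgen : ∀ b : X.presheaf.stalk P, f b = 0 ↔ b ∈ primeAt (C.specializes_center hCP) := by
    intro b
    rw [C.primeAt_generic hCP, RingHom.mem_ker]
  have hprimes : ∀ w : X.presheaf.stalk P, Prime w → ∃ (F : X) (hF : F ⤳ P),
      primeAt hF = Ideal.span {w} ∧ coheight F = 1 := by
    intro w hw
    have := (Ideal.span_singleton_prime hw.ne_zero).mpr hw
    obtain ⟨F, hF, hFw⟩ := exists_primeAt_eq (Ideal.span {w})
    exact ⟨F, hF, hFw, by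
      rw [coheight_eq_height hF, hFw]; exact height_span_singleton_of_prime hw⟩
  have hunique : ∀ w : X.presheaf.stalk P, Prime w → ∀ (F : X) (hF : F ⤳ P),
      primeAt hF = Ideal.span {w} → ∀ (F' : X) (hF' : F' ⤳ P), coheight F' = 1 →
      w ∈ primeAt hF' → F' = F := by
    intro w hw F hF hFw F' hF' hco hmem
    refine primeAt_congr hF' hF ?_
    rw [hFw]
    refine Ideal.eq_span_singleton_of_height_eq_one ?_ hmem hw
    rw [← coheight_eq_height hF', hco]
  have hord : ∀ w ∈ maximalIdeal (X.presheaf.stalk P), f w ≠ 0 → ∃ e : ℕ, 1 ≤ e ∧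
      (f w).order = e ∧ f w ∣ PowerSeries.X ^ e := by
    intro w hw hw0
    obtain ⟨e, he⟩ := ENat.ne_top_iff_exists.mp ((PowerSeries.order_eq_top.not).mpr hw0)
    refine ⟨e, ?_, he.symm, ?_⟩
    · have h1 : (PowerSeries.X : k⟦X⟧) ^ 1 ∣ f w := by
        rw [pow_one, PowerSeries.X_dvd_iff]
        exact (constantCoeff_map_eq_zero f).mpr hw
      rw [X_pow_dvd_iff_le_order, ← he] at h1
      exact_mod_cast h1
    · rw [dvd_iff_order_le, ← he, PowerSeries.order_X_pow]
  have htm : t ∈ maximalIdeal (X.presheaf.stalk P) := ht.not_isUnit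
  have hum : u ∈ maximalIdeal (X.presheaf.stalk P) := hu.not_isUnit
  have hftu : ¬ IsUnit (f t) := fun h => htm (isUnit_of_map_unit f t h)
  have htrace : ∀ ρ ∈ maximalIdeal (X.presheaf.stalk P),
      (∀ (F : X) (hF : F ⤳ P), F ∈ branchLocus (X := X) L → ρ ∈ primeAt hF) →
      ∀ q : Ideal (X.presheaf.stalk P), q.IsPrime → ρ ∉ q →
        ∃ d ∈ traceIdeal (X.presheaf.stalk P) X.functionField L, d ∉ q := by
    intro ρ hρ hρR q hq hρq
    obtain ⟨F, hF, rfl⟩ := exists_primeAt_eq q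
    have hint' := hX.isIntegrallyClosed_of_specializes hP hF fun he => hρq (he ▸ hρ)
    exact exists_trace_notMem_primeAt hF fun hFR => hρq (hρR F hF hFR)
  rcases hcases with hcase | hcase
  · obtain ⟨F, hF, hFt, hF1⟩ := hprimes t ht
    have hFR : F ∈ branchLocus (X := X) L :=
      (hcase F hF).mpr (hFt ▸ Ideal.mem_span_singleton_self t)
    -- The kernel of `f` is the prime of the image of the generic point, which lies off the branch
    -- locus.
    have hft : f t ≠ 0 := fun h0 => hCU ((hcase _ (C.specializes_center hCP)).mpr ((hgen t).mp h0))
    obtain ⟨e, he1, he, heX⟩ := hord t htm hft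
    obtain ⟨m₁, hm1, hm1o, y, d, hd, hyd⟩ := exists_pole_order hX p hx hL hP hF hFR ht hFt
    have hR0 : C.interR0 L a = (((m₁ + 1) * e : ℕ) : ℤ) := by
      rw [C.interR0_eq_of_forall_eq L hCP a hFR hF1 fun F' hF'R hF'1 hF' =>
        hunique t ht F hF hFt F' hF' hF'1 ((hcase F' hF').mp hF'R), C.interPrime_eq hCP hF hFt,
        ← hm1o, ← hf, he, ENat.toNat_natCast]
      push_cast
      ring
    rw [hR0] at h
    -- Both `m₁` and `e` are at least `1`, so the precision `(m₁ + 1) e` is at least `2`, as needed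
    -- for an invertible change of the parameter.
    obtain ⟨σ, hσ⟩ := Arc.exists_ringEquiv_congr p C D hC hD hCP hDP htu (by nlinarith) h
    obtain ⟨M, c, n, hn⟩ := exists_representative p hx hL ht.ne_zero
      (htrace t htm fun F hF hFR => (hcase F hF).mp hFR)
    obtain ⟨c', n', hn'⟩ := exists_le_pole p ht htnu htu (M := M) (M' := 0) (c := c) (n := n)
      (by rwa [pow_zero, mul_one])
      hd hyd
    refine wildJump_fibre_eq_of_congr p hx hL (by omega) hn' f g σ hftu hσ ?_ (Or.inl rfl) m hm m' hm' i
    rw [pow_zero, mul_one, ← pow_succ, mul_comm, pow_mul]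
    exact pow_dvd_pow_of_dvd heX _
  · obtain ⟨F, hF, hFt, hF1⟩ := hprimes t ht
    obtain ⟨F₂, hF₂, hFu, hF₂1⟩ := hprimes u hu
    have hFR : F ∈ branchLocus (X := X) L := (hcase F hF).mpr
      (hFt ▸ Ideal.mul_mem_right _ _ (Ideal.mem_span_singleton_self t))
    have hF₂R : F₂ ∈ branchLocus (X := X) L := (hcase F₂ hF₂).mpr
      (hFu ▸ Ideal.mul_mem_left _ _ (Ideal.mem_span_singleton_self u))
    have hne : F ≠ F₂ := by
      rintro rfl
      rw [hFt] at hFu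
      exact htnu (Ideal.mem_span_singleton.mp (hFu ▸ Ideal.mem_span_singleton_self u))
    have hftu0 : f (t * u) ≠ 0 := fun h0 =>
      hCU ((hcase _ (C.specializes_center hCP)).mpr ((hgen _).mp h0))
    rw [map_mul] at hftu0
    obtain ⟨e, he1, he, heX⟩ := hord t htm (left_ne_zero_of_mul hftu0)
    obtain ⟨e₂, he₂1, he₂, he₂X⟩ := hord u hum (right_ne_zero_of_mul hftu0)
    obtain ⟨m₁, hm1, hm1o, y, d, hd, hyd⟩ := exists_pole_order hX p hx hL hP hF hFR ht hFt
    obtain ⟨m₂, hm2, hm2o, y₂, d₂, hd₂, hyd₂⟩ := exists_pole_order hX p hx hL hP hF₂ hF₂R hu hFu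
    have hR0 : C.interR0 L a = (((m₁ + 1) * e + (m₂ + 1) * e₂ : ℕ) : ℤ) := by
      rw [C.interR0_eq_of_forall_eq_or L hCP a hFR hF1 hF₂R hF₂1 hne fun F' hF'R hF'1 hF' => ?_,
        C.interPrime_eq hCP hF hFt, C.interPrime_eq hCP hF₂ hFu, ← hm1o, ← hm2o, ← hf, he, he₂,
        ENat.toNat_natCast, ENat.toNat_natCast]
      · push_cast
        ring
      · rcases (Ideal.IsPrime.mem_or_mem inferInstance ((hcase F' hF').mp hF'R)) with h' | h'
        · exact Or.inl (hunique t ht F hF hFt F' hF' hF'1 h')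
        · exact Or.inr (hunique u hu F₂ hF₂ hFu F' hF' hF'1 h')
    rw [hR0] at h
    obtain ⟨σ, hσ⟩ := Arc.exists_ringEquiv_congr p C D hC hD hCP hDP htu (by nlinarith) h
    obtain ⟨M, c, n, hn⟩ := exists_representative p hx hL (mul_ne_zero ht.ne_zero hu.ne_zero)
      (htrace (t * u) (Ideal.mul_mem_right _ _ htm) fun F hF hFR => (hcase F hF).mp hFR)
    rw [mul_pow] at hn
    obtain ⟨c', n', hn'⟩ := exists_le_poles p ht htnu hu hunt htu hn hd hyd hd₂ hyd₂
    have hdiv : f t ^ m₁ * f u ^ m₂ ∣ PowerSeries.X ^ (e * m₁ + e₂ * m₂) := by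
      rw [pow_add, pow_mul, pow_mul]
      exact mul_dvd_mul (pow_dvd_pow_of_dvd heX _) (pow_dvd_pow_of_dvd he₂X _)
    refine wildJump_fibre_eq_of_congr p hx hL (by omega) hn' f g σ hftu hσ ?_ (Or.inr ?_) m hm m' hm' i
    -- The orders `e m₁ + e₂ m₂ + e` and, below, `e m₁ + e₂ m₂ + e₂` are both at most `(m₁ + 1) e +
    -- (m₂ + 1) e₂ = (𝒞.R₀)`.
    · refine (mul_dvd_mul hdiv heX).trans ?_
      rw [← pow_add]
      exact pow_dvd_pow _ (by nlinarith)
    · refine (mul_dvd_mul hdiv he₂X).trans ?_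
      rw [← pow_add]
      exact pow_dvd_pow _ (by nlinarith)
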